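/- **Setting.** Let $n\ge 2$, $r\ge1$, and let $X^*=[x^*_1,\dots,x^*_q]\in\mathbb R^{n\times q}$ have rank $r$ and reduced SVD $X^*=U^*\Sigma V^{*\top}$. Put $B^*=\Sigma V^{*\top}$ with columns $b^*_k$, let $\sigma_{\max},\sigma_{\min}$ be the largest and smallest diagonal entries of $\Sigma$, and let $\kappa=\sigma_{\max}/\sigma_{\min}$. Assume $\max_k\|b^*_k\|\le\mu\sqrt{r/q}\,\sigma_{\max}$ for some $\mu\ge1$. There are $L=\tilde L\rho$ nodes, split into $\tilde L$ mini-batches of $\rho\ge1$ nodes; node $(\vartheta,\ell)$ is the $\ell$-th node of mini-batch $\vartheta$. Each node $\ell$ has matrices $(A_k)_\ell\in\mathbb R^{\tilde m\times n}$, $k\in[q]$, and $(y_k)_\ell=(A_k)_\ell x^*_k$, and a second, independent set of such data used only for the threshold; all entries of all matrices are i.i.d. standard Gaussian. Put $m=L\tilde m$. A fixed set of at most $\tau L$ nodes, $\tau<0.4\,\tilde L/L$, is Byzantine: at each communication these nodes send arbitrary (measurable) functions of the data of all nodes and of the random choices the center has made before. **Algorithm.** Good nodes send $\alpha_\ell=\frac{9\kappa^2\mu^2}{\tilde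 m q}\sum_k\|(y_k)_\ell\|^2$ (from the threshold data); the center sets $\alpha=\mathrm{Median}_{\vartheta}\{\frac1\rho\sum_{\ell}\alpha_{(\vartheta,\ell)}\}$. Let $(X_0)_\ell=\sum_k(A_k)_\ell^\top((y_k)_\ell)_{\rm trunc}e_k^\top$, where truncation sets entries with $|y|>\sqrt\alpha$ to $0$. The center draws an $n\times r$ matrix $U_{\rm rand}$ with i.i.d. standard Gaussian entries and sets $U_{(\vartheta)}=U_{\rm rand}$ for all $\vartheta$. For $T_{pow}$ iterations and every $\vartheta$: the nodes of mini-batch $\vartheta$ send $V_\ell=(X_0)_\ell^\top U_{(\vartheta)}$, the center returns $V_{(\vartheta)}=\sum_{\ell}V_{(\vartheta,\ell)}$, the nodes send $U_\ell=(X_0)_\ell V_{(\vartheta)}$, and the center returns $U_{(\vartheta)}\leftarrow QR(\sum_\ell U_{(\vartheta,\ell)})$, the orthonormal factor of a QR decomposition. Finally (Subspace Median) the center orthonormalizes the $U_{(\vartheta)}$ by QR, computes an approximate geometric median $P_{gm}$ of the projection matrices $U_{(\vartheta)}U_{(\vartheta)}^\top$ (as vectors in $\mathbb R^{n^2}$),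 and outputs as $U_{out}$ a $U_{(\vartheta)}$ that minimizes $\|U_{(\vartheta)}U_{(\vartheta)}^\top-P_{gm}\|_F$. The approximate geometric median of points $z_1,\dots,z_{\tilde L}$ is computed by the path following algorithm of Cohen et al. with $T_{gm}$ iterations: with $f(x)=\sum_i\|x-z_i\|$, $x^{(0)}=\frac1{\tilde L}\sum_i z_i$, $t_i=\frac{1}{400f(x^{(0)})}(1+\frac1{600})^{i-1}$ and $f_t(x)=\sum_i\big(g_i-\log(1+g_i)\big)$, $g_i=\sqrt{1+t^2\|x-z_i\|^2}$, its (randomized) line searches produce $x^{(i)}$, $1\le i\le T_{gm}+1$, and the output is $x^{(T_{gm}+1)}$ (or $x^{(0)}$ if $f(x^{(0)})=0$). It has failure probability at most $c_{approxGM}\ge0$: on every fixed input with $f(x^{(0)})\neq0$, with probability at least $1-c_{approxGM}$ over its internal randomness (which is independent of everything else), each $x^{(i)}$, $1\le i\le T_{gm}+1$, is within $\epsilon_c/t_i$ of the minimizer of $f_{t_i}$, where $\epsilon_c\in(0,1]$ is its tolerance parameter. For $U_1,U_2$ with orthonormal columns let $SD_F(U_1,U_2)=\|(I-U_1U_1^\top)U_2\|_F$,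 and let $\psi(a,b)=(1-a)\log\frac{1-a}{1-b}+a\log\frac ab$. **Statement.** There are numerical constants $C_0,K\ge1$ and $c,c'\in(0,1)$ such that the following holds in every such setting, for every $\delta_0\in(0,1)$ and all $C_s,C_{pow},C_{gm}\ge C_0$. Let $T_{gm}=\lceil C_{gm}\log\frac{Lr}{\delta_0}\rceil$, $T_{pow}=\lceil C_{pow}\kappa^2\log\frac n{\delta_0}\rceil$, and assume $$mq\ \ge\ C_s\,\tilde L\cdot\kappa^6\mu^2(n+q)r^2/\delta_0^2 .$$ 1. With probability at least $$1-c_{approxGM}-\exp\!\big(-\tilde L\,\psi(0.4-\tau L/\tilde L,\ e^{-c(n+q)}+n^{-10})\big)-n^{-10}-L\exp\!\big(-c'\tilde m q\,\delta_0^2/(r^2\kappa^4\mu^2)\big),$$ $SD_F(U^*,U_{out})\le\delta_0$. 2. If moreover $C_s,C_{pow}\ge C_0L$ (that is, if $L$ is treated as a numerical constant, on which the constants may depend), then $SD_F(U^*,U_{out})\le\delta_0$ with probability at least $$1-c_{approxGM}-\exp\!\big(-L\,\psi(0.4-\tau,\ e^{-c(n+q)}+n^{-10})\big)-L\exp\!\big(-c'\tilde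 m q\,\delta_0^2/(r^2\kappa^4)\big).$$ 3. The number of scalars exchanged between any node and the center lies between $N$ and $K N$ for $N=C_{pow}\,\kappa^2(n+q)\,r\log\frac n{\delta_0}$; in particular, if $q\le n$, it is at most $K\,C_{pow}\,\kappa^2\,n r\log\frac n{\delta_0}$, i.e. of order $nr\,T_{pow}$. -/

import Mathlib

open MeasureTheory ProbabilityTheory

noncomputable section

namespace ByzLRCS

/-! ## Matrices, singular values, subspace distance -/

/-- Frobenius norm. -/
def frob {a b : ℕ} (M : Matrix (Fin a) (Fin b) ℝ) : ℝ := Real.sqrt (∑ i, ∑ j, M i j ^ 2)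

/-- `SD_F(U₁, U₂) = ‖(I - U₁ U₁ᵀ) U₂‖_F` for matrices with orthonormal columns. -/
def subspaceDist {n r : ℕ} (U₁ U₂ : Matrix (Fin n) (Fin r) ℝ) : ℝ :=
  frob ((1 - U₁ * U₁.transpose) * U₂)

/-- A reduced singular value decomposition `X = U diag(σ) Vᵀ` of a matrix of rank `r`. -/
structure ReducedSVD {n q : ℕ} (X : Matrix (Fin n) (Fin q) ℝ) (r : ℕ) where
  U : Matrix (Fin n) (Fin r) ℝ
  σ : Fin r → ℝ
  V : Matrix (Fin q) (Fin r) ℝ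
  U_orthonormal : U.transpose * U = 1
  V_orthonormal : V.transpose * V = 1
  σ_pos : ∀ i, 0 < σ i
  σ_antitone : Antitone σ
  eq : X = U * Matrix.diagonal σ * V.transpose

namespace ReducedSVD

variable {n q r : ℕ} {X : Matrix (Fin n) (Fin q) ℝ}

def sigmaMax (D : ReducedSVD X r) : ℝ := ⨆ i, D.σ i

def sigmaMin (D : ReducedSVD X r) : ℝ := ⨅ i, D.σ i

/-- The condition number `κ`. -/
def kappa (D : ReducedSVD X r) : ℝ := D.sigmaMax / D.sigmaMin

/-- `B = diag(σ) Vᵀ`, so that `X = U B`. -/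
def B (D : ReducedSVD X r) : Matrix (Fin r) (Fin q) ℝ := Matrix.diagonal D.σ * D.V.transpose

/-- Incoherence of the right singular vectors: `‖b_k‖ ≤ μ √(r/q) σ_max` for every column `b_k`
of `B`. -/
def Incoherent (D : ReducedSVD X r) (μ : ℝ) : Prop :=
  ∀ k : Fin q, Real.sqrt (∑ i, D.B i k ^ 2) ≤ μ * Real.sqrt ((r : ℝ) / q) * D.sigmaMax

end ReducedSVD

/-- Orthonormalization of the columns of an `n × r` matrix by a QR decomposition `M = QR(M) R`,
`R` upper triangular.  Sign conventions, and the choices made for rank deficient `M`, are left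
open; they only have to be measurable in `M`. -/
structure QRMap (n r : ℕ) where
  toFun : Matrix (Fin n) (Fin r) ℝ → Matrix (Fin n) (Fin r) ℝ
  orthonormal : ∀ M, (toFun M).transpose * toFun M = 1
  factor : ∀ M, ∃ R : Matrix (Fin r) (Fin r) ℝ, (∀ i j, j < i → R i j = 0) ∧ M = toFun M * R
  measurable_entries : ∀ i j,
    Measurable fun M : Fin n → Fin r → ℝ => toFun (Matrix.of M) i j

/-- The binary Kullback-Leibler divergence `ψ(a, b)`. -/
def psi (a b : ℝ) : ℝ :=
  (1 - a) * Real.log ((1 - a) / (1 - b)) + a * Real.log (a / b)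

/-- The median of finitely many reals (mean of the two middle values for an even number). -/
def median {K : ℕ} (a : Fin K → ℝ) : ℝ :=
  if h : 0 < K then
    (a (Tuple.sort a ⟨(K - 1) / 2, by omega⟩) + a (Tuple.sort a ⟨K / 2, by omega⟩)) / 2
  else 0

/-! ## Approximate geometric median by path following

The nearly linear time algorithm of Cohen et al. follows the path of minimizers of the penalized
objectives `f_t` along `t_1 < t_2 < …`; the `i`-th step is a line search, started at the previous
iterate, that has to end within `ε_c / t_i` of the minimizer of `f_{t_i}`. -/

section GeometricMedian

variable {K : ℕ} {E : Type} [NormedAddCommGroup E] [NormedSpace ℝ E]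

/-- `f(x) = ∑ ‖x - z_i‖`. -/
def gmObjective (z : Fin K → E) (x : E) : ℝ := ∑ i, ‖x - z i‖

/-- `x⁽⁰⁾`, the average of the points. -/
def gmCenter (z : Fin K → E) : E := (K : ℝ)⁻¹ • ∑ i, z i

/-- The penalized objective
`f_t(x) = ∑ (g_i - log (1 + g_i))`, `g_i = √(1 + t² ‖x - z_i‖²)`. -/
def gmPenalized (z : Fin K → E) (t : ℝ) (x : E) : ℝ :=
  ∑ i, (Real.sqrt (1 + t ^ 2 * ‖x - z i‖ ^ 2)
    - Real.log (1 + Real.sqrt (1 + t ^ 2 * ‖x - z i‖ ^ 2)))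

/-- The path parameter `t_{i+1} = (1 + 1/600)^i / (400 f(x⁽⁰⁾))`. -/
def gmPath (z : Fin K → E) (i : ℕ) : ℝ :=
  1 / (400 * gmObjective z (gmCenter z)) * (1 + 1 / 600) ^ i

variable [MeasurableSpace E] (K E) in
/-- A randomized implementation of the algorithm: `iterate z s i` is the iterate `x⁽ⁱ⁺¹⁾` on the
input points `z` and the random seed `s`. -/
structure MedianRoutine (S : Type) [MeasurableSpace S] where
  iterate : (Fin K → E) → S → ℕ → E
  measurable_iterate : ∀ i, Measurable fun p : (Fin K → E) × S => iterate p.1 p.2 i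

variable [MeasurableSpace E] {S : Type} [MeasurableSpace S]

/-- In a run with `T` iterations, all line searches (the initial one and one for each iteration)
met their tolerance `ε_c`. -/
def MedianRoutine.LineSearchesSucceed (A : MedianRoutine K E S) (T : ℕ) (εc : ℝ)
    (z : Fin K → E) (s : S) : Prop :=
  ∀ i ≤ T, ∃ xc : E, IsMinOn (gmPenalized z (gmPath z i)) Set.univ xc ∧
    ‖A.iterate z s i - xc‖ ≤ εc / gmPath z i

/-- `A`, run for `T` iterations with seed law `ν`, is path following with tolerance `εc` and
failure probability at most `c`, on every fixed input (with `f(x⁽⁰⁾) ≠ 0`, so that the `t_i` are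
defined). -/
def MedianRoutine.IsPathFollowing (A : MedianRoutine K E S) (ν : Measure S) (T : ℕ)
    (εc c : ℝ) : Prop :=
  ∀ z : Fin K → E, gmObjective z (gmCenter z) ≠ 0 →
    1 - c ≤ ν.real {s | A.LineSearchesSucceed T εc z s}

open Classical in
/-- The output after `T` iterations, `x⁽ᵀ⁺¹⁾`.  If `f(x⁽⁰⁾) = 0`, all the points coincide and
`x⁽⁰⁾` is returned. -/
def MedianRoutine.output (A : MedianRoutine K E S) (T : ℕ) (z : Fin K → E) (s : S) : E :=
  if gmObjective z (gmCenter z) = 0 then gmCenter z else A.iterate z s T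

end GeometricMedian

/-- Vectorization of an `n × n` matrix, with the Euclidean norm. -/
def vec {n : ℕ} (M : Matrix (Fin n) (Fin n) ℝ) : EuclideanSpace ℝ (Fin n × Fin n) :=
  WithLp.toLp 2 fun p => M p.1 p.2

/-! ## Federated data and the attack -/

/-- The nodes: `(ϑ, ℓ)` is the `ℓ`-th of the `ρ` nodes of the `ϑ`-th of the `Lt` mini-batches. -/
abbrev Node (Lt ρ : ℕ) : Type := Fin Lt × Fin ρ

/-- Measurement matrices: `A ℓ k` is the `mt × n` matrix `(A_k)_ℓ` of node `ℓ`. -/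
abbrev Sensing (n q mt Lt ρ : ℕ) : Type := Node Lt ρ → Fin q → Fin mt → Fin n → ℝ

/-- All the data of all the nodes, with sample splitting: the first component is used for the
threshold, the second one for the power methods. -/
abbrev Data (n q mt Lt ρ : ℕ) : Type := Sensing n q mt Lt ρ × Sensing n q mt Lt ρ

/-- Data together with the random `n × r` start of the power methods. -/
abbrev World (n q r mt Lt ρ : ℕ) : Type := Data n q mt Lt ρ × (Fin n → Fin r → ℝ)

/-- I.i.d. standard Gaussian measurement matrices. -/
def sensingLaw (n q mt Lt ρ : ℕ) : Measure (Sensing n q mt Lt ρ) :=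
  Measure.pi fun _ => Measure.pi fun _ => Measure.pi fun _ => Measure.pi fun _ => gaussianReal 0 1

/-- The law of the data and of the i.i.d. standard Gaussian start. -/
def worldLaw (n q r mt Lt ρ : ℕ) : Measure (World n q r mt Lt ρ) :=
  ((sensingLaw n q mt Lt ρ).prod (sensingLaw n q mt Lt ρ)).prod
    (Measure.pi fun _ => Measure.pi fun _ => gaussianReal 0 1)

/-- What the Byzantine nodes send.  The attack is omniscient and colluding: every message may
depend on the data of all nodes and, once the center has drawn it, on the random start (hence also
on all earlier messages).  The values at good nodes are not used. -/
structure Attack (n q r mt Lt ρ : ℕ) where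
  alpha : Node Lt ρ → Data n q mt Lt ρ → ℝ
  V : ℕ → Node Lt ρ → World n q r mt Lt ρ → Matrix (Fin q) (Fin r) ℝ
  U : ℕ → Node Lt ρ → World n q r mt Lt ρ → Matrix (Fin n) (Fin r) ℝ
  measurable_alpha : ∀ ℓ, Measurable (alpha ℓ)
  measurable_V : ∀ t ℓ i j, Measurable fun w => V t ℓ w i j
  measurable_U : ∀ t ℓ i j, Measurable fun w => U t ℓ w i j

/-- Everything that determines a run of the initialization up to randomness. -/
structure Protocol (n q r mt Lt ρ : ℕ) where
  /-- the unknown matrix -/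
  X : Matrix (Fin n) (Fin q) ℝ
  /-- algorithm parameter `κ` -/
  κ : ℝ
  /-- algorithm parameter `μ` -/
  μ : ℝ
  /-- the Byzantine nodes, the same ones in all iterations -/
  byz : Finset (Node Lt ρ)
  attack : Attack n q r mt Lt ρ
  qr : QRMap n r

/-- A message: a real matrix. -/
structure Message where
  rows : ℕ
  cols : ℕ
  entries : Matrix (Fin rows) (Fin cols) ℝ

/-- The number of scalars in a message. -/
def Message.size (M : Message) : ℕ := M.rows * M.cols

namespace Protocol

variable {n q r mt Lt ρ : ℕ} (p : Protocol n q r mt Lt ρ)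

/-- The measurement `((y_k)_ℓ)_i = ((A_k)_ℓ x_k)_i`. -/
def y (A : Sensing n q mt Lt ρ) (ℓ : Node Lt ρ) (k : Fin q) (i : Fin mt) : ℝ :=
  ∑ j, A ℓ k i j * p.X j k

/-! ### The threshold -/

/-- `α_ℓ` as received by the center. -/
def alphaNode (d : Data n q mt Lt ρ) (ℓ : Node Lt ρ) : ℝ :=
  if ℓ ∈ p.byz then p.attack.alpha ℓ d
  else 9 * p.κ ^ 2 * p.μ ^ 2 / ((mt : ℝ) * q) * ∑ k, ∑ i, p.y d.1 ℓ k i ^ 2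

/-- The threshold `α`: the median over the mini-batches of the mini-batch means. -/
def alpha (d : Data n q mt Lt ρ) : ℝ :=
  median fun ϑ : Fin Lt => (∑ ℓ : Fin ρ, p.alphaNode d (ϑ, ℓ)) / ρ

/-- `(X₀)_ℓ = ∑_k (A_k)_ℓᵀ ((y_k)_ℓ)_trunc e_kᵀ`, truncated at `|y| ≤ √α`. -/
def X0 (d : Data n q mt Lt ρ) (ℓ : Node Lt ρ) : Matrix (Fin n) (Fin q) ℝ :=
  Matrix.of fun j k => ∑ i, d.2 ℓ k i j *
    (if |p.y d.2 ℓ k i| ≤ Real.sqrt (p.alpha d) then p.y d.2 ℓ k i else 0)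

/-! ### The federated power methods, one iteration -/

/-- `V_ℓ` as received by the center, when the current estimates are `U`. -/
def VNode (w : World n q r mt Lt ρ) (t : ℕ) (U : Fin Lt → Matrix (Fin n) (Fin r) ℝ)
    (ℓ : Node Lt ρ) : Matrix (Fin q) (Fin r) ℝ :=
  if ℓ ∈ p.byz then p.attack.V t ℓ w else (p.X0 w.1 ℓ).transpose * U ℓ.1

/-- `V_(ϑ)`, the sum over a mini-batch. -/
def VBatch (w : World n q r mt Lt ρ) (t : ℕ) (U : Fin Lt → Matrix (Fin n) (Fin r) ℝ)
    (ϑ : Fin Lt) : Matrix (Fin q) (Fin r) ℝ :=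
  ∑ ℓ : Fin ρ, p.VNode w t U (ϑ, ℓ)

/-- `U_ℓ` as received by the center. -/
def UNode (w : World n q r mt Lt ρ) (t : ℕ) (U : Fin Lt → Matrix (Fin n) (Fin r) ℝ)
    (ℓ : Node Lt ρ) : Matrix (Fin n) (Fin r) ℝ :=
  if ℓ ∈ p.byz then p.attack.U t ℓ w else p.X0 w.1 ℓ * p.VBatch w t U ℓ.1

/-- The estimates `U_(ϑ)` after `t` iterations; all mini-batches share the random start. -/
def powerIterate (w : World n q r mt Lt ρ) : ℕ → Fin Lt → Matrix (Fin n) (Fin r) ℝ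
  | 0 => fun _ => Matrix.of w.2
  | t + 1 => fun ϑ => p.qr.toFun (∑ ℓ : Fin ρ, p.UNode w t (powerIterate w t) (ϑ, ℓ))

/-! ### Subspace median -/

/-- The orthonormalized inputs of the subspace median. -/
def basis (w : World n q r mt Lt ρ) (Tpow : ℕ) (ϑ : Fin Lt) : Matrix (Fin n) (Fin r) ℝ :=
  p.qr.toFun (p.powerIterate w Tpow ϑ)

/-- Their (vectorized) projection matrices. -/
def proj (w : World n q r mt Lt ρ) (Tpow : ℕ) (ϑ : Fin Lt) :
    EuclideanSpace ℝ (Fin n × Fin n) :=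
  vec (p.basis w Tpow ϑ * (p.basis w Tpow ϑ).transpose)

/-- `ϑ` is a best mini-batch: its projection matrix is closest to the approximate geometric median
of all of them. -/
def IsBest {S : Type} [MeasurableSpace S]
    (gm : MedianRoutine Lt (EuclideanSpace ℝ (Fin n × Fin n)) S) (Tpow Tgm : ℕ)
    (w : World n q r mt Lt ρ) (s : S) (ϑ : Fin Lt) : Prop :=
  ∀ ϑ' : Fin Lt, ‖p.proj w Tpow ϑ - gm.output Tgm (p.proj w Tpow) s‖ ≤
    ‖p.proj w Tpow ϑ' - gm.output Tgm (p.proj w Tpow) s‖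

/-- `U_out` is one of the estimates of the best mini-batches (ties are broken in any way). -/
def IsOutput {S : Type} [MeasurableSpace S]
    (gm : MedianRoutine Lt (EuclideanSpace ℝ (Fin n × Fin n)) S) (Tpow Tgm : ℕ)
    (w : World n q r mt Lt ρ) (s : S) (Uout : Matrix (Fin n) (Fin r) ℝ) : Prop :=
  ∃ ϑ : Fin Lt, p.IsBest gm Tpow Tgm w s ϑ ∧ Uout = p.basis w Tpow ϑ

/-! ### Communication -/

/-- All the messages exchanged, in both directions, between node `ℓ` and the center. -/
def transcript (w : World n q r mt Lt ρ) (Tpow : ℕ) (ℓ : Node Lt ρ) : List Message :=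
  [⟨1, 1, fun _ _ => p.alphaNode w.1 ℓ⟩, ⟨1, 1, fun _ _ => p.alpha w.1⟩,
    ⟨n, r, Matrix.of w.2⟩] ++
  (List.range Tpow).flatMap fun t =>
    [⟨q, r, p.VNode w t (p.powerIterate w t) ℓ⟩, ⟨q, r, p.VBatch w t (p.powerIterate w t) ℓ.1⟩,
      ⟨n, r, p.UNode w t (p.powerIterate w t) ℓ⟩, ⟨n, r, p.powerIterate w (t + 1) ℓ.1⟩]

/-- Communication cost of node `ℓ`: the number of scalars exchanged. -/
def commCost (w : World n q r mt Lt ρ) (Tpow : ℕ) (ℓ : Node Lt ρ) : ℕ :=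
  ((p.transcript w Tpow ℓ).map Message.size).sum

end Protocol

end ByzLRCS

end

/-! Split every Gaussian measurement vector into its component along `x_k` and its component
orthogonal to it. For a mini-batch without Byzantine nodes the sum of the `(X₀)_ℓ` is then exactly
`U* G + W`, where `G` is `B*` with its columns rescaled by nonnegative factors and `W` collects the
orthogonal components (`sum_X0_eq`). The identity holds for every threshold, so no expectation of
`X₀` is needed: it suffices that `Gᵀ` is bounded below by a `θ` of order `σ_min` and that `W` has
norm at most of order `δ₀ θ / √r`.

The difficulty is that the Byzantine nodes see all data, so `α` may be correlated with the data used
in the power methods. Clean mini-batches are a majority, so the median traps `α` in a deterministic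
interval, and both bounds are proved for all levels in that interval at once. The column factors of
`G` increase with the level, so a fixed lower level suffices (`batch_signal`,
`norm_scaled_signal_ge`). `W` is not monotone in the level, but reflecting measurement vectors
through the lines spanned by the `x_k` flips its summands without changing the truncation pattern.
Lévy's maximal inequality (`levy_maximal`) then reduces all levels to the largest one, where the
sums are sub-Gaussian and a net argument applies (`batch_noise`).

For the power method, the norms of `z, Mᵀz, MMᵀz, …` form a log-convex sequence, so the last growth
factor is at least the average one, which is of order `θ`. One multiplication by `M` adds at most
`‖W‖` outside the range of `U*`, and dividing by the last growth factor bounds the angle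
(`power_method`, `subspaceDist_power_le`). No gap among the singular values of the signal is used.
All mini-batches share the random start. Each clean one rejects it with small probability, and
Markov's inequality on the number of rejections (`measure_card_bad_gt_le`) keeps at least 55% of the
mini-batches good at a cost that does not grow with their number.

Finally, a point set with 55% of its members near the true projection has its path following median
near that projection (`norm_sub_le_of_isMinOn_gmPenalized`), and so is the input nearest to the
median. The three layers of randomness (data, start, seed) are revealed in this order in
`one_sub_le_real_success`. In the first claim the large deviation term is slack. In the second claim
it absorbs the remaining errors, because `ψ(a, b) ≤ -log b`. -/

open MeasureTheory ProbabilityTheory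

namespace ByzLRCS

open scoped RealInnerProductSpace ENNReal

/-! ## Nets -/

section Nets

variable {E F : Type*} [NormedAddCommGroup E] [InnerProductSpace ℝ E]
  [NormedAddCommGroup F] [NormedSpace ℝ F]

/-- A `1/2`-net of the unit ball with at most `5 ^ dim` points. -/
theorem exists_half_net (E : Type*) [NormedAddCommGroup E] [InnerProductSpace ℝ E]
    [FiniteDimensional ℝ E] :
    ∃ N : Finset E, N.card ≤ 5 ^ Module.finrank ℝ E ∧ (∀ y ∈ N, ‖y‖ ≤ 1) ∧
      ∀ x : E, ‖x‖ ≤ 1 → ∃ y ∈ N, ‖x - y‖ ≤ 1 / 2 := by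
  classical
  let P : ℕ → Prop := fun k => ∃ N : Finset E, N.card = k ∧ (∀ y ∈ N, ‖y‖ ≤ 1) ∧
    ∀ c ∈ N, ∀ d ∈ N, c ≠ d → 1 / 2 ≤ ‖c - d‖
  have hbound : ∀ N : Finset E, (∀ y ∈ N, ‖y‖ ≤ 1) →
      (∀ c ∈ N, ∀ d ∈ N, c ≠ d → 1 / 2 ≤ ‖c - d‖) → N.card ≤ 5 ^ Module.finrank ℝ E := by
    intro N h1 h2
    -- Doubling turns radius `1` and separation `1/2` into radius `2` and separation `1`, the
    -- normalization of the Besicovitch packing bound `5 ^ dim`.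
    have hinj : Function.Injective fun y : E => (2 : ℝ) • y :=
      smul_right_injective E two_ne_zero
    rw [← Finset.card_image_of_injective N hinj]
    apply Besicovitch.card_le_of_separated
    · intro c hc
      obtain ⟨y, hy, rfl⟩ := Finset.mem_image.1 hc
      have := h1 y hy
      simp only [norm_smul, Real.norm_eq_abs]
      norm_num
      linarith
    · intro c hc d hd hcd
      obtain ⟨y, hy, rfl⟩ := Finset.mem_image.1 hc
      obtain ⟨z, hz, rfl⟩ := Finset.mem_image.1 hd
      have := h2 y hy z hz (fun h => hcd (by rw [h]))
      simp only [← smul_sub, norm_smul, Real.norm_eq_abs]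
      norm_num
      linarith
  have hP0 : P 0 := ⟨∅, by simp⟩
  have hmax := Nat.findGreatest_spec (P := P) (Nat.zero_le (5 ^ Module.finrank ℝ E)) hP0
  obtain ⟨N, hN, h1, h2⟩ := hmax
  refine ⟨N, hbound N h1 h2, h1, fun x hx => ?_⟩
  by_contra! hcon
  -- A point far from all of `N` could be adjoined to it, against the maximality of its cardinality.
  have hxN : x ∉ N := fun h => by have := hcon x h; simp at this; linarith
  have h1' : ∀ y ∈ insert x N, ‖y‖ ≤ 1 := by
    intro y hy
    rcases Finset.mem_insert.1 hy with rfl | hy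
    exacts [hx, h1 y hy]
  have h2' : ∀ c ∈ insert x N, ∀ d ∈ insert x N, c ≠ d → 1 / 2 ≤ ‖c - d‖ := by
    intro c hc d hd hcd
    rcases Finset.mem_insert.1 hc with hc | hc <;> rcases Finset.mem_insert.1 hd with hd | hd
    · exact absurd (hc.trans hd.symm) hcd
    · rw [hc]; exact (hcon d hd).le
    · rw [norm_sub_rev, hd]; exact (hcon c hc).le
    · exact h2 c hc d hd hcd
  have h3 : P (N.card + 1) := ⟨insert x N, Finset.card_insert_of_notMem hxN, h1', h2'⟩
  have h4 := hbound _ h1' h2'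
  rw [Finset.card_insert_of_notMem hxN] at h4
  have := Nat.le_findGreatest (P := P) h4 h3
  omega

/-- Replacing the unit vector in the direction of `w` by a nearby net point loses at most half of
`‖w‖`. -/
theorem norm_le_of_net {N : Finset E} (hN : ∀ x : E, ‖x‖ ≤ 1 → ∃ y ∈ N, ‖x - y‖ ≤ 1 / 2)
    {w : E} {t : ℝ} (h : ∀ u ∈ N, ⟪u, w⟫ ≤ t) : ‖w‖ ≤ 2 * t := by
  rcases eq_or_ne w 0 with rfl | hw
  · obtain ⟨y, hy, -⟩ := hN 0 (by simp)
    have := h y hy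
    simp at this ⊢
    linarith
  have hw' : 0 < ‖w‖ := norm_pos_iff.2 hw
  obtain ⟨y, hy, hxy⟩ := hN (‖w‖⁻¹ • w) (by rw [norm_smul]; simp [hw])
  have h1 : ⟪‖w‖⁻¹ • w, w⟫ = ‖w‖ := by
    rw [inner_smul_left, real_inner_self_eq_norm_sq]; simp; field_simp
  have h2 : ⟪‖w‖⁻¹ • w - y, w⟫ ≤ 1 / 2 * ‖w‖ :=
    (real_inner_le_norm _ _).trans (by gcongr)
  rw [inner_sub_left, h1] at h2
  have := h y hy
  linarith

theorem opNorm_le_of_net {N : Finset E} (hN : ∀ x : E, ‖x‖ ≤ 1 → ∃ y ∈ N, ‖x - y‖ ≤ 1 / 2)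
    (T : E →L[ℝ] F) {t : ℝ} (h : ∀ u ∈ N, ‖T u‖ ≤ t) : ‖T‖ ≤ 2 * t := by
  have ht : 0 ≤ t := by
    obtain ⟨y, hy, -⟩ := hN 0 (by simp)
    exact (norm_nonneg _).trans (h y hy)
  have : ‖T‖ ≤ t + ‖T‖ * (1 / 2) := by
    refine ContinuousLinearMap.opNorm_le_of_unit_norm (by positivity) fun x hx => ?_
    obtain ⟨y, hy, hxy⟩ := hN x hx.le
    calc ‖T x‖ = ‖T y + T (x - y)‖ := by rw [← map_add]; congr 2; abel
      _ ≤ ‖T y‖ + ‖T (x - y)‖ := norm_add_le _ _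
      _ ≤ t + ‖T‖ * (1 / 2) := by
        gcongr
        · exact h y hy
        · exact (T.le_opNorm _).trans (by gcongr)
  linarith

end Nets

/-! ## Robustness of the path following median -/

section Median

variable {K : ℕ} {E : Type} [NormedAddCommGroup E] [InnerProductSpace ℝ E]

/-- The derivative of `g - log (1 + g)` is `g g' / (1 + g)`, and `g g' = t² ⟪v, u⟫`, so nothing
singular happens at `v = 0`. -/
theorem hasDerivAt_penalty (t : ℝ) (v u : E) :
    HasDerivAt (fun s : ℝ => Real.sqrt (1 + t ^ 2 * ‖v + s • u‖ ^ 2)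
      - Real.log (1 + Real.sqrt (1 + t ^ 2 * ‖v + s • u‖ ^ 2)))
      (t ^ 2 * ⟪v, u⟫ / (1 + Real.sqrt (1 + t ^ 2 * ‖v‖ ^ 2))) 0 := by
  have hq : HasDerivAt (fun s : ℝ => 1 + t ^ 2 * ‖v + s • u‖ ^ 2) (t ^ 2 * (2 * ⟪v, u⟫)) 0 := by
    have h1 : HasDerivAt (fun s : ℝ => v + s • u) u 0 := by
      simpa using ((hasDerivAt_id (0 : ℝ)).smul_const u).const_add v
    have h2 := h1.norm_sq
    simp only [zero_smul, add_zero] at h2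
    exact (h2.const_mul (t ^ 2)).const_add 1
  have hpos : (0 : ℝ) < 1 + t ^ 2 * ‖v‖ ^ 2 := by positivity
  set g := Real.sqrt (1 + t ^ 2 * ‖v‖ ^ 2) with hg
  have hgpos : 0 < g := Real.sqrt_pos.2 hpos
  have hs := hq.sqrt (by simp; positivity)
  have hl := (hs.const_add 1).log (by simp; positivity)
  have := hs.sub hl
  simp only [zero_smul, add_zero, ← hg] at this
  have hg1 : 1 + g ≠ 0 := by positivity
  refine this.congr_deriv ?_
  field_simp
  ring

/-- Differentiate at the minimizer `x` in the direction `x - zs`, of length `Δ`. Any input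
contributes at least `-tΔ`. An input within `d` of `zs` contributes more than `(9/11) tΔ` as soon as
`2tΔ > 18 + 20td`, that is, `Δ > 10d + 9/t`. Since `0.55 · 9/11 = 0.45`, the good inputs then
strictly outweigh all others, and the derivative cannot vanish. -/
theorem norm_sub_le_of_isMinOn_gmPenalized {z : Fin K → E} {t : ℝ} (ht : 0 < t) {x : E}
    (hx : IsMinOn (gmPenalized z t) Set.univ x) {zs : E} {d : ℝ} (hd : 0 ≤ d)
    (G : Finset (Fin K)) (hG : ∀ i ∈ G, ‖z i - zs‖ ≤ d) (hK : 0 < K)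
    (hcard : 0.55 * (K : ℝ) ≤ G.card) : ‖x - zs‖ ≤ 10 * d + 9 / t := by
  classical
  by_contra! hcon
  set Δ := ‖x - zs‖ with hΔ
  set u := x - zs with hu
  have h9 : 0 < 9 / t := by positivity
  have hΔpos : 0 < Δ := by linarith
  have hderiv : HasDerivAt (fun s : ℝ => gmPenalized z t (x + s • u))
      (∑ i, t ^ 2 * ⟪x - z i, u⟫ / (1 + Real.sqrt (1 + t ^ 2 * ‖x - z i‖ ^ 2))) 0 := by
    unfold gmPenalized
    refine (HasDerivAt.fun_sum (fun i _ => hasDerivAt_penalty t (x - z i) u)).congr_of_eventuallyEq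
      (Filter.Eventually.of_forall fun s => ?_)
    simp only [add_sub_right_comm]
  have hmin : IsLocalMin (fun s : ℝ => gmPenalized z t (x + s • u)) 0 := by
    refine Filter.Eventually.of_forall fun s => ?_
    simpa using hx (Set.mem_univ (x + s • u))
  have hzero := hmin.hasDerivAt_eq_zero hderiv
  set D : Fin K → ℝ := fun i =>
    t ^ 2 * ⟪x - z i, u⟫ / (1 + Real.sqrt (1 + t ^ 2 * ‖x - z i‖ ^ 2)) with hD
  have hbad : ∀ i, -(t * Δ) ≤ D i := by
    intro i
    have h1 : t * ‖x - z i‖ ≤ Real.sqrt (1 + t ^ 2 * ‖x - z i‖ ^ 2) := by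
      apply Real.le_sqrt_of_sq_le; nlinarith
    have h2 : -(‖x - z i‖ * Δ) ≤ ⟪x - z i, u⟫ := by
      have := abs_real_inner_le_norm (x - z i) u
      linarith [neg_abs_le ⟪x - z i, u⟫]
    rw [hD]
    simp only
    rw [le_div_iff₀ (by positivity)]
    have h3 : t * Δ * (t * ‖x - z i‖) ≤ t * Δ * (1 + Real.sqrt (1 + t ^ 2 * ‖x - z i‖ ^ 2)) := by
      gcongr; linarith
    nlinarith [mul_le_mul_of_nonneg_left h2 (sq_nonneg t)]
  have hgood : ∀ i ∈ G, 9 / 11 * (t * Δ) < D i := by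
    intro i hi
    have hzi := hG i hi
    have hv : x - z i = u - (z i - zs) := by rw [hu]; abel
    have hnorm : ‖x - z i‖ ≤ Δ + d := by
      rw [hv]; exact (norm_sub_le _ _).trans (by linarith)
    have hinner : Δ * (Δ - d) ≤ ⟪x - z i, u⟫ := by
      rw [hv, inner_sub_left, real_inner_self_eq_norm_sq]
      have := (real_inner_le_norm (z i - zs) u).trans
        (mul_le_mul_of_nonneg_right hzi (norm_nonneg _))
      rw [← hΔ] at this ⊢
      nlinarith
    have h1 : Real.sqrt (1 + t ^ 2 * ‖x - z i‖ ^ 2) ≤ 1 + t * (Δ + d) := by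
      rw [Real.sqrt_le_left (by positivity)]
      have : t * ‖x - z i‖ ≤ t * (Δ + d) := by gcongr
      have h0 : 0 ≤ t * ‖x - z i‖ := by positivity
      nlinarith
    have h2 : 18 + 20 * (t * d) < 2 * (t * Δ) := by
      have := mul_lt_mul_of_pos_left hcon ht
      have h3 : t * (10 * d + 9 / t) = 10 * (t * d) + 9 := by field_simp
      linarith
    rw [hD]
    simp only
    rw [lt_div_iff₀ (by positivity)]
    have h3 : 9 / 11 * (t * Δ) * (1 + Real.sqrt (1 + t ^ 2 * ‖x - z i‖ ^ 2)) ≤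
        9 / 11 * (t * Δ) * (2 + t * (Δ + d)) :=
      mul_le_mul_of_nonneg_left (by linarith) (by positivity)
    have h4 : t ^ 2 * (Δ * (Δ - d)) ≤ t ^ 2 * ⟪x - z i, u⟫ := by gcongr
    have h5 : 9 / 11 * (2 + t * (Δ + d)) < t * (Δ - d) := by nlinarith
    have h6 := mul_lt_mul_of_pos_left h5 (mul_pos ht hΔpos)
    nlinarith
  have hGne : G.Nonempty := by
    rw [← Finset.card_pos]
    have : (0 : ℝ) < G.card := lt_of_lt_of_le (by positivity) hcard
    exact_mod_cast this
  have hsumG : G.card * (9 / 11 * (t * Δ)) < ∑ i ∈ G, D i := by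
    rw [← nsmul_eq_mul, ← Finset.sum_const]
    exact Finset.sum_lt_sum_of_nonempty hGne hgood
  have hsumB : -((K - G.card) * (t * Δ)) ≤ ∑ i ∈ Gᶜ, D i := by
    have h1 : (Gᶜ.card : ℝ) = K - G.card := by
      have := Finset.card_add_card_compl G
      rw [Fintype.card_fin] at this
      have h2 : (G.card : ℝ) + Gᶜ.card = K := by exact_mod_cast this
      linarith
    rw [← h1, ← mul_neg, ← nsmul_eq_mul, ← Finset.sum_const]
    exact Finset.sum_le_sum fun i _ => hbad i
  have htot := Finset.sum_add_sum_compl G D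
  have : (G.card * (9 / 11) - (K - G.card)) * (t * Δ) < 0 := by nlinarith
  have hpos : 0 ≤ ((G.card : ℝ) * (9 / 11) - (K - G.card)) * (t * Δ) := by
    apply mul_nonneg _ (by positivity)
    norm_num at hcard ⊢
    linarith
  linarith

/-- Distance of the output of the path following algorithm to a point near most of the inputs. -/
theorem MedianRoutine.norm_output_sub_le {S : Type} [MeasurableSpace S] [MeasurableSpace E]
    (A : MedianRoutine K E S) {T : ℕ} {εc : ℝ} (hε : εc ≤ 1) {z : Fin K → E} {s : S}
    (hs : gmObjective z (gmCenter z) ≠ 0 → A.LineSearchesSucceed T εc z s)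
    {zs : E} {d : ℝ} (hd : 0 ≤ d)
    (G : Finset (Fin K)) (hG : ∀ i ∈ G, ‖z i - zs‖ ≤ d) (hK : 0 < K)
    (hcard : 0.55 * (K : ℝ) ≤ G.card) :
    ‖A.output T z s - zs‖ ≤
      10 * d + 4000 * gmObjective z (gmCenter z) / (1 + 1 / 600) ^ T := by
  have hobj : 0 ≤ gmObjective z (gmCenter z) := Finset.sum_nonneg fun _ _ => norm_nonneg _
  unfold MedianRoutine.output
  split_ifs with h0
  · have hGne : G.Nonempty := by
      rw [← Finset.card_pos]
      have : (0 : ℝ) < G.card := lt_of_lt_of_le (by positivity) hcard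
      exact_mod_cast this
    obtain ⟨i, hi⟩ := hGne
    have h1 : ‖gmCenter z - z i‖ = 0 :=
      (Finset.sum_eq_zero_iff_of_nonneg fun _ _ => norm_nonneg _).1 h0 i (Finset.mem_univ i)
    rw [norm_eq_zero, sub_eq_zero] at h1
    rw [h0, h1]
    have := hG i hi
    simp only [mul_zero, zero_div, add_zero]
    linarith
  · obtain ⟨xc, hxc, hdist⟩ := hs h0 T le_rfl
    have hpos : 0 < gmObjective z (gmCenter z) := lt_of_le_of_ne hobj (Ne.symm h0)
    have ht : 0 < gmPath z T := by unfold gmPath; positivity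
    have h1 := norm_sub_le_of_isMinOn_gmPenalized ht hxc hd G hG hK hcard
    have h2 : εc / gmPath z T ≤ 1 / gmPath z T := by gcongr
    -- Of the `10 / t`, `9 / t` is the distance of the exact minimizer and `1 / t` bounds the line
    -- search error, as `εc ≤ 1`.
    have h3 : 4000 * gmObjective z (gmCenter z) / (1 + 1 / 600) ^ T = 10 / gmPath z T := by
      unfold gmPath
      field_simp
      norm_num
    have h4 : ‖A.iterate z s T - zs‖ ≤ ‖A.iterate z s T - xc‖ + ‖xc - zs‖ :=
      norm_sub_le_norm_sub_add_norm_sub _ _ _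
    rw [h3]
    have h5 : 10 / gmPath z T = 9 / gmPath z T + 1 / gmPath z T := by ring
    linarith

end Median

/-! ## Exponential moments of independent sums -/

section Chernoff

variable {I : Type*} [Fintype I] {Ω : Type*} [MeasurableSpace Ω] {γ : Measure Ω}
  [IsProbabilityMeasure γ]

/-- Markov's inequality for the exponential of the sum, whose integral factors over the coordinates.
Using `∫⁻` avoids integrability hypotheses. -/
theorem chernoff_pi {f : I → Ω → ℝ} (hf : ∀ i, Measurable (f i)) {b : I → ℝ}
    (hb : ∀ i, ∫⁻ a, ENNReal.ofReal (Real.exp (f i a)) ∂γ ≤ ENNReal.ofReal (Real.exp (b i)))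
    (t : ℝ) :
    Measure.pi (fun _ : I => γ) {ω | t + ∑ i, b i ≤ ∑ i, f i (ω i)} ≤
      ENNReal.ofReal (Real.exp (-t)) := by
  set μ := Measure.pi (fun _ : I => γ)
  have hind : iIndepFun (fun i (ω : I → Ω) => ENNReal.ofReal (Real.exp (f i (ω i)))) μ :=
    iIndepFun_pi (X := fun i a => ENNReal.ofReal (Real.exp (f i a)))
      fun i => (by fun_prop : Measurable _).aemeasurable
  have hprod : ∫⁻ ω, ENNReal.ofReal (Real.exp (∑ i, f i (ω i))) ∂μ ≤
      ENNReal.ofReal (Real.exp (∑ i, b i)) := by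
    have h1 : ∀ ω : I → Ω, ENNReal.ofReal (Real.exp (∑ i, f i (ω i))) =
        ∏ i, ENNReal.ofReal (Real.exp (f i (ω i))) := fun ω => by
      rw [Real.exp_sum, ENNReal.ofReal_prod_of_nonneg fun i _ => (Real.exp_pos _).le]
    simp_rw [h1]
    rw [lintegral_prod_eq_prod_lintegral_of_indepFun Finset.univ _ hind fun i => by fun_prop,
      Real.exp_sum, ENNReal.ofReal_prod_of_nonneg fun i _ => (Real.exp_pos _).le]
    refine Finset.prod_le_prod' fun i _ => ?_
    have := (measurePreserving_eval (fun _ : I => γ) i).lintegral_comp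
      (f := fun a => ENNReal.ofReal (Real.exp (f i a))) (by fun_prop)
    rw [this]
    exact hb i
  have hmark := mul_meas_ge_le_lintegral (μ := μ)
    (f := fun ω : I → Ω => ENNReal.ofReal (Real.exp (∑ i, f i (ω i)))) (by fun_prop)
    (ENNReal.ofReal (Real.exp (t + ∑ i, b i)))
  have hset : {ω : I → Ω | t + ∑ i, b i ≤ ∑ i, f i (ω i)} ⊆
      {ω | ENNReal.ofReal (Real.exp (t + ∑ i, b i)) ≤
        ENNReal.ofReal (Real.exp (∑ i, f i (ω i)))} := fun ω hω =>
    ENNReal.ofReal_le_ofReal (Real.exp_le_exp.2 hω)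
  have h2 := (mul_le_mul_right (measure_mono (μ := μ) hset)
    (ENNReal.ofReal (Real.exp (t + ∑ i, b i)))).trans (hmark.trans hprod)
  have h3 : Real.exp (∑ i, b i) = Real.exp (t + ∑ i, b i) * Real.exp (-t) := by
    rw [← Real.exp_add]; ring_nf
  rw [h3, ENNReal.ofReal_mul (Real.exp_pos _).le] at h2
  exact (ENNReal.mul_le_mul_iff_right (by simp [Real.exp_pos]) ENNReal.ofReal_ne_top).1 h2

theorem chernoff_pi_quadratic {f : I → Ω → ℝ} (hf : ∀ i, Measurable (f i)) {c : I → ℝ}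
    (hc : ∀ i, 0 ≤ c i) (hb : ∀ i, ∀ lam : ℝ, ∫⁻ a, ENNReal.ofReal (Real.exp (lam * f i a)) ∂γ ≤
      ENNReal.ofReal (Real.exp (lam ^ 2 * c i / 2))) {t S : ℝ}
    (ht : 0 ≤ t) (hS : ∑ i, c i ≤ S) : Measure.pi (fun _ : I => γ) {ω | t ≤ ∑ i, f i (ω i)} ≤
      ENNReal.ofReal (Real.exp (-(t ^ 2 / (2 * S)))) := by
  have hS0 : 0 ≤ S := (Finset.sum_nonneg fun i _ => hc i).trans hS
  -- For `S = 0`, division by zero makes the right-hand side `1`. Otherwise the optimal parameter is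
  -- `t / S`.
  rcases eq_or_ne S 0 with h0 | h0
  · rw [h0]; simpa using prob_le_one
  have hSpos : 0 < S := lt_of_le_of_ne hS0 (Ne.symm h0)
  have := chernoff_pi (f := fun i a => t / S * f i a) (fun i => by fun_prop)
    (b := fun i => (t / S) ^ 2 * c i / 2) (fun i => hb i (t / S)) (t ^ 2 / (2 * S))
  refine (measure_mono fun ω hω => ?_).trans this
  simp only [Set.mem_ofPred_eq] at hω ⊢
  rw [← Finset.mul_sum, ← Finset.sum_div, ← Finset.mul_sum]
  have h1 : t / S * t ≤ t / S * ∑ i, f i (ω i) := by gcongr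
  have h2 : (t / S) ^ 2 * ∑ i, c i ≤ (t / S) ^ 2 * S := by gcongr
  have h3 : t ^ 2 / (2 * S) + (t / S) ^ 2 * S / 2 = t / S * t := by field_simp; ring
  linarith

end Chernoff

/-! ### A maximal inequality from sign symmetry -/

section Reflection

variable {I : Type*} [Fintype I] {Ω : Type*} [MeasurableSpace Ω] {μ : Measure Ω}

/-- The Lévy maximal inequality for sums over the sets `{i | η i ≤ s}`, when the signs of the
summands can be changed by measure preserving maps that do not change `η`. -/
theorem levy_maximal {η ξ : I → Ω → ℝ} (hη : ∀ i, Measurable (η i)) (hξ : ∀ i, Measurable (ξ i))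
    (R : Set I → Ω → Ω) (hR : ∀ A, MeasurePreserving (R A) μ μ)
    (hRη : ∀ A i ω, η i (R A ω) = η i ω) (hRξ : ∀ A, ∀ i ∈ A, ∀ ω, ξ i (R A ω) = -ξ i ω)
    (hRξ' : ∀ A, ∀ i ∉ A, ∀ ω, ξ i (R A ω) = ξ i ω) {s₀ ε : ℝ} (hε : 0 ≤ ε) :
    μ {ω | ∃ s ≤ s₀, ε < ∑ i, if η i ω ≤ s then ξ i ω else 0} ≤
      2 * μ {ω | ε < ∑ i, if η i ω ≤ s₀ then ξ i ω else 0} := by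
  classical
  set F : Ω → ℝ → ℝ := fun ω s => ∑ i, if η i ω ≤ s then ξ i ω else 0 with hF
  have hFm : ∀ i₀, Measurable fun ω => F ω (η i₀ ω) := fun i₀ =>
    Finset.measurable_sum _ fun i _ =>
      Measurable.ite (measurableSet_le (hη i) (hη i₀)) (hξ i) measurable_const
  have hFm0 : Measurable fun ω => F ω s₀ :=
    Finset.measurable_sum _ fun i _ =>
      Measurable.ite (measurableSet_le (hη i) measurable_const) (hξ i) measurable_const
  -- `η i₀` is the first attained level at which the partial sum exceeds `ε`, and `J` is the set of
  -- indices summed up to then. Stopping is thus recorded by a finite set, and the events `A J` are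
  -- disjoint.
  set Q : Finset I → I → Set Ω := fun J i₀ =>
    {ω | η i₀ ω ≤ s₀ ∧ (∀ i, i ∈ J ↔ η i ω ≤ η i₀ ω) ∧ ε < F ω (η i₀ ω) ∧
      ∀ i₁, η i₁ ω < η i₀ ω → F ω (η i₁ ω) ≤ ε} with hQ
  set A : Finset I → Set Ω := fun J => ⋃ i₀, Q J i₀ with hA
  have hAm : ∀ J, MeasurableSet (A J) := by
    intro J
    refine MeasurableSet.iUnion fun i₀ => ?_
    refine (measurableSet_le (hη i₀) measurable_const).inter (MeasurableSet.inter ?_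
      ((measurableSet_lt measurable_const (hFm i₀)).inter ?_))
    · have : {ω | ∀ i, i ∈ J ↔ η i ω ≤ η i₀ ω} = ⋂ i, {ω | i ∈ J ↔ η i ω ≤ η i₀ ω} := by
        ext; simp
      change MeasurableSet {ω | ∀ i, i ∈ J ↔ η i ω ≤ η i₀ ω}
      rw [this]
      refine MeasurableSet.iInter fun i => ?_
      by_cases hi : i ∈ J
      · simpa [hi] using measurableSet_le (hη i) (hη i₀)
      · simpa [hi] using measurableSet_lt (hη i₀) (hη i)
    · have : {ω | ∀ i₁, η i₁ ω < η i₀ ω → F ω (η i₁ ω) ≤ ε} =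
          ⋂ i₁, ({ω | η i₁ ω < η i₀ ω}ᶜ ∪ {ω | F ω (η i₁ ω) ≤ ε}) := by
        ext ω
        simp only [Set.mem_ofPred_eq, Set.mem_iInter, Set.mem_union, Set.mem_compl_iff,
          imp_iff_not_or]
      change MeasurableSet {ω | ∀ i₁, η i₁ ω < η i₀ ω → F ω (η i₁ ω) ≤ ε}
      rw [this]
      exact MeasurableSet.iInter fun i₁ =>
        (measurableSet_lt (hη i₁) (hη i₀)).compl.union (measurableSet_le (hFm i₁) measurable_const)
  have hcover : {ω | ∃ s ≤ s₀, ε < F ω s} ⊆ ⋃ J, A J := by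
    rintro ω ⟨s, hs, hωs⟩
    let T : Finset I := Finset.univ.filter fun i => η i ω ≤ s₀ ∧ ε < F ω (η i ω)
    have hTne : T.Nonempty := by
      let T' : Finset I := Finset.univ.filter fun i => η i ω ≤ s
      have hT' : T'.Nonempty := by
        by_contra hne
        rw [Finset.not_nonempty_iff_eq_empty, Finset.filter_eq_empty_iff] at hne
        have : F ω s = 0 := Finset.sum_eq_zero fun i _ => if_neg (hne (Finset.mem_univ i))
        linarith
      obtain ⟨i, hi, hmax⟩ := T'.exists_max_image (fun i => η i ω) hT'
      have hi' : η i ω ≤ s := (Finset.mem_filter.1 hi).2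
      have heq : F ω s = F ω (η i ω) := by
        refine Finset.sum_congr rfl fun j _ => ?_
        have : η j ω ≤ s ↔ η j ω ≤ η i ω :=
          ⟨fun h => hmax j (Finset.mem_filter.2 ⟨Finset.mem_univ _, h⟩), fun h => h.trans hi'⟩
        simp only [this]
      exact ⟨i, Finset.mem_filter.2 ⟨Finset.mem_univ _, hi'.trans hs, heq ▸ hωs⟩⟩
    obtain ⟨i₀, hi₀, hmin⟩ := T.exists_min_image (fun i => η i ω) hTne
    obtain ⟨-, h1, h2⟩ := Finset.mem_filter.1 hi₀
    refine Set.mem_iUnion.2 ⟨Finset.univ.filter fun i => η i ω ≤ η i₀ ω,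
      Set.mem_iUnion.2 ⟨i₀, h1, by simp, h2, fun i₁ hi₁ => ?_⟩⟩
    by_contra! hcon
    exact absurd (hmin i₁ (Finset.mem_filter.2 ⟨Finset.mem_univ _, hi₁.le.trans h1, hcon⟩))
      (not_le.2 hi₁)
  have hdisj : Pairwise (Function.onFun Disjoint A) := by
    intro J J' hJ
    refine Set.disjoint_left.2 fun ω hω hω' => hJ ?_
    obtain ⟨i₀, h1, h2, h3, h4⟩ := Set.mem_iUnion.1 hω
    obtain ⟨i₁, h1', h2', h3', h4'⟩ := Set.mem_iUnion.1 hω'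
    have heq : η i₀ ω = η i₁ ω := by
      rcases lt_trichotomy (η i₀ ω) (η i₁ ω) with h | h | h
      · linarith [h4' i₀ h]
      · exact h
      · linarith [h4 i₁ h]
    ext i
    rw [h2, h2', heq]
  -- Flipping the summands outside `J` leaves the stopping data alone, and the two sums up to `s₀`
  -- average to the stopped sum. Hence one of them exceeds `ε`.
  have hinv : ∀ J, ∀ ω ∈ A J, R {i | i ∉ J} ω ∈ A J ∧
      F ω s₀ + F (R {i | i ∉ J} ω) s₀ > 2 * ε := by
    intro J ω hω
    obtain ⟨i₀, h1, h2, h3, h4⟩ := Set.mem_iUnion.1 hω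
    have hpart : ∀ s ≤ η i₀ ω, F (R {i | i ∉ J} ω) s = F ω s := by
      intro s hs
      refine Finset.sum_congr rfl fun i _ => ?_
      rw [hRη]
      split_ifs with h
      · exact hRξ' _ i (by simpa using (h2 i).2 (h.trans hs)) ω
      · rfl
    refine ⟨Set.mem_iUnion.2 ⟨i₀, ?_, ?_, ?_, ?_⟩, ?_⟩
    · rwa [hRη]
    · simpa only [hRη] using h2
    · rw [hRη, hpart _ le_rfl]; exact h3
    · intro i₁ hi₁
      rw [hRη, hRη] at hi₁
      rw [hRη, hpart _ hi₁.le]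
      exact h4 i₁ hi₁
    · have : F ω s₀ + F (R {i | i ∉ J} ω) s₀ = 2 * F ω (η i₀ ω) := by
        simp only [hF, ← Finset.sum_add_distrib, Finset.mul_sum]
        refine Finset.sum_congr rfl fun i _ => ?_
        rw [hRη]
        by_cases hi : i ∈ J
        · have h5 := (h2 i).1 hi
          rw [if_pos (h5.trans h1), if_pos (h5.trans h1), if_pos h5, hRξ' _ i (by simpa using hi)]
          ring
        · have h5 := fun h => hi ((h2 i).2 h)
          rw [if_neg h5, hRξ _ i hi]
          split_ifs <;> ring
      linarith
  have hJ : ∀ J, μ (A J) ≤ 2 * μ (A J ∩ {ω | ε < F ω s₀}) := by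
    intro J
    have hsub : A J ⊆ (A J ∩ {ω | ε < F ω s₀}) ∪
        R {i | i ∉ J} ⁻¹' (A J ∩ {ω | ε < F ω s₀}) := by
      intro ω hω
      obtain ⟨h1, h2⟩ := hinv J ω hω
      by_cases h : ε < F ω s₀
      · exact Or.inl ⟨hω, h⟩
      · exact Or.inr ⟨h1, by simp only [Set.mem_ofPred_eq]; linarith⟩
    refine (measure_mono hsub).trans ((measure_union_le _ _).trans ?_)
    rw [(hR _).measure_preimage ((hAm J).inter
      (measurableSet_lt measurable_const hFm0)).nullMeasurableSet, two_mul]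
  calc μ {ω | ∃ s ≤ s₀, ε < F ω s} ≤ μ (⋃ J, A J) := measure_mono hcover
    _ ≤ ∑ J, μ (A J) := measure_iUnion_fintype_le _ _
    _ ≤ ∑ J, 2 * μ (A J ∩ {ω | ε < F ω s₀}) := Finset.sum_le_sum fun J _ => hJ J
    _ = 2 * μ (⋃ J, A J ∩ {ω | ε < F ω s₀}) := by
      rw [← Finset.mul_sum, measure_iUnion, tsum_fintype]
      · exact fun J J' h => (hdisj h).mono Set.inter_subset_left Set.inter_subset_left
      · exact fun J => (hAm J).inter (measurableSet_lt measurable_const hFm0)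
    _ ≤ 2 * μ {ω | ε < F ω s₀} := by
      gcongr
      exact Set.iUnion_subset fun J => Set.inter_subset_right

end Reflection

/-! ## Gaussian vectors -/

section Orthogonal

variable {E : Type*} [NormedAddCommGroup E] [InnerProductSpace ℝ E]

/-- The component of `u` orthogonal to `x`. -/
noncomputable def orthComp (x u : E) : E := u - (⟪x, u⟫ / ‖x‖ ^ 2) • x

theorem inner_orthComp (x u : E) : ⟪x, orthComp x u⟫ = 0 := by
  unfold orthComp
  rw [inner_sub_right, inner_smul_right, real_inner_self_eq_norm_sq]
  rcases eq_or_ne x 0 with rfl | hx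
  · simp
  · field_simp; ring

theorem norm_orthComp_le (x u : E) : ‖orthComp x u‖ ≤ ‖u‖ := by
  have h1 : u = orthComp x u + (⟪x, u⟫ / ‖x‖ ^ 2) • x := by unfold orthComp; abel
  have h2 : ‖u‖ * ‖u‖ = ‖orthComp x u‖ * ‖orthComp x u‖ +
      ‖(⟪x, u⟫ / ‖x‖ ^ 2) • x‖ * ‖(⟪x, u⟫ / ‖x‖ ^ 2) • x‖ := by
    conv_lhs => rw [h1]
    apply norm_add_sq_eq_norm_sq_add_norm_sq_real
    rw [inner_smul_right, real_inner_comm x (orthComp x u), inner_orthComp, mul_zero]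
  nlinarith [norm_nonneg u, norm_nonneg (orthComp x u),
    mul_self_nonneg ‖(⟪x, u⟫ / ‖x‖ ^ 2) • x‖]

/-- This reflection supplies the sign changes for `levy_maximal`: it keeps the measurement, hence
the truncation decision, and negates the orthogonal component. -/
theorem inner_reflection_span (x a : E) : ⟪x, (ℝ ∙ x).reflection a⟫ = ⟪x, a⟫ := by
  have h := (ℝ ∙ x).reflection.inner_map_map x a
  rwa [Submodule.reflection_mem_subspace_eq_self (Submodule.mem_span_singleton_self x)] at h

theorem inner_reflection_span_of_orthogonal {x u : E} (h : ⟪x, u⟫ = 0) (a : E) :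
    ⟪u, (ℝ ∙ x).reflection a⟫ = -⟪u, a⟫ := by
  have h1 := (ℝ ∙ x).reflection.inner_map_map u a
  rw [Submodule.reflection_mem_subspace_orthogonalComplement_eq_neg
    (Submodule.mem_orthogonal_singleton_iff_inner_right.2 h), inner_neg_left] at h1
  linarith

end Orthogonal

section Gaussian

variable {E : Type*} [NormedAddCommGroup E] [InnerProductSpace ℝ E] [FiniteDimensional ℝ E]
  [MeasurableSpace E] [BorelSpace E]

theorem map_inner_stdGaussian (c : E) :
    (stdGaussian E).map (fun a => ⟪c, a⟫) = gaussianReal 0 (‖c‖ ^ 2).toNNReal := by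
  have := IsGaussian.map_eq_gaussianReal (μ := stdGaussian E) (innerSL ℝ c)
  rw [integral_strongDual_stdGaussian, variance_dual_stdGaussian] at this
  simpa using this

theorem measurePreserving_reflection_stdGaussian (K : Submodule ℝ E) :
    MeasurePreserving K.reflection (stdGaussian E) (stdGaussian E) :=
  ⟨K.reflection.continuous.measurable, stdGaussian_map _⟩

theorem indepFun_inner_stdGaussian {x u : E} (h : ⟪x, u⟫ = 0) :
    IndepFun (fun a => ⟪x, a⟫) (fun a => ⟪u, a⟫) (stdGaussian E) := by
  apply HasGaussianLaw.indepFun_of_covariance_eq_zero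
  · have : HasGaussianLaw (fun a : E => a) (stdGaussian E) := IsGaussian.hasGaussianLaw_id
    exact this.map (((innerSL ℝ x).prod (innerSL ℝ u)))
  · have := covarianceBilin_apply_eq_cov (μ := stdGaussian E) IsGaussian.memLp_two_id x u
    rw [← this, covarianceBilin_stdGaussian, innerSL_apply_apply]
    exact h

theorem lintegral_exp_mul_gaussianReal (v : NNReal) (t : ℝ) :
    ∫⁻ y, ENNReal.ofReal (Real.exp (t * y)) ∂(gaussianReal 0 v) =
      ENNReal.ofReal (Real.exp (v * t ^ 2 / 2)) := by
  have h1 := mgf_gaussianReal (p := gaussianReal 0 v) (X := id) (μ := 0) (v := v) (by simp) t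
  rw [← ofReal_integral_eq_lintegral_ofReal (integrable_exp_mul_gaussianReal t)
    (Filter.Eventually.of_forall fun _ => (Real.exp_pos _).le)]
  congr 1
  simpa [mgf] using h1

/-- The two inner products are independent. Integrating the second one first leaves a Gaussian
moment whose variance parameter contains the truncated square, at most `s²`. Without truncation the
product would only be sub-exponential. -/
theorem lintegral_exp_trunc_mul_le {x u : E} (h : ⟪x, u⟫ = 0) (s lam : ℝ) :
    ∫⁻ a, ENNReal.ofReal (Real.exp (lam * if |⟪x, a⟫| ≤ s then ⟪x, a⟫ * ⟪u, a⟫ else 0))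
      ∂(stdGaussian E) ≤ ENNReal.ofReal (Real.exp (lam ^ 2 * (s ^ 2 * ‖u‖ ^ 2) / 2)) := by
  set g : ℝ × ℝ → ℝ≥0∞ := fun p =>
    ENNReal.ofReal (Real.exp ((lam * if |p.1| ≤ s then p.1 else 0) * p.2)) with hg
  have hite : Measurable fun y : ℝ => if |y| ≤ s then y else 0 :=
    Measurable.ite (measurableSet_le (by fun_prop) measurable_const) measurable_id measurable_const
  have hgm : Measurable g := by
    have h1 : Measurable fun p : ℝ × ℝ => (if |p.1| ≤ s then p.1 else 0) :=
      hite.comp measurable_fst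
    fun_prop
  have hlaw : (stdGaussian E).map (fun a => (⟪x, a⟫, ⟪u, a⟫)) =
      (gaussianReal 0 (‖x‖ ^ 2).toNNReal).prod (gaussianReal 0 (‖u‖ ^ 2).toNNReal) := by
    rw [(indepFun_iff_map_prod_eq_prod_map_map (by fun_prop) (by fun_prop)).1
      (indepFun_inner_stdGaussian h), map_inner_stdGaussian, map_inner_stdGaussian]
  have h1 : ∫⁻ a, ENNReal.ofReal (Real.exp
      (lam * if |⟪x, a⟫| ≤ s then ⟪x, a⟫ * ⟪u, a⟫ else 0)) ∂(stdGaussian E) =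
      ∫⁻ p, g p ∂((gaussianReal 0 (‖x‖ ^ 2).toNNReal).prod (gaussianReal 0 (‖u‖ ^ 2).toNNReal)) := by
    rw [← hlaw, lintegral_map hgm (by fun_prop)]
    refine lintegral_congr fun a => ?_
    simp only [hg]
    congr 2
    split_ifs <;> ring
  rw [h1, lintegral_prod _ hgm.aemeasurable]
  calc _ ≤ ∫⁻ _, ENNReal.ofReal (Real.exp (lam ^ 2 * (s ^ 2 * ‖u‖ ^ 2) / 2))
        ∂(gaussianReal 0 (‖x‖ ^ 2).toNNReal) := by
        refine lintegral_mono fun y => ?_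
        simp only [hg]
        rw [lintegral_exp_mul_gaussianReal, Real.coe_toNNReal _ (by positivity)]
        apply ENNReal.ofReal_le_ofReal
        apply Real.exp_le_exp.2
        have : (if |y| ≤ s then y else 0) ^ 2 ≤ s ^ 2 := by
          split_ifs with hy
          · exact sq_le_sq' (by linarith [neg_abs_le y]) ((le_abs_self y).trans hy)
          · rw [zero_pow two_ne_zero]; positivity
        have h2 := mul_le_mul_of_nonneg_left this (show 0 ≤ lam ^ 2 * ‖u‖ ^ 2 by positivity)
        nlinarith
    _ = _ := by simp

/-- Uniform deviation bound, over all truncation levels `s ≤ s₀`, for the part of truncated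
measurements that is orthogonal to the signal. -/
theorem measure_exists_trunc_sum_gt_le {I : Type*} [Fintype I] (x : I → E) (v : I → ℝ) (u : E)
    (hu : ‖u‖ ≤ 1) {s₀ ε S : ℝ} (hε : 0 ≤ ε) (hS : ∑ i, v i ^ 2 ≤ S) :
    Measure.pi (fun _ : I => stdGaussian E) {ω | ∃ s ≤ s₀, ε < ∑ i,
        if |⟪x i, ω i⟫| ≤ s then v i * (⟪x i, ω i⟫ * ⟪orthComp (x i) u, ω i⟫) else 0} ≤
      2 * ENNReal.ofReal (Real.exp (-(ε ^ 2 / (2 * (s₀ ^ 2 * S))))) := by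
  classical
  set μ := Measure.pi (fun _ : I => stdGaussian E)
  let R : Set I → (I → E) → (I → E) := fun A ω i =>
    (if i ∈ A then (ℝ ∙ x i).reflection else LinearIsometryEquiv.refl ℝ E) (ω i)
  have hR : ∀ A, MeasurePreserving (R A) μ μ := by
    intro A
    refine measurePreserving_pi _ _ fun i => ?_
    split_ifs
    · exact measurePreserving_reflection_stdGaussian _
    · exact MeasurePreserving.id _
  have hlevy := levy_maximal (μ := μ) (η := fun i ω => |⟪x i, ω i⟫|)
    (ξ := fun i ω => v i * (⟪x i, ω i⟫ * ⟪orthComp (x i) u, ω i⟫))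
    (fun i => by fun_prop) (fun i => by fun_prop) R hR
    (fun A i ω => by
      by_cases hi : i ∈ A
      · simp [R, hi, inner_reflection_span]
      · simp [R, hi])
    (fun A i hi ω => by
      simp only [R, hi, if_true, inner_reflection_span,
        inner_reflection_span_of_orthogonal (inner_orthComp (x i) u)]
      ring)
    (fun A i hi ω => by simp [R, hi]) (s₀ := s₀) hε
  refine hlevy.trans ?_
  gcongr
  have hm : ∀ i, Measurable fun a : E =>
      v i * if |⟪x i, a⟫| ≤ s₀ then ⟪x i, a⟫ * ⟪orthComp (x i) u, a⟫ else 0 := fun i =>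
    measurable_const.mul (Measurable.ite (measurableSet_le (by fun_prop) measurable_const)
      (by fun_prop) measurable_const)
  have hch := chernoff_pi_quadratic (γ := stdGaussian E) hm (c := fun i => s₀ ^ 2 * v i ^ 2)
    (fun i => by positivity) (fun i lam => by
      have := lintegral_exp_trunc_mul_le (inner_orthComp (x i) u) s₀ (lam * v i)
      simp only [mul_assoc] at this ⊢
      refine this.trans (ENNReal.ofReal_le_ofReal (Real.exp_le_exp.2 ?_))
      have h1 : ‖orthComp (x i) u‖ ^ 2 ≤ 1 := by
        have := (norm_orthComp_le (x i) u).trans hu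
        exact pow_le_one₀ (norm_nonneg _) this
      have h2 : 0 ≤ (lam * v i) ^ 2 * s₀ ^ 2 := by positivity
      nlinarith [mul_le_mul_of_nonneg_left h1 h2]) hε (S := s₀ ^ 2 * S)
    (by rw [← Finset.mul_sum]; gcongr)
  refine (measure_mono fun ω hω => ?_).trans hch
  simp only [Set.mem_ofPred_eq] at hω ⊢
  refine hω.le.trans (le_of_eq (Finset.sum_congr rfl fun i _ => ?_))
  split_ifs <;> simp

/-! ### Truncated second moments -/

/-- `y ↦ y² 1{|y| ≤ b}`. -/
noncomputable def truncSq (b y : ℝ) : ℝ := if |y| ≤ b then y ^ 2 else 0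

theorem truncSq_nonneg (b y : ℝ) : 0 ≤ truncSq b y := by unfold truncSq; split_ifs <;> positivity

theorem truncSq_le_sq (b y : ℝ) : truncSq b y ≤ y ^ 2 := by
  unfold truncSq; split_ifs <;> [rfl; positivity]

theorem truncSq_le (b y : ℝ) : truncSq b y ≤ b ^ 2 := by
  unfold truncSq
  split_ifs with h
  · rw [← sq_abs]; exact pow_le_pow_left₀ (abs_nonneg y) h 2
  · positivity

theorem measurable_truncSq (b : ℝ) : Measurable (truncSq b) :=
  Measurable.ite (measurableSet_le (by fun_prop) measurable_const) (by fun_prop) measurable_const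

/-- `𝔼[ζ² 1{|ζ| ≤ b}]` for a standard Gaussian `ζ`. -/
noncomputable def truncMean (b : ℝ) : ℝ := ∫ y, truncSq b y ∂(gaussianReal 0 1)

theorem integrable_truncSq (b : ℝ) (μ : Measure ℝ) [IsProbabilityMeasure μ] :
    Integrable (truncSq b) μ :=
  Integrable.of_mem_Icc 0 (b ^ 2) (measurable_truncSq b).aemeasurable
    (Filter.Eventually.of_forall fun y => ⟨truncSq_nonneg b y, truncSq_le b y⟩)

theorem truncMean_pos {b : ℝ} (hb : 0 < b) : 0 < truncMean b := by
  unfold truncMean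
  rw [integral_pos_iff_support_of_nonneg (truncSq_nonneg b) (integrable_truncSq b _)]
  have hsub : Set.Ioo 0 b ⊆ Function.support (truncSq b) := by
    intro y hy
    have : |y| ≤ b := by rw [abs_of_pos hy.1]; exact hy.2.le
    simp [truncSq, this, hy.1.ne']
  refine lt_of_lt_of_le ?_ (measure_mono hsub)
  rw [pos_iff_ne_zero]
  intro h0
  have := gaussianReal_absolutelyContinuous' 0 (one_ne_zero (α := NNReal)) h0
  simp at this
  linarith

/-- Hoeffding's lemma for a variable with values in `[0, b²]`: the variance proxy is `b⁴ / 4`. -/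
theorem lintegral_exp_truncSq_le {e : E} (he : ‖e‖ = 1) (b c lam : ℝ) :
    ∫⁻ a, ENNReal.ofReal (Real.exp (lam * (c * (truncSq b ⟪e, a⟫ - truncMean b))))
      ∂(stdGaussian E) ≤ ENNReal.ofReal (Real.exp (lam ^ 2 * (c ^ 2 * b ^ 4 / 4) / 2)) := by
  have hlaw := map_inner_stdGaussian e
  rw [he] at hlaw
  simp only [one_pow, Real.toNNReal_one] at hlaw
  have hsub := hasSubgaussianMGF_of_mem_Icc (μ := gaussianReal 0 1) (X := truncSq b)
    (a := 0) (b := b ^ 2) (measurable_truncSq b).aemeasurable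
    (Filter.Eventually.of_forall fun y => ⟨truncSq_nonneg b y, truncSq_le b y⟩)
  have hm : Measurable fun y => ENNReal.ofReal (Real.exp (lam * (c * (truncSq b y - truncMean b)))) := by
    have := measurable_truncSq b
    fun_prop
  have h1 := lintegral_map (μ := stdGaussian E) hm (g := fun a : E => ⟪e, a⟫) (by fun_prop)
  rw [← h1, hlaw]
  have h2 := hsub.mgf_le (lam * c)
  have h3 := hsub.integrable_exp_mul (lam * c)
  simp only [mul_assoc] at h2 h3
  rw [← ofReal_integral_eq_lintegral_ofReal (by simpa only [truncMean] using h3)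
    (Filter.Eventually.of_forall fun _ => (Real.exp_pos _).le)]
  apply ENNReal.ofReal_le_ofReal
  simp only [mgf, mul_assoc] at h2
  refine h2.trans (Real.exp_le_exp.2 (le_of_eq ?_))
  simp
  ring

/-- The weights may have either sign, so this gives upper and lower tails. Unit norm is asked only
where `c i ≠ 0`, because `direction` vanishes on zero columns. -/
theorem measure_truncSq_sum_ge_le {I : Type*} [Fintype I] (e : I → E) (c : I → ℝ)
    (he : ∀ i, c i ≠ 0 → ‖e i‖ = 1) (b : ℝ) {t S : ℝ} (ht : 0 ≤ t)
    (hS : ∑ i, c i ^ 2 ≤ S) : Measure.pi (fun _ : I => stdGaussian E)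
        {ω | t ≤ ∑ i, c i * (truncSq b ⟪e i, ω i⟫ - truncMean b)} ≤
      ENNReal.ofReal (Real.exp (-(2 * t ^ 2 / (b ^ 4 * S)))) := by
  have hch := chernoff_pi_quadratic (γ := stdGaussian E)
    (f := fun i a => c i * (truncSq b ⟪e i, a⟫ - truncMean b))
    (fun i => by have := measurable_truncSq b; fun_prop) (c := fun i => c i ^ 2 * b ^ 4 / 4)
    (fun i => by positivity) (fun i lam => by
      by_cases hc : c i = 0
      · simp [hc]
      · exact lintegral_exp_truncSq_le (he i hc) b (c i) lam) ht (S := S * b ^ 4 / 4)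
    (by rw [← Finset.sum_div, ← Finset.sum_mul]; gcongr)
  refine hch.trans (le_of_eq ?_)
  congr 3
  rcases eq_or_ne (b ^ 4 * S) 0 with h0 | h0
  · rw [mul_comm S, h0]; simp
  · rw [mul_comm S]
    field_simp
    norm_num

/-- `𝔼 exp(ζ² / 4)` for a standard Gaussian `ζ`. -/
noncomputable def expSqMean : ℝ := ∫ y, Real.exp (y ^ 2 / 4) ∂(gaussianReal 0 1)

theorem integrable_exp_sq : Integrable (fun y : ℝ => Real.exp (y ^ 2 / 4)) (gaussianReal 0 1) := by
  rw [gaussianReal_of_var_ne_zero _ one_ne_zero]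
  rw [integrable_withDensity_iff (measurable_gaussianPDF 0 1)
    (Filter.Eventually.of_forall fun y => gaussianPDF_lt_top)]
  have h := (integrable_exp_neg_mul_sq (b := 1 / 4) (by norm_num)).const_mul (√(2 * Real.pi))⁻¹
  refine h.congr (Filter.Eventually.of_forall fun y => ?_)
  simp only [toReal_gaussianPDF, gaussianPDFReal]
  simp only [NNReal.coe_one, mul_one, sub_zero]
  rw [mul_left_comm, ← Real.exp_add]
  congr 2
  ring

theorem one_le_expSqMean : 1 ≤ expSqMean := by
  have h : ∫ _ : ℝ, (1 : ℝ) ∂(gaussianReal 0 1) = 1 := by simp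
  rw [← h]
  exact integral_mono (integrable_const _) integrable_exp_sq
    fun y => Real.one_le_exp (by positivity)

/-- By convexity `exp (s v) ≤ 1 - s + s exp v`, so the single constant `expSqMean` controls all
weights `s` in `[0, 1]`. -/
theorem lintegral_exp_sq_le {e : E} (he : ‖e‖ = 1) {s : ℝ} (h0 : 0 ≤ s) (h1 : s ≤ 1) :
    ∫⁻ a, ENNReal.ofReal (Real.exp (s * (⟪e, a⟫ ^ 2 / 4))) ∂(stdGaussian E) ≤
      ENNReal.ofReal (Real.exp (s * (expSqMean - 1))) := by
  have hlaw := map_inner_stdGaussian e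
  rw [he] at hlaw
  simp only [one_pow, Real.toNNReal_one] at hlaw
  have h2 := lintegral_map (μ := stdGaussian E)
    (f := fun y : ℝ => ENNReal.ofReal (Real.exp (s * (y ^ 2 / 4)))) (by fun_prop)
    (g := fun a : E => ⟪e, a⟫) (by fun_prop)
  rw [← h2, hlaw]
  calc _ ≤ ∫⁻ y, ENNReal.ofReal (1 - s + s * Real.exp (y ^ 2 / 4)) ∂(gaussianReal 0 1) := by
        refine lintegral_mono fun y => ENNReal.ofReal_le_ofReal ?_
        have := convexOn_exp.2 (Set.mem_univ 0) (Set.mem_univ (y ^ 2 / 4))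
          (sub_nonneg.2 h1) h0 (by ring)
        simpa using this
    _ = ENNReal.ofReal (1 - s + s * expSqMean) := by
        rw [← ofReal_integral_eq_lintegral_ofReal]
        · rw [integral_add (integrable_const _) (integrable_exp_sq.const_mul _),
            integral_const_mul]
          simp [expSqMean]
        · exact (integrable_const _).add (integrable_exp_sq.const_mul _)
        · refine Filter.Eventually.of_forall fun y => ?_
          have := Real.exp_pos (y ^ 2 / 4)
          simp only [Pi.zero_apply]
          nlinarith
    _ ≤ _ := by
        apply ENNReal.ofReal_le_ofReal
        have := Real.add_one_le_exp (s * (expSqMean - 1))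
        linarith

/-- After division by `W` the weights lie in `[0, 1]`. Taking the deviation equal to the total
weight turns the mean bound `expSqMean - 1` into `expSqMean`, and `4` undoes the quarter in the
exponent. -/
theorem measure_sq_sum_ge_le {I : Type*} [Fintype I] (e : I → E) (w : I → ℝ) {W : ℝ} (hW : 0 < W)
    (hw0 : ∀ i, 0 ≤ w i) (hw : ∀ i, w i ≤ W) (he : ∀ i, w i ≠ 0 → ‖e i‖ = 1) :
    Measure.pi (fun _ : I => stdGaussian E)
        {ω | 4 * expSqMean * ∑ i, w i ≤ ∑ i, w i * ⟪e i, ω i⟫ ^ 2} ≤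
      ENNReal.ofReal (Real.exp (-((∑ i, w i) / W))) := by
  have hch := chernoff_pi (γ := stdGaussian E)
    (f := fun i a => w i / W * (⟪e i, a⟫ ^ 2 / 4)) (fun i => by fun_prop)
    (b := fun i => w i / W * (expSqMean - 1)) (fun i => by
      by_cases hc : w i = 0
      · simp [hc]
      · exact lintegral_exp_sq_le (he i hc) (div_nonneg (hw0 i) hW.le)
          ((div_le_one hW).2 (hw i))) ((∑ i, w i) / W)
  refine (measure_mono fun ω hω => ?_).trans hch
  simp only [Set.mem_ofPred_eq] at hω ⊢
  rw [← Finset.sum_mul, ← Finset.sum_div]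
  have h1 : ∑ i, w i / W * (⟪e i, ω i⟫ ^ 2 / 4) = (∑ i, w i * ⟪e i, ω i⟫ ^ 2) / (4 * W) := by
    rw [Finset.sum_div]
    exact Finset.sum_congr rfl fun i _ => by field_simp
  rw [h1, le_div_iff₀ (by positivity)]
  refine le_trans (le_of_eq ?_) hω
  field_simp
  ring

end Gaussian

/-! ## The power method -/

/-- The ratios `c (k + 1) / c k` increase, hence so do their running geometric means. The
division-free form allows zeros. -/
theorem pow_le_of_logConvex {c : ℕ → ℝ} (h0 : ∀ k, 0 ≤ c k)
    (h : ∀ k, c (k + 1) ^ 2 ≤ c k * c (k + 2)) (k : ℕ) :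
    c k ^ (k + 1) ≤ c (k + 1) ^ k * c 0 := by
  induction k with
  | zero => simp
  | succ k ih =>
    rcases eq_or_lt_of_le (h0 (k + 1)) with hk | hk
    · rw [← hk]
      simp only [ne_eq, Nat.add_eq_zero_iff, one_ne_zero, and_false, not_false_eq_true, zero_pow]
      exact mul_nonneg (pow_nonneg (h0 _) _) (h0 0)
    · have h1 : (c (k + 1) ^ 2) ^ (k + 1) ≤ (c k * c (k + 2)) ^ (k + 1) :=
        pow_le_pow_left₀ (sq_nonneg _) (h k) _
      rw [mul_pow] at h1
      have h2 := h1.trans (mul_le_mul_of_nonneg_right ih (pow_nonneg (h0 (k + 2)) (k + 1)))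
      have h3 : c (k + 1) ^ k * c (k + 1) ^ (k + 2) ≤
          c (k + 1) ^ k * (c (k + 2) ^ (k + 1) * c 0) := by
        calc _ = (c (k + 1) ^ 2) ^ (k + 1) := by ring
          _ ≤ _ := h2
          _ = _ := by ring
      exact le_of_mul_le_mul_left h3 (pow_pos hk k)

/-- The last growth ratio of a log-convex sequence is at least the geometric mean of all of them. -/
theorem le_of_logConvex {c : ℕ → ℝ} (h0 : ∀ k, 0 ≤ c k)
    (h : ∀ k, c (k + 1) ^ 2 ≤ c k * c (k + 2)) {b : ℝ} (hb : 0 ≤ b) (m : ℕ)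
    (hm : b ^ (m + 1) * c 0 ≤ c (m + 1)) : b * c m ≤ c (m + 1) := by
  have h1 := pow_le_of_logConvex h0 h m
  refine le_of_pow_le_pow_left₀ (Nat.succ_ne_zero m) (h0 _) ?_
  calc (b * c m) ^ (m + 1) = b ^ (m + 1) * c m ^ (m + 1) := mul_pow _ _ _
    _ ≤ b ^ (m + 1) * (c (m + 1) ^ m * c 0) := by gcongr
    _ = c (m + 1) ^ m * (b ^ (m + 1) * c 0) := by ring
    _ ≤ c (m + 1) ^ m * c (m + 1) := by have := h0 (m + 1); gcongr
    _ = c (m + 1) ^ (m + 1) := by ring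

section Power

variable {E F : Type*} [NormedAddCommGroup E] [InnerProductSpace ℝ E]
  [NormedAddCommGroup F] [InnerProductSpace ℝ F]

/-- A symmetric operator that is at least `a` on an `r`-dimensional subspace has `r` orthonormal
eigenvectors with eigenvalues at least `a`. -/
theorem exists_orthonormal_eigenvectors [FiniteDimensional ℝ E] {H : E →ₗ[ℝ] E} (hH : H.IsSymmetric) {a : ℝ} {r : ℕ}
    (S : Submodule ℝ E) (hS : Module.finrank ℝ S = r)
    (h : ∀ u ∈ S, a * ‖u‖ ^ 2 ≤ ⟪u, H u⟫) :
    ∃ (Q : Fin r → E) (l : Fin r → ℝ), Orthonormal ℝ Q ∧ (∀ i, H (Q i) = l i • Q i) ∧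
      ∀ i, a ≤ l i := by
  classical
  set N := Module.finrank ℝ E with hN
  set e := hH.eigenvectorBasis hN.symm with he
  set l := hH.eigenvalues hN.symm with hl
  have hel : ∀ i, H (e i) = l i • e i := fun i => by
    exact hH.apply_eigenvectorBasis hN.symm i
  let S₀ : Finset (Fin N) := Finset.univ.filter fun i => a ≤ l i
  -- Courant–Fischer: with fewer than `r` eigenvalues at least `a`, some nonzero `u ∈ S` would be
  -- orthogonal to their eigenvectors, and its quadratic form would be below `a ‖u‖²`.
  have hcard : r ≤ S₀.card := by
    by_contra! hlt
    let f : S →ₗ[ℝ] (S₀ → ℝ) := LinearMap.pi fun i => (innerₛₗ ℝ (e i)).comp S.subtype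
    have hker := LinearMap.ker_ne_bot_of_finrank_lt (f := f) (by
      rw [Module.finrank_fintype_fun_eq_card, hS, Fintype.card_coe]; exact hlt)
    obtain ⟨u, hu, hu0⟩ := (Submodule.ne_bot_iff _).1 hker
    have hort : ∀ i ∈ S₀, ⟪e i, (u : E)⟫ = 0 := fun i hi =>
      congrFun (LinearMap.mem_ker.1 hu) ⟨i, hi⟩
    have h1 := h u u.2
    have h2 : ⟪(u : E), H u⟫ = ∑ i, l i * ⟪e i, (u : E)⟫ ^ 2 := by
      rw [← e.sum_inner_mul_inner]
      refine Finset.sum_congr rfl fun i _ => ?_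
      rw [← hH, hel, inner_smul_left, real_inner_comm]
      simp; ring
    have h3 : ‖(u : E)‖ ^ 2 = ∑ i, ⟪e i, (u : E)⟫ ^ 2 := (e.sum_sq_inner_right _).symm
    rw [h2, h3, Finset.mul_sum] at h1
    have hne : ∃ i, ⟪e i, (u : E)⟫ ≠ 0 := by
      by_contra! hall
      apply hu0
      have : ‖(u : E)‖ ^ 2 = 0 := by rw [h3]; simp [hall]
      simpa using this
    obtain ⟨i, hi⟩ := hne
    have h4 : ∑ i, l i * ⟪e i, (u : E)⟫ ^ 2 < ∑ i, a * ⟪e i, (u : E)⟫ ^ 2 := by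
      refine Finset.sum_lt_sum (fun j _ => ?_) ⟨i, Finset.mem_univ i, ?_⟩
      · by_cases hj : j ∈ S₀
        · simp [hort j hj]
        · have : l j < a := by simpa [S₀] using hj
          gcongr
      · have hi' : i ∉ S₀ := fun h => hi (hort i h)
        have : l i < a := by simpa [S₀] using hi'
        have := sq_pos_of_ne_zero hi
        gcongr
    linarith
  obtain ⟨T, hTS, hT⟩ := Finset.exists_subset_card_eq hcard
  let g : Fin r ≃ T := (T.equivFinOfCardEq hT).symm
  refine ⟨fun i => e (g i), fun i => l (g i), ?_, fun i => hel _, fun i => ?_⟩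
  · exact e.orthonormal.comp _ (Subtype.val_injective.comp g.injective)
  · simpa [S₀] using hTS (g i).2

theorem norm_pow_apply_ge {H : E →ₗ[ℝ] E} (hH : H.IsSymmetric) {a : ℝ} (ha : 0 ≤ a) {r : ℕ}
    {Q : Fin r → E} {l : Fin r → ℝ} (hQ : Orthonormal ℝ Q) (hl : ∀ i, H (Q i) = l i • Q i)
    (hal : ∀ i, a ≤ l i) (T : ℕ) (z : E) :
    a ^ T * Real.sqrt (∑ i, ⟪Q i, z⟫ ^ 2) ≤ ‖(H ^ T) z‖ := by
  have hpow : ∀ i, ⟪Q i, (H ^ T) z⟫ = l i ^ T * ⟪Q i, z⟫ := by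
    intro i
    induction T with
    | zero => simp
    | succ T ih =>
      rw [pow_succ', Module.End.mul_apply, ← hH, hl, inner_smul_left, ih]
      simp; ring
  have h1 := hQ.sum_inner_products_le (x := (H ^ T) z) (s := Finset.univ)
  apply le_of_sq_le_sq _ (norm_nonneg _)
  rw [mul_pow, Real.sq_sqrt (Finset.sum_nonneg fun _ _ => sq_nonneg _)]
  refine le_trans ?_ h1
  rw [Finset.mul_sum]
  refine Finset.sum_le_sum fun i _ => ?_
  rw [hpow, Real.norm_eq_abs, sq_abs, mul_pow]
  have := hal i
  gcongr

/-- After `T` steps of the power method for `M Mᵀ`, a vector that was not too close to the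
orthogonal complement of the dominant eigenspace is close to the range of the main part of `M`. -/
theorem power_method [FiniteDimensional ℝ E] [FiniteDimensional ℝ F] (M : F →ₗ[ℝ] E)
    (P : E →ₗ[ℝ] E) {ε θ : ℝ} (hθ : 0 < θ) (hε : 0 ≤ ε)
    (hP : ∀ w, ‖P (M w)‖ ≤ ε * ‖w‖) {r : ℕ} (S : Submodule ℝ E) (hS : Module.finrank ℝ S = r)
    (hM : ∀ u ∈ S, θ * ‖u‖ ≤ ‖M.adjoint u‖) :
    ∃ Q : Fin r → E, Orthonormal ℝ Q ∧ ∀ (T : ℕ) (z : E),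
      ‖z‖ ≤ 4 ^ (T + 1) * Real.sqrt (∑ i, ⟪Q i, z⟫ ^ 2) →
      ‖P (((M ∘ₗ M.adjoint) ^ (T + 1)) z)‖ ≤ 2 * ε / θ * ‖((M ∘ₗ M.adjoint) ^ (T + 1)) z‖ ∧
      (θ / 2) ^ (2 * T + 2) * ‖z‖ ≤ ‖((M ∘ₗ M.adjoint) ^ (T + 1)) z‖ := by
  set H := M ∘ₗ M.adjoint with hHdef
  have hHq : ∀ u v, ⟪u, H v⟫ = ⟪M.adjoint u, M.adjoint v⟫ := fun u v => by
    rw [hHdef, LinearMap.comp_apply, LinearMap.adjoint_inner_left]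
  have hH : H.IsSymmetric := fun u v => by
    rw [hHq, real_inner_comm, hHq, real_inner_comm]
  obtain ⟨Q, l, hQ, hl, hal⟩ := exists_orthonormal_eigenvectors hH (a := θ ^ 2) S hS
    (fun u hu => by
      rw [hHq, real_inner_self_eq_norm_sq, ← mul_pow]
      exact pow_le_pow_left₀ (by positivity) (hM u hu) 2)
  refine ⟨Q, hQ, fun T z hz => ?_⟩
  have hlow := norm_pow_apply_ge hH (sq_nonneg θ) hQ hl hal (T + 1) z
  -- The norms of `z, Mᵀz, MMᵀz, …`. Counting half steps makes the Cauchy–Schwarz inequality exactly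
  -- log-convexity.
  set c : ℕ → ℝ := fun k => if Even k then ‖(H ^ (k / 2)) z‖ else ‖M.adjoint ((H ^ (k / 2)) z)‖
    with hc
  have hc0 : ∀ k, 0 ≤ c k := fun k => by simp only [hc]; split_ifs <;> positivity
  have hce : ∀ j, c (2 * j) = ‖(H ^ j) z‖ := fun j => by simp [hc]
  have hco : ∀ j, c (2 * j + 1) = ‖M.adjoint ((H ^ j) z)‖ := fun j => by
    have h1 : ¬ Even (2 * j + 1) := by simp
    have h2 : (2 * j + 1) / 2 = j := by omega
    simp only [hc, h1, if_false, h2]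
  have hlc : ∀ k, c (k + 1) ^ 2 ≤ c k * c (k + 2) := by
    intro k
    rcases Nat.even_or_odd' k with ⟨j, rfl | rfl⟩
    · rw [hco, hce, show 2 * j + 2 = 2 * (j + 1) by ring, hce, ← real_inner_self_eq_norm_sq, ← hHq,
        pow_succ' H j, Module.End.mul_apply]
      exact real_inner_le_norm _ _
    · rw [show 2 * j + 1 + 1 = 2 * (j + 1) by ring, show 2 * j + 1 + 2 = 2 * (j + 1) + 1 by ring,
        hco, hco, hce, ← real_inner_self_eq_norm_sq]
      conv_lhs => rw [pow_succ' H j, Module.End.mul_apply, hHq, real_inner_comm]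
      rw [pow_succ' H j, Module.End.mul_apply]
      exact real_inner_le_norm _ _
  -- The loss `4 ^ (T + 1)` allowed for the start costs one factor `1/2` in each of the `2T + 2`
  -- half steps.
  have hm : (θ / 2) ^ (2 * T + 2) * ‖z‖ ≤ ‖(H ^ (T + 1)) z‖ := by
    refine le_trans ?_ hlow
    calc (θ / 2) ^ (2 * T + 2) * ‖z‖
        ≤ (θ / 2) ^ (2 * T + 2) * (4 ^ (T + 1) * Real.sqrt (∑ i, ⟪Q i, z⟫ ^ 2)) := by gcongr
      _ = _ := by
        rw [show 2 * T + 2 = 2 * (T + 1) by ring, pow_mul, ← mul_assoc, ← mul_pow]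
        ring
  have hstep := le_of_logConvex hc0 hlc (b := θ / 2) (by positivity) (2 * T + 1) (by
    rw [show 2 * T + 1 + 1 = 2 * (T + 1) by ring, hce, show c 0 = ‖z‖ by simp [hc]]
    exact hm)
  rw [show 2 * T + 1 + 1 = 2 * (T + 1) by ring, hce, hco] at hstep
  refine ⟨?_, hm⟩
  have h1 : (H ^ (T + 1)) z = M (M.adjoint ((H ^ T) z)) := by
    rw [pow_succ' H T, Module.End.mul_apply, hHdef, LinearMap.comp_apply]
  have h2 := hP (M.adjoint ((H ^ T) z))
  rw [← h1] at h2
  refine h2.trans ?_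
  calc ε * ‖M.adjoint ((H ^ T) z)‖ = 2 * ε / θ * (θ / 2 * ‖M.adjoint ((H ^ T) z)‖) := by
        field_simp
    _ ≤ _ := by gcongr

end Power

section

open Matrix

/-! ## Matrices as operators between Euclidean spaces -/

section MatrixOperators

variable {a b n q r : ℕ}

theorem frob_sq_eq_sum (M : Matrix (Fin a) (Fin b) ℝ) : frob M ^ 2 = ∑ i, ∑ j, M i j ^ 2 :=
  Real.sq_sqrt (Finset.sum_nonneg fun _ _ => Finset.sum_nonneg fun _ _ => sq_nonneg _)

theorem frob_sq (M : Matrix (Fin a) (Fin b) ℝ) : frob M ^ 2 = (Mᵀ * M).trace := by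
  rw [frob_sq_eq_sum, Finset.sum_comm]
  simp only [Matrix.trace, Matrix.diag, Matrix.mul_apply, Matrix.transpose_apply, pow_two]

theorem frob_sq_eq_sum_norm (M : Matrix (Fin a) (Fin b) ℝ) :
    frob M ^ 2 = ∑ j, ‖M.toEuclideanLin (EuclideanSpace.single j 1)‖ ^ 2 := by
  rw [frob_sq_eq_sum, Finset.sum_comm]
  refine Finset.sum_congr rfl fun j _ => ?_
  rw [EuclideanSpace.real_norm_sq_eq]
  refine Finset.sum_congr rfl fun i _ => ?_
  simp [Matrix.toLpLin_apply]

theorem adjoint_toEuclideanLin (M : Matrix (Fin a) (Fin b) ℝ) :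
    M.toEuclideanLin.adjoint = Mᵀ.toEuclideanLin := by
  rw [← Matrix.toEuclideanLin_conjTranspose_eq_adjoint, Matrix.conjTranspose_eq_transpose_of_trivial]

theorem norm_toEuclideanLin_of_orthonormal {U : Matrix (Fin n) (Fin r) ℝ} (hU : Uᵀ * U = 1)
    (x : EuclideanSpace ℝ (Fin r)) : ‖U.toEuclideanLin x‖ = ‖x‖ := by
  have h : ⟪U.toEuclideanLin x, U.toEuclideanLin x⟫ = ⟪x, x⟫ := by
    rw [← LinearMap.adjoint_inner_right, adjoint_toEuclideanLin, ← LinearMap.comp_apply,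
      ← Matrix.toLpLin_mul_same, hU, Matrix.toLpLin_one, LinearMap.id_apply]
  rw [real_inner_self_eq_norm_sq, real_inner_self_eq_norm_sq] at h
  exact (sq_eq_sq₀ (norm_nonneg _) (norm_nonneg _)).1 h

theorem norm_transpose_toEuclideanLin_le {W : Matrix (Fin a) (Fin b) ℝ} {ε : ℝ}
    (hε : 0 ≤ ε) (hW : ∀ w, ‖W.toEuclideanLin w‖ ≤ ε * ‖w‖) (u : EuclideanSpace ℝ (Fin a)) :
    ‖Wᵀ.toEuclideanLin u‖ ≤ ε * ‖u‖ := by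
  rcases eq_or_ne (Wᵀ.toEuclideanLin u) 0 with h0 | h0
  · rw [h0, norm_zero]; positivity
  · have hpos := norm_pos_iff.2 h0
    have h1 : ‖Wᵀ.toEuclideanLin u‖ ^ 2 = ⟪u, W.toEuclideanLin (Wᵀ.toEuclideanLin u)⟫ := by
      rw [← real_inner_self_eq_norm_sq, ← adjoint_toEuclideanLin, LinearMap.adjoint_inner_left]
    have h2 : ‖Wᵀ.toEuclideanLin u‖ ^ 2 ≤ ‖u‖ * (ε * ‖Wᵀ.toEuclideanLin u‖) := by
      rw [h1]
      exact (real_inner_le_norm _ _).trans (by gcongr; exact hW _)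
    nlinarith

theorem proj_compl_mul_self {U : Matrix (Fin n) (Fin r) ℝ} (hU : Uᵀ * U = 1) :
    (1 - U * Uᵀ) * U = 0 := by
  rw [Matrix.sub_mul, Matrix.one_mul, Matrix.mul_assoc, hU, Matrix.mul_one, sub_self]

theorem proj_compl_sq {U : Matrix (Fin n) (Fin r) ℝ} (hU : Uᵀ * U = 1) :
    (1 - U * Uᵀ)ᵀ * (1 - U * Uᵀ) = 1 - U * Uᵀ := by
  have h1 : (1 - U * Uᵀ)ᵀ = 1 - U * Uᵀ := by simp
  rw [h1, Matrix.mul_sub, Matrix.mul_one, ← Matrix.mul_assoc, proj_compl_mul_self hU]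
  simp

theorem norm_proj_compl_le {U : Matrix (Fin n) (Fin r) ℝ} (hU : Uᵀ * U = 1)
    (z : EuclideanSpace ℝ (Fin n)) : ‖(1 - U * Uᵀ).toEuclideanLin z‖ ≤ ‖z‖ := by
  have h : ‖(1 - U * Uᵀ).toEuclideanLin z‖ ^ 2 = ⟪(1 - U * Uᵀ).toEuclideanLin z, z⟫ := by
    rw [← real_inner_self_eq_norm_sq, ← LinearMap.adjoint_inner_left, adjoint_toEuclideanLin,
      ← LinearMap.comp_apply, ← Matrix.toLpLin_mul_same, proj_compl_sq hU]
  have h2 := h.le.trans (real_inner_le_norm _ _)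
  by_contra! hlt
  nlinarith [norm_nonneg z, norm_nonneg ((1 - U * Uᵀ).toEuclideanLin z)]

theorem frob_sq_subspaceDist {U Z : Matrix (Fin n) (Fin r) ℝ} (hU : Uᵀ * U = 1)
    (hZ : Zᵀ * Z = 1) : subspaceDist U Z ^ 2 = r - (U * Uᵀ * (Z * Zᵀ)).trace := by
  unfold subspaceDist
  rw [frob_sq, Matrix.transpose_mul, Matrix.mul_assoc, ← Matrix.mul_assoc (1 - U * Uᵀ)ᵀ,
    proj_compl_sq hU, Matrix.sub_mul, Matrix.mul_sub, Matrix.one_mul, hZ, Matrix.trace_sub]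
  congr 1
  · simp
  · rw [Matrix.trace_mul_comm, Matrix.mul_assoc]

/-- Projection distance and subspace distance. -/
theorem norm_vec_proj_sub {U Z : Matrix (Fin n) (Fin r) ℝ} (hU : Uᵀ * U = 1) (hZ : Zᵀ * Z = 1) :
    ‖vec (Z * Zᵀ) - vec (U * Uᵀ)‖ ^ 2 = 2 * subspaceDist U Z ^ 2 := by
  have h1 : ‖vec (Z * Zᵀ) - vec (U * Uᵀ)‖ ^ 2 = frob (Z * Zᵀ - U * Uᵀ) ^ 2 := by
    rw [frob_sq_eq_sum, EuclideanSpace.real_norm_sq_eq, Fintype.sum_prod_type]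
    rfl
  have hidem : ∀ {Y : Matrix (Fin n) (Fin r) ℝ}, Yᵀ * Y = 1 → Y * Yᵀ * (Y * Yᵀ) = Y * Yᵀ := by
    intro Y hY
    rw [Matrix.mul_assoc, ← Matrix.mul_assoc Yᵀ, hY, Matrix.one_mul]
  have htr : ∀ {Y : Matrix (Fin n) (Fin r) ℝ}, Yᵀ * Y = 1 → (Y * Yᵀ).trace = r := by
    intro Y hY
    rw [Matrix.trace_mul_comm, hY]; simp
  rw [h1, frob_sq, frob_sq_subspaceDist hU hZ]
  have h2 : (Z * Zᵀ - U * Uᵀ)ᵀ = Z * Zᵀ - U * Uᵀ := by simp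
  rw [h2, Matrix.sub_mul, Matrix.mul_sub, Matrix.mul_sub, hidem hU, hidem hZ]
  simp only [Matrix.trace_sub, htr hU, htr hZ]
  rw [Matrix.trace_mul_comm (Z * Zᵀ) (U * Uᵀ)]
  ring

theorem norm_vec_proj {Z : Matrix (Fin n) (Fin r) ℝ} (hZ : Zᵀ * Z = 1) :
    ‖vec (Z * Zᵀ)‖ ^ 2 = r := by
  have h1 : ‖vec (Z * Zᵀ)‖ ^ 2 = frob (Z * Zᵀ) ^ 2 := by
    rw [frob_sq_eq_sum, EuclideanSpace.real_norm_sq_eq, Fintype.sum_prod_type]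
    rfl
  rw [h1, frob_sq]
  have h2 : (Z * Zᵀ)ᵀ = Z * Zᵀ := by simp
  rw [h2, Matrix.mul_assoc, ← Matrix.mul_assoc Zᵀ, hZ, Matrix.one_mul, Matrix.trace_mul_comm, hZ]
  simp

/-- The linear combinations of the columns `u j` have a component in the span of `Q` that is not
too small. -/
def StartGood {E : Type*} [NormedAddCommGroup E] [InnerProductSpace ℝ E] (Q u : Fin r → E)
    (c : ℝ) : Prop :=
  ∀ x : Fin r → ℝ, x ≠ 0 → 0 < ‖∑ j, x j • u j‖ ∧
    ‖∑ j, x j • u j‖ ≤ c * Real.sqrt (∑ i, ⟪Q i, ∑ j, x j • u j⟫ ^ 2)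

/-- The columns of a matrix. -/
def cols (M : Fin n → Fin r → ℝ) (j : Fin r) : EuclideanSpace ℝ (Fin n) :=
  WithLp.toLp 2 fun i => M i j

theorem toEuclideanLin_eq_sum_cols (M : Matrix (Fin n) (Fin r) ℝ) (x : Fin r → ℝ) :
    M.toEuclideanLin (WithLp.toLp 2 x) = ∑ j, x j • cols M j := by
  ext i
  simp [cols, Matrix.mulVec, dotProduct, mul_comm]

/-- On the range of `U` the transpose of `M` is bounded below by `2θ - ε ≥ θ`, so `power_method`
applies. Each of the `r` columns of `Z` is a power iterate of a vector in the span of the start,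
hence the factor `√r`. `Q` is chosen before `T` and `U₀`, which lets the random start be drawn after
it. -/
theorem subspaceDist_power_le {U : Matrix (Fin n) (Fin r) ℝ} (hU : Uᵀ * U = 1)
    {M W : Matrix (Fin n) (Fin q) ℝ} {G : Matrix (Fin r) (Fin q) ℝ} (hM : M = U * G + W)
    {ε θ : ℝ} (hθ : 0 < θ) (hε : 0 ≤ ε) (hεθ : ε ≤ θ)
    (hW : ∀ w, ‖W.toEuclideanLin w‖ ≤ ε * ‖w‖)
    (hG : ∀ u, 2 * θ * ‖u‖ ≤ ‖Gᵀ.toEuclideanLin u‖) :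
    ∃ Q : Fin r → EuclideanSpace ℝ (Fin n), Orthonormal ℝ Q ∧
      ∀ (T : ℕ) (U₀ Z : Matrix (Fin n) (Fin r) ℝ) (R : Matrix (Fin r) (Fin r) ℝ),
        StartGood Q (cols U₀) (4 ^ (T + 1)) → Zᵀ * Z = 1 → (M * Mᵀ) ^ (T + 1) * U₀ = Z * R →
        subspaceDist U Z ≤ Real.sqrt r * (2 * ε / θ) := by
  set P := (1 - U * Uᵀ).toEuclideanLin with hP
  let S := LinearMap.range U.toEuclideanLin
  have hinj : Function.Injective U.toEuclideanLin := by
    refine (injective_iff_map_eq_zero _).2 fun x hx => ?_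
    rw [← norm_eq_zero, norm_toEuclideanLin_of_orthonormal hU, norm_eq_zero] at hx
    exact hx
  have hS : Module.finrank ℝ S = r := by
    rw [LinearMap.finrank_range_of_inj hinj]; simp
  obtain ⟨Q, hQ, hpow⟩ := power_method M.toEuclideanLin P hθ hε
    (fun w => by
      rw [hP, ← LinearMap.comp_apply, ← Matrix.toLpLin_mul_same, hM, Matrix.mul_add,
        ← Matrix.mul_assoc, proj_compl_mul_self hU, Matrix.zero_mul, zero_add,
        Matrix.toLpLin_mul_same, LinearMap.comp_apply]
      exact (norm_proj_compl_le hU _).trans (hW w)) S hS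
    (fun u hu => by
      obtain ⟨x, rfl⟩ := hu
      rw [norm_toEuclideanLin_of_orthonormal hU, adjoint_toEuclideanLin, ← LinearMap.comp_apply,
        ← Matrix.toLpLin_mul_same, hM, Matrix.transpose_add, Matrix.transpose_mul, Matrix.add_mul,
        Matrix.mul_assoc, hU, Matrix.mul_one, map_add, LinearMap.add_apply,
        Matrix.toLpLin_mul_same 2 Wᵀ, LinearMap.comp_apply]
      have h1 := hG x
      have h2 := norm_transpose_toEuclideanLin_le hε hW (U.toEuclideanLin x)
      rw [norm_toEuclideanLin_of_orthonormal hU] at h2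
      have h3 := norm_sub_le_norm_add (Gᵀ.toEuclideanLin x)
        (Wᵀ.toEuclideanLin (U.toEuclideanLin x))
      nlinarith [norm_nonneg x])
  refine ⟨Q, hQ, fun T U₀ Z R hstart hZ heq => ?_⟩
  have hHpow : ((M.toEuclideanLin ∘ₗ M.toEuclideanLin.adjoint) ^ (T + 1)) =
      ((M * Mᵀ) ^ (T + 1)).toEuclideanLin := by
    rw [adjoint_toEuclideanLin, ← Matrix.toLpLin_mul_same, Matrix.toLpLin_pow]
  have happ : ∀ x : Fin r → ℝ, ((M * Mᵀ) ^ (T + 1)).toEuclideanLin (∑ j, x j • cols U₀ j) =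
      Z.toEuclideanLin (WithLp.toLp 2 (R *ᵥ x)) := by
    intro x
    rw [← toEuclideanLin_eq_sum_cols, ← LinearMap.comp_apply, ← Matrix.toLpLin_mul_same, heq,
      Matrix.toLpLin_mul_same, LinearMap.comp_apply]
    congr 1
  -- The lower growth bound excludes a rank loss. So `R` is invertible, and every column of `Z`
  -- comes from the start.
  have hRinj : Function.Injective R.mulVec := by
    refine (injective_iff_map_eq_zero (Matrix.mulVecLin R)).2 fun x hx => ?_
    by_contra hx0
    obtain ⟨h1, h2⟩ := hstart x hx0
    have h3 := (hpow T _ h2).2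
    rw [hHpow, happ] at h3
    rw [Matrix.mulVecLin_apply] at hx
    rw [hx, WithLp.toLp_zero, map_zero, norm_zero] at h3
    have : 0 < (θ / 2) ^ (2 * T + 2) * ‖∑ j, x j • cols U₀ j‖ := by positivity
    linarith
  have hRsurj : Function.Surjective R.mulVec :=
    (LinearMap.injective_iff_surjective (f := Matrix.mulVecLin R)).1 hRinj
  have hcol : ∀ j, ‖P (Z.toEuclideanLin (EuclideanSpace.single j 1))‖ ≤ 2 * ε / θ := by
    intro j
    obtain ⟨x, hx⟩ := hRsurj (Pi.single j 1)
    have hx0 : x ≠ 0 := by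
      rintro rfl
      rw [Matrix.mulVec_zero] at hx
      have := congrFun hx j
      simp at this
    have h3 := (hpow T _ (hstart x hx0).2).1
    rw [hHpow, happ, hx, norm_toEuclideanLin_of_orthonormal hZ] at h3
    simpa using h3
  have hnn : 0 ≤ 2 * ε / θ := by positivity
  refine le_of_sq_le_sq ?_ (by positivity)
  unfold subspaceDist
  rw [frob_sq_eq_sum_norm, mul_pow, Real.sq_sqrt (Nat.cast_nonneg r)]
  calc ∑ j, ‖((1 - U * Uᵀ) * Z).toEuclideanLin (EuclideanSpace.single j 1)‖ ^ 2
      ≤ ∑ _j : Fin r, (2 * ε / θ) ^ 2 := by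
        refine Finset.sum_le_sum fun j _ => ?_
        rw [Matrix.toLpLin_mul_same, LinearMap.comp_apply]
        exact pow_le_pow_left₀ (norm_nonneg _) (hcol j) 2
    _ = _ := by simp

end MatrixOperators

end

/-! ## Probability tools -/

section Tools

/-- Sequential lower bound for the outer measure of a set in a product of probability spaces. -/
theorem one_sub_le_prod_real {α β : Type*} [MeasurableSpace α] [MeasurableSpace β]
    {μ : Measure α} {ν : Measure β} [IsProbabilityMeasure μ] [IsProbabilityMeasure ν]
    {G : Set α} {E : Set (α × β)} {a b : ℝ} (ha : 0 ≤ a) (hb : 0 ≤ b)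
    (hG : 1 - a ≤ μ.real G) (hE : ∀ x ∈ G, 1 - b ≤ ν.real {y | (x, y) ∈ E}) :
    1 - a - b ≤ (μ.prod ν).real E := by
  by_cases hb1 : 1 ≤ b
  · exact le_trans (by linarith) measureReal_nonneg
  by_cases ha1 : 1 ≤ a
  · exact le_trans (by linarith) measureReal_nonneg
  push Not at hb1 ha1
  -- `E` and `G` need not be measurable. Fubini is applied to a measurable hull of `E`, and Markov's
  -- inequality on its slices gives `(1 - b)(1 - a)`.
  set M := toMeasurable (μ.prod ν) E with hM
  have hMm : MeasurableSet M := measurableSet_toMeasurable _ _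
  have hslice : ∀ x ∈ G, ENNReal.ofReal (1 - b) ≤ ν (Prod.mk x ⁻¹' M) := by
    intro x hx
    have h1 := hE x hx
    rw [ENNReal.ofReal_le_iff_le_toReal (measure_ne_top _ _)]
    refine h1.trans (ENNReal.toReal_mono (measure_ne_top _ _) (measure_mono fun y hy => ?_))
    exact subset_toMeasurable (μ.prod ν) E hy
  have hmark := mul_meas_ge_le_lintegral (μ := μ) (f := fun x => ν (Prod.mk x ⁻¹' M))
    (measurable_measure_prodMk_left hMm) (ENNReal.ofReal (1 - b))
  have h2 : ENNReal.ofReal (1 - a) ≤ μ {x | ENNReal.ofReal (1 - b) ≤ ν (Prod.mk x ⁻¹' M)} := by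
    rw [ENNReal.ofReal_le_iff_le_toReal (measure_ne_top _ _)]
    exact hG.trans (ENNReal.toReal_mono (measure_ne_top _ _) (measure_mono fun x hx => hslice x hx))
  rw [← Measure.prod_apply hMm, hM, measure_toMeasurable] at hmark
  have h3 : ENNReal.ofReal ((1 - b) * (1 - a)) ≤ (μ.prod ν) E := by
    rw [ENNReal.ofReal_mul (by linarith)]
    exact (mul_le_mul_right h2 _).trans hmark
  rw [ENNReal.ofReal_le_iff_le_toReal (measure_ne_top _ _)] at h3
  refine le_trans ?_ h3
  nlinarith [mul_nonneg ha hb]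

theorem one_sub_le_measureReal_of_compl {α : Type*} [MeasurableSpace α] {μ : Measure α}
    [IsProbabilityMeasure μ] {G : Set α} {a : ℝ} (ha : 0 ≤ a)
    (h : μ Gᶜ ≤ ENNReal.ofReal a) : 1 - a ≤ μ.real G := by
  have h1 : (1 : ℝ≥0∞) ≤ μ G + μ Gᶜ := by
    rw [← measure_univ (μ := μ), ← Set.union_compl_self G]; exact measure_union_le _ _
  have h2 := ENNReal.toReal_mono (by finiteness) (h1.trans (add_le_add_right h _))
  rw [ENNReal.toReal_add (by finiteness) (by finiteness), ENNReal.toReal_ofReal ha] at h2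
  rw [Measure.real]
  simp only [ENNReal.toReal_one] at h2
  linarith

/-- Markov's inequality for the number of bad indices, whose mean is at most `N p`. No independence
is needed, so a common start is allowed, and the bound does not grow with `N`. -/
theorem measure_card_bad_gt_le {Ω ι : Type*} [MeasurableSpace Ω] {ν : Measure Ω} (G : Finset ι)
    (B : ι → Set Ω) {p : ℝ} (hB : ∀ i ∈ G, ν (B i) ≤ ENNReal.ofReal p) {N : ℕ}
    (hN : 0 < N) (hG : G.card ≤ N) [∀ u, DecidablePred fun i => u ∈ B i] :
    ν {u | 0.05 * (N : ℝ) < (G.filter fun i => u ∈ B i).card} ≤ ENNReal.ofReal (20 * p) := by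
  set f : Ω → ℝ≥0∞ := fun u => ∑ i ∈ G, (toMeasurable ν (B i)).indicator 1 u with hf
  have hfm : Measurable f := Finset.measurable_sum _ fun i _ =>
    measurable_one.indicator (measurableSet_toMeasurable _ _)
  have hlint : ∫⁻ u, f u ∂ν ≤ ENNReal.ofReal (N * p) := by
    rw [lintegral_finsetSum _ fun i _ =>
      measurable_one.indicator (measurableSet_toMeasurable _ _)]
    calc _ = ∑ i ∈ G, ν (B i) := Finset.sum_congr rfl fun i _ => by
            rw [lintegral_indicator_one (measurableSet_toMeasurable _ _), measure_toMeasurable]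
      _ ≤ ∑ i ∈ G, ENNReal.ofReal p := Finset.sum_le_sum hB
      _ = G.card * ENNReal.ofReal p := by simp
      _ ≤ N * ENNReal.ofReal p := by gcongr
      _ = _ := by rw [ENNReal.ofReal_mul (Nat.cast_nonneg N), ENNReal.ofReal_natCast]
  have hmark := mul_meas_ge_le_lintegral (μ := ν) hfm (ENNReal.ofReal (0.05 * N))
  have hsub : {u | 0.05 * (N : ℝ) < (G.filter fun i => u ∈ B i).card} ⊆
      {u | ENNReal.ofReal (0.05 * N) ≤ f u} := by
    intro u hu
    have h1 : ((G.filter fun i => u ∈ B i).card : ℝ≥0∞) ≤ f u := by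
      rw [Finset.card_filter, Nat.cast_sum]
      refine Finset.sum_le_sum fun i _ => ?_
      split_ifs with h
      · rw [Set.indicator_of_mem (subset_toMeasurable ν (B i) h)]; simp
      · simp
    refine le_trans ?_ h1
    rw [← ENNReal.ofReal_natCast]
    exact ENNReal.ofReal_le_ofReal (le_of_lt hu)
  have h2 := (mul_le_mul_right (measure_mono (μ := ν) hsub) (ENNReal.ofReal (0.05 * N))).trans
    (hmark.trans hlint)
  have h3 : ENNReal.ofReal (N * p) = ENNReal.ofReal (0.05 * N) * ENNReal.ofReal (20 * p) := by
    rw [← ENNReal.ofReal_mul (by positivity)]; congr 1; ring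
  rw [h3] at h2
  have hN' : (0 : ℝ) < N := by exact_mod_cast hN
  exact (ENNReal.mul_le_mul_iff_right (by simp; positivity) ENNReal.ofReal_ne_top).1 h2

end Tools

/-! ## The random start -/

section Start

variable {E : Type*} [NormedAddCommGroup E] [InnerProductSpace ℝ E] [FiniteDimensional ℝ E]
  [MeasurableSpace E] [BorelSpace E]

theorem gaussianReal_abs_lt_le (s : ℝ) :
    gaussianReal 0 1 {y | |y| < s} ≤ ENNReal.ofReal s := by
  rw [gaussianReal_apply 0 one_ne_zero]
  have hset : {y : ℝ | |y| < s} = Set.Ioo (-s) s := by ext y; simp [abs_lt]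
  calc ∫⁻ y in {y : ℝ | |y| < s}, gaussianPDF 0 1 y
      ≤ ∫⁻ _ in {y : ℝ | |y| < s}, ENNReal.ofReal (1 / 2) := by
        refine lintegral_mono fun y => ENNReal.ofReal_le_ofReal ?_
        unfold gaussianPDFReal
        have h1 : Real.exp (-(y - 0) ^ 2 / (2 * ((1 : NNReal) : ℝ))) ≤ 1 :=
          Real.exp_le_one_iff.2 (by
            have : 0 ≤ (y - 0) ^ 2 := sq_nonneg _
            simp only [NNReal.coe_one, mul_one]; linarith)
        have h2 : (2 : ℝ) ≤ √(2 * Real.pi * ((1 : NNReal) : ℝ)) := by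
          apply Real.le_sqrt_of_sq_le
          simp only [NNReal.coe_one]
          linarith [Real.pi_gt_three]
        calc _ ≤ (2 : ℝ)⁻¹ * 1 := by gcongr
          _ = _ := by norm_num
    _ = ENNReal.ofReal s := by
        rw [setLIntegral_const, hset, Real.volume_Ioo, ← ENNReal.ofReal_mul (by norm_num)]
        congr 1; ring

theorem measure_abs_inner_lt_le {e : E} (he : ‖e‖ = 1) (s : ℝ) :
    stdGaussian E {a | |⟪e, a⟫| < s} ≤ ENNReal.ofReal s := by
  have hlaw := map_inner_stdGaussian e
  rw [he] at hlaw
  simp only [one_pow, Real.toNNReal_one] at hlaw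
  have h := gaussianReal_abs_lt_le s
  rwa [← hlaw, Measure.map_apply (by fun_prop)
    (measurableSet_lt (by fun_prop) measurable_const)] at h

theorem lintegral_norm_sq_stdGaussian :
    ∫⁻ a, ENNReal.ofReal (‖a‖ ^ 2) ∂(stdGaussian E) = Module.finrank ℝ E := by
  set b := stdOrthonormalBasis ℝ E
  have h1 : ∀ a : E, ENNReal.ofReal (‖a‖ ^ 2) = ∑ i, ENNReal.ofReal (⟪b i, a⟫ ^ 2) := fun a => by
    rw [← b.sum_sq_inner_right, ENNReal.ofReal_sum_of_nonneg fun _ _ => sq_nonneg _]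
  simp_rw [h1]
  rw [lintegral_finsetSum _ fun i _ => by fun_prop]
  have h2 : ∀ i, ∫⁻ a, ENNReal.ofReal (⟪b i, a⟫ ^ 2) ∂(stdGaussian E) = 1 := by
    intro i
    have hlaw := map_inner_stdGaussian (b i)
    rw [b.norm_eq_one] at hlaw
    simp only [one_pow, Real.toNNReal_one] at hlaw
    have h3 := lintegral_map (μ := stdGaussian E)
      (f := fun y : ℝ => ENNReal.ofReal (y ^ 2)) (by fun_prop)
      (g := fun a : E => ⟪b i, a⟫) (by fun_prop)
    have h4 : Integrable (fun y : ℝ => y ^ 2) (gaussianReal 0 1) :=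
      (memLp_id_gaussianReal 2).integrable_sq
    rw [← h3, hlaw, ← ofReal_integral_eq_lintegral_ofReal h4 (Filter.Eventually.of_forall fun _ => sq_nonneg _)]
    have := variance_id_gaussianReal (μ := 0) (v := 1)
    rw [variance_eq_integral (by fun_prop)] at this
    simp only [id_eq, integral_id_gaussianReal, sub_zero, NNReal.coe_one] at this
    rw [this, ENNReal.ofReal_one]
  simp [h2]

/-- A column of a Gaussian matrix is not close to the span of the other ones, even after
projection to an `r`-dimensional space. -/
theorem measure_near_span_le {r : ℕ} {Q : Fin (r + 1) → E} (hQ : Orthonormal ℝ Q) (j : Fin (r + 1))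
    {s : ℝ} (hs : 0 ≤ s) :
    Measure.pi (fun _ : Fin (r + 1) => stdGaussian E)
      {u | ∃ x : Fin (r + 1) → ℝ, x j = 1 ∧ ∑ i, ⟪Q i, ∑ k, x k • u k⟫ ^ 2 < s ^ 2} ≤
      ENNReal.ofReal s := by
  set B : Set (Fin (r + 1) → E) :=
    {u | ∃ x : Fin (r + 1) → ℝ, x j = 1 ∧ ∑ i, ⟪Q i, ∑ k, x k • u k⟫ ^ 2 < s ^ 2} with hB
  have hBm : MeasurableSet B := by
    have : B = ⋃ x : {x : Fin (r + 1) → ℝ // x j = 1},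
        {u | ∑ i, ⟪Q i, ∑ k, x.1 k • u k⟫ ^ 2 < s ^ 2} := by
      ext u; simp [hB]
    rw [this]
    exact (isOpen_iUnion fun x => isOpen_lt (by fun_prop) continuous_const).measurableSet
  set e := MeasurableEquiv.piFinSuccAbove (fun _ : Fin (r + 1) => E) j with he
  have hmp := measurePreserving_piFinSuccAbove (fun _ : Fin (r + 1) => stdGaussian E) j
  rw [← hmp.symm.measure_preimage_equiv B, Measure.prod_apply_symm (e.symm.measurable hBm)]
  calc _ ≤ ∫⁻ _, ENNReal.ofReal s ∂(Measure.pi fun _ : Fin r => stdGaussian E) := by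
        refine lintegral_mono fun v => ?_
        -- The other `r` columns impose `r` linear conditions on `r + 1` coefficients. Along the
        -- resulting unit vector of the span of `Q` the combination reduces to the column `a` alone,
        -- so `a` must have a small coordinate there.
        obtain ⟨w, hw1, hwv⟩ : ∃ w : Fin (r + 1) → ℝ, ∑ i, w i ^ 2 = 1 ∧
            ∀ k, ⟪∑ i, w i • Q i, v k⟫ = 0 := by
          let f : EuclideanSpace ℝ (Fin (r + 1)) →ₗ[ℝ] (Fin r → ℝ) :=
            { toFun := fun w k => ∑ i, w i * ⟪Q i, v k⟫
              map_add' := fun a b => by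
                ext k; simp [add_mul, Finset.sum_add_distrib]
              map_smul' := fun c a => by
                ext k; simp [Finset.mul_sum, mul_assoc] }
          have hker := LinearMap.ker_ne_bot_of_finrank_lt (f := f) (by simp)
          obtain ⟨w, hw, hw0⟩ := (Submodule.ne_bot_iff _).1 hker
          have hn : ‖w‖ ≠ 0 := norm_ne_zero_iff.2 hw0
          refine ⟨fun i => ‖w‖⁻¹ * w i, ?_, fun k => ?_⟩
          · simp_rw [mul_pow]
            rw [← Finset.mul_sum, ← EuclideanSpace.real_norm_sq_eq]
            field_simp
          · have h1 : ∑ i, w i * ⟪Q i, v k⟫ = 0 := congrFun (LinearMap.mem_ker.1 hw) k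
            rw [sum_inner]
            simp only [inner_smul_left, conj_trivial, mul_assoc]
            rw [← Finset.mul_sum, h1, mul_zero]
        have hnorm : ‖∑ i, w i • Q i‖ = 1 := by
          have h1 : ‖∑ i, w i • Q i‖ ^ 2 = 1 := by
            rw [← real_inner_self_eq_norm_sq, hQ.inner_sum]
            simp only [conj_trivial]
            rw [← hw1]
            exact Finset.sum_congr rfl fun i _ => by ring
          exact (sq_eq_sq₀ (norm_nonneg _) zero_le_one).1 (by rw [h1, one_pow])
        refine (measure_mono ?_).trans (measure_abs_inner_lt_le hnorm s)
        intro a ha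
        obtain ⟨x, hxj, hx⟩ := ha
        have hsum : ∑ k, x k • (e.symm (a, v)) k = a + ∑ k, x (j.succAbove k) • v k := by
          have hins : e.symm (a, v) = j.insertNth (α := fun _ => E) a v := rfl
          rw [Fin.sum_univ_succAbove _ j, hxj, one_smul, hins]
          simp
        have h1 : ⟪∑ i, w i • Q i, a⟫ = ∑ i, w i * ⟪Q i, ∑ k, x k • (e.symm (a, v)) k⟫ := by
          have h2 : ⟪∑ i, w i • Q i, ∑ k, x k • (e.symm (a, v)) k⟫ = ⟪∑ i, w i • Q i, a⟫ := by
            rw [hsum, inner_add_right, inner_sum]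
            simp [inner_smul_right, hwv]
          rw [← h2, sum_inner]
          simp [inner_smul_left]
        have h2 := Finset.sum_mul_sq_le_sq_mul_sq Finset.univ w
          (fun i => ⟪Q i, ∑ k, x k • (e.symm (a, v)) k⟫)
        rw [← h1, hw1, one_mul] at h2
        exact abs_lt_of_sq_lt_sq (h2.trans_lt hx) hs
    _ = ENNReal.ofReal s := by simp

/-- Two events of probability at most `η` are excluded: too large a total energy of the columns
(Markov), and some column closer than `η / r` to the span of the others after projection. Otherwise,
for the largest coefficient `x_j`, the projection has norm at least `|x_j| η / r`, while the vector
has norm at most `|x_j| N² / η` with `N` the dimension. The quotient is at most `N³ / η²`. -/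
theorem measure_not_startGood_le {r : ℕ} (hr : 0 < r) {Q : Fin r → E} (hQ : Orthonormal ℝ Q)
    {η c : ℝ} (hη : 0 < η) (hη1 : η ≤ 1) (hc : (Module.finrank ℝ E : ℝ) ^ 3 / η ^ 2 ≤ c) :
    Measure.pi (fun _ : Fin r => stdGaussian E) {u | ¬ StartGood Q u c} ≤
      ENNReal.ofReal (2 * η) := by
  obtain ⟨r, rfl⟩ : ∃ k, r = k + 1 := ⟨r - 1, by omega⟩
  set μ := Measure.pi (fun _ : Fin (r + 1) => stdGaussian E)
  set N : ℝ := (Module.finrank ℝ E : ℝ) with hN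
  set R : ℝ := ((r + 1 : ℕ) : ℝ) with hR
  have hR1 : 1 ≤ R := by rw [hR]; exact_mod_cast hr
  have hRN : R ≤ N := by
    rw [hR, hN]
    have := hQ.linearIndependent.fintype_card_le_finrank
    rw [Fintype.card_fin] at this
    exact_mod_cast this
  set s := η / R with hs
  have hspos : 0 < s := by positivity
  set B₁ : Set (Fin (r + 1) → E) := {u | N * R / η ≤ ∑ j, ‖u j‖ ^ 2} with hB₁
  set B₂ : Fin (r + 1) → Set (Fin (r + 1) → E) := fun j =>
    {u | ∃ x : Fin (r + 1) → ℝ, x j = 1 ∧ ∑ i, ⟪Q i, ∑ k, x k • u k⟫ ^ 2 < s ^ 2} with hB₂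
  have h1 : μ B₁ ≤ ENNReal.ofReal η := by
    have hlint : ∫⁻ u, ENNReal.ofReal (∑ j, ‖u j‖ ^ 2) ∂μ = ENNReal.ofReal (N * R) := by
      simp_rw [ENNReal.ofReal_sum_of_nonneg fun _ _ => sq_nonneg _]
      rw [lintegral_finsetSum _ fun i _ => by fun_prop]
      have h2 : ∀ j, ∫⁻ u, ENNReal.ofReal (‖u j‖ ^ 2) ∂μ = Module.finrank ℝ E := fun j => by
        have := (measurePreserving_eval (fun _ : Fin (r + 1) => stdGaussian E) j).lintegral_comp
          (f := fun a => ENNReal.ofReal (‖a‖ ^ 2)) (by fun_prop)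
        rw [← lintegral_norm_sq_stdGaussian (E := E), ← this]
      simp only [h2, Finset.sum_const, Finset.card_univ, Fintype.card_fin, nsmul_eq_mul]
      rw [hN, hR, ENNReal.ofReal_mul (Nat.cast_nonneg _), ENNReal.ofReal_natCast,
        ENNReal.ofReal_natCast, mul_comm]
    have hmark := mul_meas_ge_le_lintegral (μ := μ)
      (f := fun u : Fin (r + 1) → E => ENNReal.ofReal (∑ j, ‖u j‖ ^ 2)) (by fun_prop)
      (ENNReal.ofReal (N * R / η))
    rw [hlint] at hmark
    have hsub : B₁ ⊆ {u | ENNReal.ofReal (N * R / η) ≤ ENNReal.ofReal (∑ j, ‖u j‖ ^ 2)} :=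
      fun u hu => ENNReal.ofReal_le_ofReal hu
    have h3 := (mul_le_mul_right (measure_mono (μ := μ) hsub) _).trans hmark
    have hpos : 0 < N * R / η := by
      have : 0 < N := by linarith
      positivity
    have h4 : ENNReal.ofReal (N * R) = ENNReal.ofReal (N * R / η) * ENNReal.ofReal η := by
      rw [← ENNReal.ofReal_mul hpos.le]; congr 1; field_simp
    rw [h4] at h3
    exact (ENNReal.mul_le_mul_iff_right (by simpa using hpos) ENNReal.ofReal_ne_top).1 h3
  have h2 : μ (⋃ j, B₂ j) ≤ ENNReal.ofReal η := by
    refine (measure_iUnion_fintype_le _ _).trans ?_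
    calc ∑ j, μ (B₂ j) ≤ ∑ _j : Fin (r + 1), ENNReal.ofReal s :=
          Finset.sum_le_sum fun j _ => measure_near_span_le hQ j hspos.le
      _ = ENNReal.ofReal η := by
        simp only [Finset.sum_const, Finset.card_univ, Fintype.card_fin, nsmul_eq_mul]
        rw [← ENNReal.ofReal_natCast, ← ENNReal.ofReal_mul (Nat.cast_nonneg _), ← hR, hs]
        congr 1; field_simp
  have hsub : {u | ¬ StartGood Q u c} ⊆ B₁ ∪ ⋃ j, B₂ j := by
    intro u hu
    by_contra hcon
    apply hu
    simp only [Set.mem_union, Set.mem_iUnion, not_or, not_exists] at hcon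
    obtain ⟨hu1, hu2⟩ := hcon
    have hu1' : ∑ j, ‖u j‖ ^ 2 < N * R / η := not_le.1 hu1
    intro x hx
    obtain ⟨j, -, hj⟩ := Finset.exists_max_image Finset.univ (fun j => |x j|) Finset.univ_nonempty
    have hxj : 0 < |x j| := by
      rw [abs_pos]
      intro h0
      apply hx
      ext k
      have := hj k (Finset.mem_univ k)
      rw [h0, abs_zero] at this
      simpa using this
    set z := ∑ k, x k • u k with hz
    have hlow : |x j| * s ≤ Real.sqrt (∑ i, ⟪Q i, z⟫ ^ 2) := by
      apply Real.le_sqrt_of_sq_le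
      by_contra! hlt
      apply hu2 j
      refine ⟨fun k => (x j)⁻¹ * x k, inv_mul_cancel₀ (abs_pos.1 hxj), ?_⟩
      have h3 : ∑ k, ((x j)⁻¹ * x k) • u k = (x j)⁻¹ • z := by
        rw [hz, Finset.smul_sum]; simp [mul_smul]
      simp_rw [h3, inner_smul_right, mul_pow]
      rw [← Finset.mul_sum]
      have h4 : (|x j| * s) ^ 2 = x j ^ 2 * s ^ 2 := by rw [mul_pow, sq_abs]
      rw [h4] at hlt
      have h5 : 0 < x j ^ 2 := by rw [← sq_abs]; positivity
      rw [inv_pow, inv_mul_lt_iff₀ h5]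
      exact hlt
    have hup : ‖z‖ ≤ |x j| * (N ^ 2 / η) := by
      have h3 : ‖z‖ ≤ |x j| * ∑ k, ‖u k‖ := by
        rw [hz, Finset.mul_sum]
        refine (norm_sum_le _ _).trans (Finset.sum_le_sum fun k _ => ?_)
        rw [norm_smul, Real.norm_eq_abs]
        exact mul_le_mul_of_nonneg_right (hj k (Finset.mem_univ k)) (norm_nonneg _)
      refine h3.trans ?_
      gcongr
      have h4 := sq_sum_le_card_mul_sum_sq (s := Finset.univ) (f := fun k => ‖u k‖)
      rw [Finset.card_univ, Fintype.card_fin, ← hR] at h4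
      refine le_of_sq_le_sq (h4.trans ?_) (by positivity)
      calc R * ∑ k, ‖u k‖ ^ 2 ≤ N * (N * R / η) := by gcongr
        _ ≤ N * (N * N / η) := by gcongr
        _ ≤ (N ^ 2 / η) ^ 2 := by
          rw [div_pow, mul_div_assoc', div_le_div_iff₀ hη (by positivity)]
          have hN1 : 1 ≤ N := hR1.trans hRN
          have h5 : N * (N * N) ≤ (N ^ 2) ^ 2 := by nlinarith [pow_pos (lt_of_lt_of_le one_pos hN1) 3]
          have h6 : η ^ 2 ≤ η := by nlinarith
          calc N * (N * N) * η ^ 2 ≤ (N ^ 2) ^ 2 * η := by gcongr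
            _ = _ := rfl
    refine ⟨?_, ?_⟩
    · rw [norm_pos_iff]
      intro h0
      rw [h0] at hlow
      simp at hlow
      nlinarith
    · refine hup.trans (le_trans ?_ (mul_le_mul_of_nonneg_left hlow
        (le_trans (by positivity) hc)))
      have h3 : N ^ 2 / η ≤ c * s := by
        refine le_trans ?_ (mul_le_mul_of_nonneg_right hc hspos.le)
        rw [hs, div_mul_div_comm, div_le_div_iff₀ hη (by positivity)]
        have : N ^ 2 * R * η ^ 2 ≤ N ^ 2 * N * η ^ 2 := by gcongr
        nlinarith
      calc _ ≤ |x j| * (c * s) := by gcongr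
        _ = _ := by ring
  refine (measure_mono hsub).trans ((measure_union_le _ _).trans ((add_le_add h1 h2).trans ?_))
  rw [← ENNReal.ofReal_add hη.le hη.le, two_mul]

end Start

/-! ### The random start as independent Gaussian columns -/

section Columns

variable {n r : ℕ}

theorem measurePreserving_cols : MeasurePreserving (cols (n := n) (r := r))
    (Measure.pi fun _ => Measure.pi fun _ => gaussianReal 0 1)
    (Measure.pi fun _ : Fin r => stdGaussian (EuclideanSpace ℝ (Fin n))) := by
  have h1 : MeasurePreserving (fun (U : Fin n → Fin r → ℝ) (p : Fin r × Fin n) => U p.2 p.1)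
      (Measure.pi fun _ => Measure.pi fun _ => gaussianReal 0 1)
      (Measure.pi fun _ : Fin r × Fin n => gaussianReal 0 1) := by
    refine ⟨by fun_prop, (Measure.pi_eq fun s hs => ?_).symm⟩
    rw [Measure.map_apply (by fun_prop) (MeasurableSet.univ_pi hs)]
    have : (fun (U : Fin n → Fin r → ℝ) (p : Fin r × Fin n) => U p.2 p.1) ⁻¹' Set.univ.pi s =
        Set.univ.pi fun i => Set.univ.pi fun j => s (j, i) := by
      ext U
      simp only [Set.mem_preimage, Set.mem_pi, Set.mem_univ, true_implies, Prod.forall]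
      exact ⟨fun h i j => h j i, fun h j i => h i j⟩
    rw [this, Measure.pi_pi, Fintype.prod_prod_type, Finset.prod_comm]
    exact Finset.prod_congr rfl fun i _ => Measure.pi_pi _ _
  have h2 : MeasurePreserving (MeasurableEquiv.curry (Fin r) (Fin n) ℝ)
      (Measure.pi fun _ : Fin r × Fin n => gaussianReal 0 1)
      (Measure.pi fun _ : Fin r => Measure.pi fun _ : Fin n => gaussianReal 0 1) := by
    refine ⟨MeasurableEquiv.measurable _, ?_⟩
    have := Measure.infinitePi_map_curry (ι := Fin r) (κ := Fin n) (X := ℝ)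
      (μ := fun _ _ => gaussianReal 0 1)
    simpa only [Measure.infinitePi_eq_pi] using this
  have h3 : MeasurePreserving (fun (u : Fin r → Fin n → ℝ) j => WithLp.toLp 2 (u j))
      (Measure.pi fun _ : Fin r => Measure.pi fun _ : Fin n => gaussianReal 0 1)
      (Measure.pi fun _ : Fin r => stdGaussian (EuclideanSpace ℝ (Fin n))) :=
    measurePreserving_pi _ _ fun _ => ⟨by fun_prop, map_pi_eq_stdGaussian⟩
  exact (h3.comp h2).comp h1

end Columns

/-! ## Sampling in one mini-batch -/

section Batch

variable {n q r mt ρ : ℕ}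

/-- Indices of the measurements of one mini-batch: node, column, row. -/
abbrev BatchIndex (ρ q mt : ℕ) : Type := Fin ρ × Fin q × Fin mt

theorem sum_batchIndex (f : Fin q → ℝ) :
    ∑ p : BatchIndex ρ q mt, f p.2.1 = ρ * mt * ∑ k, f k := by
  simp only [Fintype.sum_prod_type, Finset.sum_const, Finset.card_univ, Fintype.card_fin,
    nsmul_eq_mul, ← Finset.mul_sum]
  ring

theorem sum_batchIndex_mul (f : Fin q → ℝ) (g : BatchIndex ρ q mt → ℝ) :
    ∑ p : BatchIndex ρ q mt, f p.2.1 * g p = ∑ k, f k * ∑ l, ∑ i, g (l, k, i) := by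
  simp only [Fintype.sum_prod_type, Finset.mul_sum]
  rw [Finset.sum_comm]

/-- The law of the measurement vectors of one mini-batch. -/
noncomputable def batchLaw (n q mt ρ : ℕ) :
    Measure (BatchIndex ρ q mt → EuclideanSpace ℝ (Fin n)) :=
  Measure.pi fun _ => stdGaussian (EuclideanSpace ℝ (Fin n))

instance : IsProbabilityMeasure (batchLaw n q mt ρ) := by unfold batchLaw; infer_instance

/-- A unit vector in the direction of `x`. -/
noncomputable def direction {E : Type*} [NormedAddCommGroup E] [NormedSpace ℝ E] (x : E) : E :=
  ‖x‖⁻¹ • x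

theorem norm_direction {E : Type*} [NormedAddCommGroup E] [NormedSpace ℝ E] {x : E} (hx : x ≠ 0) :
    ‖direction x‖ = 1 := by
  unfold direction
  rw [norm_smul, norm_inv, norm_norm, inv_mul_cancel₀ (norm_ne_zero_iff.2 hx)]

theorem inner_eq_norm_mul_direction {E : Type*} [NormedAddCommGroup E] [InnerProductSpace ℝ E]
    (x a : E) : ⟪x, a⟫ = ‖x‖ * ⟪direction x, a⟫ := by
  rcases eq_or_ne x 0 with rfl | hx
  · simp
  · unfold direction
    rw [inner_smul_left]
    have := norm_ne_zero_iff.2 hx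
    simp
    field_simp

variable (x : Fin q → EuclideanSpace ℝ (Fin n)) {M : ℝ}

/-- For a lower tail each square may be truncated at level `1` relative to the column norm, which
leaves bounded summands; the weights are `-‖x k‖²`. -/
theorem batch_energy_low (hM : 0 < M) (hx : ∀ k, ‖x k‖ ^ 2 ≤ M) :
    batchLaw n q mt ρ {ω | ∑ p, ⟪x p.2.1, ω p⟫ ^ 2 ≤
        truncMean 1 / 2 * (ρ * mt * ∑ k, ‖x k‖ ^ 2)} ≤
      ENNReal.ofReal (Real.exp (-(truncMean 1 ^ 2 / 2 * (ρ * mt * (∑ k, ‖x k‖ ^ 2) / M)))) := by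
  set F := ∑ k, ‖x k‖ ^ 2 with hF
  have hF0 : 0 ≤ F := Finset.sum_nonneg fun _ _ => sq_nonneg _
  have hβ := truncMean_pos one_pos
  set N : ℝ := (ρ : ℝ) * mt with hN
  have hN0 : 0 ≤ N := by positivity
  have hS : ∑ p : BatchIndex ρ q mt, (-‖x p.2.1‖ ^ 2) ^ 2 ≤ N * (M * F) := by
    rw [sum_batchIndex (fun k => (-‖x k‖ ^ 2) ^ 2)]
    gcongr
    rw [hF, Finset.mul_sum]
    refine Finset.sum_le_sum fun k _ => ?_
    rw [neg_sq, sq (‖x k‖ ^ 2)]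
    gcongr
    exact hx k
  have h := measure_truncSq_sum_ge_le (fun p : BatchIndex ρ q mt => direction (x p.2.1))
    (fun p => -‖x p.2.1‖ ^ 2) (fun p hp => norm_direction (by
      intro h0; simp [h0] at hp)) 1 (t := truncMean 1 / 2 * (N * F)) (by positivity) hS
  refine (measure_mono fun ω hω => ?_).trans (h.trans (ENNReal.ofReal_le_ofReal
    (Real.exp_le_exp.2 (neg_le_neg ?_))))
  · simp only [Set.mem_ofPred_eq] at hω ⊢
    have h1 : ∑ p : BatchIndex ρ q mt, ‖x p.2.1‖ ^ 2 * truncSq 1 ⟪direction (x p.2.1), ω p⟫ ≤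
        ∑ p, ⟪x p.2.1, ω p⟫ ^ 2 := by
      refine Finset.sum_le_sum fun p _ => ?_
      rw [inner_eq_norm_mul_direction (x p.2.1), mul_pow]
      gcongr
      exact truncSq_le_sq _ _
    have h2 : ∑ p : BatchIndex ρ q mt, ‖x p.2.1‖ ^ 2 * truncMean 1 = truncMean 1 * (N * F) := by
      rw [← Finset.sum_mul, sum_batchIndex (fun k => ‖x k‖ ^ 2)]
      ring
    simp only [neg_mul, mul_sub, Finset.sum_neg_distrib, Finset.sum_sub_distrib]
    rw [h2]
    linarith
  · rcases eq_or_ne (N * F) 0 with h0 | h0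
    · rw [h0]; simp
    · have hN1 : N ≠ 0 := left_ne_zero_of_mul h0
      have hF1 : F ≠ 0 := right_ne_zero_of_mul h0
      apply le_of_eq
      field_simp

theorem batch_energy_high (hM : 0 < M) (hx : ∀ k, ‖x k‖ ^ 2 ≤ M) :
    batchLaw n q mt ρ {ω | 4 * expSqMean * (ρ * mt * ∑ k, ‖x k‖ ^ 2) ≤
        ∑ p, ⟪x p.2.1, ω p⟫ ^ 2} ≤
      ENNReal.ofReal (Real.exp (-(ρ * mt * (∑ k, ‖x k‖ ^ 2) / M))) := by
  have h := measure_sq_sum_ge_le (fun p : BatchIndex ρ q mt => direction (x p.2.1))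
    (fun p => ‖x p.2.1‖ ^ 2) hM (fun p => sq_nonneg _) (fun p => hx _)
    (fun p hp => norm_direction (by intro h0; simp [h0] at hp))
  rw [sum_batchIndex (fun k => ‖x k‖ ^ 2)] at h
  refine (measure_mono fun ω hω => ?_).trans h
  simp only [Set.mem_ofPred_eq] at hω ⊢
  refine hω.trans (le_of_eq (Finset.sum_congr rfl fun p _ => ?_))
  rw [inner_eq_norm_mul_direction, mul_pow]

/-- The part of the truncated measurements orthogonal to the signals. -/
noncomputable def noisePart (s : ℝ) (ω : BatchIndex ρ q mt → EuclideanSpace ℝ (Fin n)) :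
    Matrix (Fin n) (Fin q) ℝ :=
  Matrix.of fun j k => ∑ l, ∑ i, if |⟪x k, ω (l, k, i)⟫| ≤ s then
    ⟪x k, ω (l, k, i)⟫ * (ω (l, k, i) j - ⟪x k, ω (l, k, i)⟫ / ‖x k‖ ^ 2 * x k j) else 0

/-- The orthogonal projection is symmetric, so it can be moved from the measurement vector to the
test vector `u`. This produces the sums of `measure_exists_trunc_sum_gt_le`. -/
theorem inner_noisePart (s : ℝ) (ω : BatchIndex ρ q mt → EuclideanSpace ℝ (Fin n))
    (u : EuclideanSpace ℝ (Fin n)) (v : EuclideanSpace ℝ (Fin q)) :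
    ⟪u, (noisePart x s ω).toEuclideanLin v⟫ = ∑ p, if |⟪x p.2.1, ω p⟫| ≤ s then
      v p.2.1 * (⟪x p.2.1, ω p⟫ * ⟪orthComp (x p.2.1) u, ω p⟫) else 0 := by
  have h1 : (noisePart x s ω).toEuclideanLin v = ∑ p : BatchIndex ρ q mt,
      if |⟪x p.2.1, ω p⟫| ≤ s then (v p.2.1 * ⟪x p.2.1, ω p⟫) •
        (ω p - (⟪x p.2.1, ω p⟫ / ‖x p.2.1‖ ^ 2) • x p.2.1) else 0 := by
    ext j
    simp only [Matrix.toLpLin_apply, Matrix.mulVec, dotProduct, noisePart, Matrix.of_apply,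
      WithLp.ofLp_sum, Finset.sum_apply, Fintype.sum_prod_type]
    rw [Finset.sum_comm]
    refine Finset.sum_congr rfl fun k _ => ?_
    simp only [Finset.sum_mul]
    refine Finset.sum_congr rfl fun l _ => Finset.sum_congr rfl fun i _ => ?_
    split_ifs
    · simp; ring
    · simp
  rw [h1, inner_sum]
  refine Finset.sum_congr rfl fun p _ => ?_
  split_ifs
  · unfold orthComp
    rw [inner_smul_right, inner_sub_right, inner_sub_left, inner_smul_right, inner_smul_left,
      real_inner_comm (x p.2.1) u]
    simp
    ring
  · simp

/-- Nets for both arguments of the bilinear form: two losses of a factor `2` explain `ε / 4`, hence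
the `32`. Each pair is already controlled uniformly in the level, so the union bound is over pairs
only. -/
theorem batch_noise {s₀ ε : ℝ} (hε : 0 ≤ ε) :
    batchLaw n q mt ρ {ω | ¬ ∀ s ≤ s₀, ∀ w, ‖(noisePart x s ω).toEuclideanLin w‖ ≤ ε * ‖w‖} ≤
      ENNReal.ofReal (5 ^ (n + q) * (2 * Real.exp (-(ε ^ 2 / (32 * (s₀ ^ 2 * (ρ * mt))))))) := by
  obtain ⟨Nu, hNu, hNu1, hNu2⟩ := exists_half_net (EuclideanSpace ℝ (Fin n))
  obtain ⟨Nv, hNv, hNv1, hNv2⟩ := exists_half_net (EuclideanSpace ℝ (Fin q))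
  rw [finrank_euclideanSpace_fin] at hNu hNv
  let B : EuclideanSpace ℝ (Fin n) → EuclideanSpace ℝ (Fin q) →
      Set (BatchIndex ρ q mt → EuclideanSpace ℝ (Fin n)) := fun u v =>
    {ω | ∃ s ≤ s₀, ε / 4 < ∑ p, if |⟪x p.2.1, ω p⟫| ≤ s then
      v p.2.1 * (⟪x p.2.1, ω p⟫ * ⟪orthComp (x p.2.1) u, ω p⟫) else 0}
  have hB : ∀ u ∈ Nu, ∀ v ∈ Nv, batchLaw n q mt ρ (B u v) ≤
      ENNReal.ofReal (2 * Real.exp (-(ε ^ 2 / (32 * (s₀ ^ 2 * (ρ * mt)))))) := by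
    intro u hu v hv
    have h := measure_exists_trunc_sum_gt_le (fun p : BatchIndex ρ q mt => x p.2.1)
      (fun p => v p.2.1) u (hNu1 u hu) (s₀ := s₀) (ε := ε / 4) (S := ρ * mt) (by positivity) (by
        rw [sum_batchIndex (fun k => v k ^ 2), ← EuclideanSpace.real_norm_sq_eq]
        exact mul_le_of_le_one_right (by positivity)
          (pow_le_one₀ (norm_nonneg _) (hNv1 v hv)))
    refine h.trans (le_of_eq ?_)
    rw [ENNReal.ofReal_mul zero_le_two, ENNReal.ofReal_ofNat]
    have h1 : (ε / 4) ^ 2 / (2 * (s₀ ^ 2 * (ρ * mt))) = ε ^ 2 / (32 * (s₀ ^ 2 * (ρ * mt))) := by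
      rw [div_pow, div_div]
      congr 1
      ring
    rw [h1]
  have hsub : {ω | ¬ ∀ s ≤ s₀, ∀ w, ‖(noisePart x s ω).toEuclideanLin w‖ ≤ ε * ‖w‖} ⊆
      ⋃ u ∈ Nu, ⋃ v ∈ Nv, B u v := by
    intro ω hω
    by_contra hcon
    apply hω
    intro s hs w
    have h1 : ∀ u ∈ Nu, ∀ v ∈ Nv, ⟪u, (noisePart x s ω).toEuclideanLin v⟫ ≤ ε / 4 := by
      intro u hu v hv
      by_contra! hlt
      apply hcon
      rw [inner_noisePart] at hlt
      simp only [Set.mem_iUnion]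
      exact ⟨u, hu, v, hv, s, hs, hlt⟩
    have h2 := opNorm_le_of_net hNv2 (noisePart x s ω).toEuclideanLin.toContinuousLinearMap
      fun v hv => norm_le_of_net hNu2 fun u hu => h1 u hu v hv
    refine ((noisePart x s ω).toEuclideanLin.toContinuousLinearMap.le_opNorm w).trans ?_
    gcongr
    linarith
  refine (measure_mono hsub).trans ((measure_biUnion_finset_le _ _).trans ?_)
  calc ∑ u ∈ Nu, batchLaw n q mt ρ (⋃ v ∈ Nv, B u v)
      ≤ ∑ u ∈ Nu, ∑ v ∈ Nv, ENNReal.ofReal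
          (2 * Real.exp (-(ε ^ 2 / (32 * (s₀ ^ 2 * (ρ * mt)))))) :=
        Finset.sum_le_sum fun u hu => (measure_biUnion_finset_le _ _).trans
          (Finset.sum_le_sum fun v hv => hB u hu v hv)
    _ = (Nu.card * Nv.card : ℕ) * ENNReal.ofReal
          (2 * Real.exp (-(ε ^ 2 / (32 * (s₀ ^ 2 * (ρ * mt)))))) := by
        simp [mul_assoc]
    _ ≤ _ := by
        rw [ENNReal.ofReal_mul (p := 5 ^ (n + q)) (by positivity)]
        refine mul_le_mul_left ?_ _
        rw [← ENNReal.ofReal_natCast]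
        apply ENNReal.ofReal_le_ofReal
        rw [pow_add]
        exact_mod_cast Nat.mul_le_mul hNu hNv

/-- A matrix Hoeffding bound by nets. The `v k` form a Parseval frame, so the mean of the form is
`truncMean b` times `ρ mt ‖w‖²`, and incoherence (`M`) bounds the sum of squared weights by `ρ mt
M`. -/
theorem batch_signal (e : Fin q → EuclideanSpace ℝ (Fin n)) (v : Fin q → EuclideanSpace ℝ (Fin r))
    (hv : ∀ u w, ∑ k, ⟪v k, u⟫ * ⟪v k, w⟫ = ⟪u, w⟫) (hM : 0 ≤ M)
    (hvM : ∀ k, ‖v k‖ ^ 2 ≤ M)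
    (he : ∀ k, v k ≠ 0 → ‖e k‖ = 1) {b : ℝ} (hb : 0 < b) :
    batchLaw n q mt ρ {ω | ¬ ∀ w, truncMean b / 2 * (ρ * mt) * ‖w‖ ^ 2 ≤
        ∑ k, ⟪v k, w⟫ ^ 2 * ∑ l, ∑ i, truncSq b ⟪e k, ω (l, k, i)⟫} ≤
      ENNReal.ofReal (25 ^ r * Real.exp (-(truncMean b ^ 2 / (32 * b ^ 4) * (ρ * mt / M)))) := by
  obtain ⟨Nu, hNu, hNu1, hNu2⟩ := exists_half_net (EuclideanSpace ℝ (Fin r))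
  rw [finrank_euclideanSpace_fin] at hNu
  have hβ := truncMean_pos hb
  set β := truncMean b with hβdef
  set N : ℝ := (ρ : ℝ) * mt with hN
  have hN0 : 0 ≤ N := by positivity
  let B : EuclideanSpace ℝ (Fin r) → EuclideanSpace ℝ (Fin r) →
      Set (BatchIndex ρ q mt → EuclideanSpace ℝ (Fin n)) := fun u w =>
    {ω | N * β / 8 ≤ ∑ p, -(⟪v p.2.1, u⟫ * ⟪v p.2.1, w⟫) * (truncSq b ⟪e p.2.1, ω p⟫ - β)}
  have hB : ∀ u ∈ Nu, ∀ w ∈ Nu, batchLaw n q mt ρ (B u w) ≤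
      ENNReal.ofReal (Real.exp (-(β ^ 2 / (32 * b ^ 4) * (N / M)))) := by
    intro u hu w hw
    have h := measure_truncSq_sum_ge_le (fun p : BatchIndex ρ q mt => e p.2.1)
      (fun p => -(⟪v p.2.1, u⟫ * ⟪v p.2.1, w⟫)) (fun p hp => he _ (by
        intro h0; simp [h0] at hp)) b (t := N * β / 8) (S := N * M) (by positivity) (by
        rw [sum_batchIndex (fun k => (-(⟪v k, u⟫ * ⟪v k, w⟫)) ^ 2)]
        gcongr
        calc ∑ k, (-(⟪v k, u⟫ * ⟪v k, w⟫)) ^ 2 ≤ ∑ k, M * (⟪v k, w⟫ * ⟪v k, w⟫) := by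
              refine Finset.sum_le_sum fun k _ => ?_
              have h1 : ⟪v k, u⟫ ^ 2 ≤ M := by
                rw [← sq_abs]
                refine (pow_le_pow_left₀ (abs_nonneg _) (abs_real_inner_le_norm _ _) 2).trans ?_
                rw [mul_pow]
                have h2 : ‖u‖ ^ 2 ≤ 1 := pow_le_one₀ (norm_nonneg _) (hNu1 u hu)
                nlinarith [hvM k, sq_nonneg ‖v k‖, sq_nonneg ‖u‖]
              rw [neg_sq, mul_pow, sq ⟪v k, w⟫]
              exact mul_le_mul_of_nonneg_right h1 (mul_self_nonneg _)
          _ = M * ‖w‖ ^ 2 := by rw [← Finset.mul_sum, hv, real_inner_self_eq_norm_sq]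
          _ ≤ M * 1 := by
              gcongr
              exact pow_le_one₀ (norm_nonneg _) (hNu1 w hw)
          _ = M := mul_one M)
    refine h.trans (le_of_eq ?_)
    congr 3
    rcases eq_or_ne N 0 with h0 | h0
    · rw [h0]; simp
    · field_simp
      norm_num
  have hsub : {ω | ¬ ∀ w, β / 2 * N * ‖w‖ ^ 2 ≤
        ∑ k, ⟪v k, w⟫ ^ 2 * ∑ l, ∑ i, truncSq b ⟪e k, ω (l, k, i)⟫} ⊆
      ⋃ u ∈ Nu, ⋃ w ∈ Nu, B u w := by
    intro ω hω
    by_contra hcon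
    apply hω
    intro w
    -- The negated deviation from the mean, so that an upper bound on `‖T‖` is a lower bound on the
    -- form. The nets give `2 · 2 · Nβ/8`, half of the mean.
    let T : EuclideanSpace ℝ (Fin r) →L[ℝ] EuclideanSpace ℝ (Fin r) :=
      ∑ p : BatchIndex ρ q mt, (-(truncSq b ⟪e p.2.1, ω p⟫ - β)) •
        (innerSL ℝ (v p.2.1)).smulRight (v p.2.1)
    have hT : ∀ u w, ⟪u, T w⟫ =
        ∑ p, -(⟪v p.2.1, u⟫ * ⟪v p.2.1, w⟫) * (truncSq b ⟪e p.2.1, ω p⟫ - β) := by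
      intro u w
      simp only [T, sum_apply, inner_sum, smul_apply,
        ContinuousLinearMap.smulRight_apply, innerSL_apply_apply, inner_smul_right]
      refine Finset.sum_congr rfl fun p _ => ?_
      rw [real_inner_comm (v p.2.1) u]
      ring
    have h1 : ∀ u ∈ Nu, ∀ w ∈ Nu, ⟪u, T w⟫ ≤ N * β / 8 := by
      intro u hu w hw
      by_contra! hlt
      apply hcon
      rw [hT] at hlt
      simp only [Set.mem_iUnion]
      exact ⟨u, hu, w, hw, hlt.le⟩
    have h2 := opNorm_le_of_net hNu2 T fun w hw => norm_le_of_net hNu2 fun u hu => h1 u hu w hw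
    have h3 : ⟪w, T w⟫ ≤ N * β / 2 * ‖w‖ ^ 2 := by
      refine (real_inner_le_norm _ _).trans ?_
      have h4 := T.le_opNorm w
      calc ‖w‖ * ‖T w‖ ≤ ‖w‖ * (‖T‖ * ‖w‖) := by gcongr
        _ ≤ ‖w‖ * ((2 * (2 * (N * β / 8))) * ‖w‖) := by gcongr
        _ = _ := by ring
    rw [hT] at h3
    have h5 : ∑ p : BatchIndex ρ q mt, -(⟪v p.2.1, w⟫ * ⟪v p.2.1, w⟫) *
        (truncSq b ⟪e p.2.1, ω p⟫ - β) = N * β * ‖w‖ ^ 2 -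
        ∑ k, ⟪v k, w⟫ ^ 2 * ∑ l, ∑ i, truncSq b ⟪e k, ω (l, k, i)⟫ := by
      rw [← sum_batchIndex_mul (fun k => ⟪v k, w⟫ ^ 2) (fun p => truncSq b ⟪e p.2.1, ω p⟫),
        ← real_inner_self_eq_norm_sq, ← hv]
      have h6 := sum_batchIndex (ρ := ρ) (mt := mt) (fun k => ⟪v k, w⟫ * ⟪v k, w⟫ * β)
      rw [show N * β * ∑ k, ⟪v k, w⟫ * ⟪v k, w⟫ = N * ((∑ k, ⟪v k, w⟫ * ⟪v k, w⟫) * β) by ring,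
        hN, Finset.sum_mul, ← h6, ← Finset.sum_sub_distrib]
      exact Finset.sum_congr rfl fun p _ => by ring
    rw [h5] at h3
    linarith
  refine (measure_mono hsub).trans ((measure_biUnion_finset_le _ _).trans ?_)
  calc ∑ u ∈ Nu, batchLaw n q mt ρ (⋃ w ∈ Nu, B u w)
      ≤ ∑ u ∈ Nu, ∑ w ∈ Nu, ENNReal.ofReal (Real.exp (-(β ^ 2 / (32 * b ^ 4) * (N / M)))) :=
        Finset.sum_le_sum fun u hu => (measure_biUnion_finset_le _ _).trans
          (Finset.sum_le_sum fun v hv => hB u hu v hv)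
    _ = (Nu.card * Nu.card : ℕ) * ENNReal.ofReal
          (Real.exp (-(β ^ 2 / (32 * b ^ 4) * (N / M)))) := by
        simp [mul_assoc]
    _ ≤ _ := by
        rw [ENNReal.ofReal_mul (by positivity)]
        gcongr
        rw [← ENNReal.ofReal_natCast]
        apply ENNReal.ofReal_le_ofReal
        have : Nu.card * Nu.card ≤ 25 ^ r := by
          rw [show 25 = 5 * 5 by norm_num, mul_pow]; exact Nat.mul_le_mul hNu hNu
        exact_mod_cast this

end Batch

section

open Matrix

/-! ## The median -/

/-- If a middle order statistic left the interval, so would everything on one side of it. That is at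
least half of all the indices, all outside the majority `G`. -/
theorem sort_mem_Icc {K : ℕ} {a : Fin K → ℝ} {lo hi : ℝ} (G : Finset (Fin K))
    (hG : ∀ i ∈ G, a i ∈ Set.Icc lo hi) (hcard : K < 2 * G.card) (m : Fin K)
    (hm1 : 2 * (m : ℕ) ≤ K) (hm2 : K ≤ 2 * (m + 1)) :
    a (Tuple.sort a m) ∈ Set.Icc lo hi := by
  classical
  have hmono := Tuple.monotone_sort a
  have key : ∀ B : Finset (Fin K), (∀ j ∈ B, Tuple.sort a j ∉ G) → G.card + B.card ≤ K := by
    intro B hB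
    have h1 : Disjoint G (B.map (Tuple.sort a).toEmbedding) := by
      rw [Finset.disjoint_left]
      intro i hi hi'
      obtain ⟨j, hj, rfl⟩ := Finset.mem_map.1 hi'
      exact hB j hj hi
    have h2 := Finset.card_le_univ (G ∪ B.map (Tuple.sort a).toEmbedding)
    rwa [Finset.card_union_of_disjoint h1, Finset.card_map, Fintype.card_fin] at h2
  constructor
  · by_contra! hlt
    have := key (Finset.Iic m) fun j hj hjG => by
      have h1 : a (Tuple.sort a j) ≤ a (Tuple.sort a m) := hmono (Finset.mem_Iic.1 hj)
      have h2 := (hG _ hjG).1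
      linarith
    rw [Fin.card_Iic] at this
    omega
  · by_contra! hlt
    have := key (Finset.Ici m) fun j hj hjG => by
      have h1 : a (Tuple.sort a m) ≤ a (Tuple.sort a j) := hmono (Finset.mem_Ici.1 hj)
      have h2 := (hG _ hjG).2
      linarith
    rw [Fin.card_Ici] at this
    omega

theorem median_mem_Icc {K : ℕ} {a : Fin K → ℝ} {lo hi : ℝ} (G : Finset (Fin K))
    (hG : ∀ i ∈ G, a i ∈ Set.Icc lo hi) (hcard : K < 2 * G.card) :
    median a ∈ Set.Icc lo hi := by
  have hK : 0 < K := by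
    rcases Nat.eq_zero_or_pos K with rfl | h
    · have := Finset.card_le_univ G
      simp only [Fintype.card_fin] at this
      omega
    · exact h
  unfold median
  rw [dif_pos hK]
  have h1 := sort_mem_Icc G hG hcard ⟨(K - 1) / 2, by omega⟩ (by simp only; omega)
    (by simp only; omega)
  have h2 := sort_mem_Icc G hG hcard ⟨K / 2, by omega⟩ (by simp only; omega) (by simp only; omega)
  constructor
  · linarith [h1.1, h2.1]
  · linarith [h1.2, h2.2]

/-! ## Singular values and columns -/

namespace ReducedSVD

variable {n q r : ℕ} {X : Matrix (Fin n) (Fin q) ℝ} (D : ReducedSVD X r)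

theorem sigmaMin_le (i : Fin r) : D.sigmaMin ≤ D.σ i := ciInf_le (Finite.bddBelow_range _) i

theorem le_sigmaMax (i : Fin r) : D.σ i ≤ D.sigmaMax := le_ciSup (Finite.bddAbove_range _) i

theorem sigmaMin_pos (hr : 0 < r) : 0 < D.sigmaMin := by
  have : Nonempty (Fin r) := ⟨⟨0, hr⟩⟩
  obtain ⟨i, hi⟩ := exists_eq_ciInf_of_finite (f := D.σ)
  unfold sigmaMin
  rw [← hi]
  exact D.σ_pos i

theorem sigmaMax_eq (hr : 0 < r) : D.sigmaMax = D.kappa * D.sigmaMin := by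
  unfold kappa
  rw [div_mul_cancel₀ _ (D.sigmaMin_pos hr).ne']

theorem one_le_kappa (hr : 0 < r) : 1 ≤ D.kappa := by
  unfold kappa
  rw [one_le_div (D.sigmaMin_pos hr)]
  exact (D.sigmaMin_le ⟨0, hr⟩).trans (D.le_sigmaMax _)

theorem eq_mul_B : X = D.U * D.B := by
  unfold B
  rw [← Matrix.mul_assoc]
  exact D.eq

theorem norm_col_sq (k : Fin q) : ‖cols X k‖ ^ 2 = ∑ i, D.B i k ^ 2 := by
  have h : cols X k = D.U.toEuclideanLin (WithLp.toLp 2 fun i => D.B i k) := by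
    ext j
    simp only [cols, Matrix.toLpLin_apply, Matrix.mulVec, dotProduct]
    conv_lhs => rw [D.eq_mul_B]
    rw [Matrix.mul_apply]
  rw [h, norm_toEuclideanLin_of_orthonormal D.U_orthonormal, EuclideanSpace.real_norm_sq_eq]

theorem B_apply (i : Fin r) (k : Fin q) : D.B i k = D.σ i * D.V k i := by
  unfold B
  rw [Matrix.diagonal_mul, Matrix.transpose_apply]

/-- The rows of the right singular factor. -/
def row (k : Fin q) : EuclideanSpace ℝ (Fin r) := WithLp.toLp 2 fun i => D.V k i

theorem sum_V_mul_V (i j : Fin r) : ∑ k, D.V k i * D.V k j = if i = j then 1 else 0 := by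
  have := congrFun (congrFun D.V_orthonormal i) j
  rw [Matrix.mul_apply] at this
  simpa [Matrix.one_apply] using this

theorem sum_inner_row (u w : EuclideanSpace ℝ (Fin r)) :
    ∑ k, ⟪D.row k, u⟫ * ⟪D.row k, w⟫ = ⟪u, w⟫ := by
  have h1 : ∀ (k : Fin q) (u : EuclideanSpace ℝ (Fin r)), ⟪D.row k, u⟫ = ∑ i, D.V k i * u i := by
    intro k u
    simp [row, PiLp.inner_apply, mul_comm]
  have h2 : ⟪u, w⟫ = ∑ i, ∑ j, (u i * w j) * if i = j then 1 else 0 := by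
    simp [PiLp.inner_apply, mul_comm]
  simp_rw [h1, Finset.sum_mul_sum]
  rw [h2, Finset.sum_comm]
  refine Finset.sum_congr rfl fun i _ => ?_
  rw [Finset.sum_comm]
  refine Finset.sum_congr rfl fun j _ => ?_
  rw [← D.sum_V_mul_V, Finset.mul_sum]
  exact Finset.sum_congr rfl fun k _ => by ring

theorem sum_norm_col_sq : ∑ k, ‖cols X k‖ ^ 2 = ∑ i, D.σ i ^ 2 := by
  simp_rw [D.norm_col_sq, D.B_apply]
  rw [Finset.sum_comm]
  refine Finset.sum_congr rfl fun i _ => ?_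
  simp_rw [mul_pow]
  rw [← Finset.mul_sum]
  have := D.sum_V_mul_V i i
  simp only [if_true] at this
  simp_rw [pow_two (D.V _ i)]
  rw [this, mul_one]

theorem le_sum_norm_col_sq (hr : 0 < r) : r * D.sigmaMin ^ 2 ≤ ∑ k, ‖cols X k‖ ^ 2 := by
  rw [D.sum_norm_col_sq]
  calc (r : ℝ) * D.sigmaMin ^ 2 = ∑ _i : Fin r, D.sigmaMin ^ 2 := by simp
    _ ≤ _ := Finset.sum_le_sum fun i _ =>
      pow_le_pow_left₀ (D.sigmaMin_pos hr).le (D.sigmaMin_le i) 2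

theorem sum_norm_col_sq_le : ∑ k, ‖cols X k‖ ^ 2 ≤ r * D.sigmaMax ^ 2 := by
  rw [D.sum_norm_col_sq]
  calc _ ≤ ∑ _i : Fin r, D.sigmaMax ^ 2 := Finset.sum_le_sum fun i _ =>
        pow_le_pow_left₀ (D.σ_pos i).le (D.le_sigmaMax i) 2
    _ = _ := by simp

theorem q_pos {X : Matrix (Fin n) (Fin q) ℝ} (D : ReducedSVD X r) (hr : 0 < r) : 0 < q := by
  rcases Nat.eq_zero_or_pos q with rfl | h
  · have h1 := D.le_sum_norm_col_sq hr
    have := D.sigmaMin_pos hr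
    have hr' : (0 : ℝ) < r := by exact_mod_cast hr
    simp at h1
    have : 0 < (r : ℝ) * D.sigmaMin ^ 2 := by positivity
    linarith
  · exact h

theorem norm_col_sq_le {μ : ℝ} (h : D.Incoherent μ) (k : Fin q) :
    ‖cols X k‖ ^ 2 ≤ μ ^ 2 * (r / q) * D.sigmaMax ^ 2 := by
  rw [D.norm_col_sq]
  have h1 := pow_le_pow_left₀ (Real.sqrt_nonneg _) (h k) 2
  rw [Real.sq_sqrt (Finset.sum_nonneg fun _ _ => sq_nonneg _), mul_pow, mul_pow,
    Real.sq_sqrt (by positivity)] at h1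
  exact h1

theorem norm_row_sq_le_col (hr : 0 < r) (k : Fin q) :
    D.sigmaMin ^ 2 * ‖D.row k‖ ^ 2 ≤ ‖cols X k‖ ^ 2 := by
  rw [D.norm_col_sq, EuclideanSpace.real_norm_sq_eq, Finset.mul_sum]
  refine Finset.sum_le_sum fun i _ => ?_
  rw [D.B_apply, mul_pow]
  have := D.sigmaMin_le i
  have := D.sigmaMin_pos hr
  simp only [row]
  gcongr

theorem r_le_n {X : Matrix (Fin n) (Fin q) ℝ} (D : ReducedSVD X r) : r ≤ n := by
  have h := Matrix.rank_le_height D.U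
  have h1 : (D.Uᵀ * D.U).rank ≤ D.U.rank := Matrix.rank_mul_le_right _ _
  rw [D.U_orthonormal, Matrix.rank_one, Fintype.card_fin] at h1
  exact h1.trans h

end ReducedSVD

/-! ## The batch matrices -/

section BatchMatrix

variable {n q r mt Lt ρ : ℕ}

/-- The measurement vectors of the mini-batch `ϑ`. -/
def batchView (ϑ : Fin Lt) (A : Sensing n q mt Lt ρ) :
    BatchIndex ρ q mt → EuclideanSpace ℝ (Fin n) :=
  fun p => WithLp.toLp 2 (A (ϑ, p.1) p.2.1 p.2.2)

/-- Only this marginal law is used later. The mini-batches are combined by a union bound. -/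
theorem map_batchView (ϑ : Fin Lt) :
    MeasurePreserving (batchView ϑ) (sensingLaw n q mt Lt ρ) (batchLaw n q mt ρ) := by
  classical
  have h1 : MeasurePreserving
      (fun (A : Sensing n q mt Lt ρ) (p : BatchIndex ρ q mt) => A (ϑ, p.1) p.2.1 p.2.2)
      (sensingLaw n q mt Lt ρ)
      (Measure.pi fun _ : BatchIndex ρ q mt => Measure.pi fun _ : Fin n => gaussianReal 0 1) := by
    refine ⟨by fun_prop, (Measure.pi_eq fun s hs => ?_).symm⟩
    rw [Measure.map_apply (by fun_prop) (MeasurableSet.univ_pi hs)]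
    have : (fun (A : Sensing n q mt Lt ρ) (p : BatchIndex ρ q mt) => A (ϑ, p.1) p.2.1 p.2.2) ⁻¹'
        Set.univ.pi s = Set.univ.pi fun node : Node Lt ρ => Set.univ.pi fun k =>
          Set.univ.pi fun i => if node.1 = ϑ then s (node.2, k, i) else Set.univ := by
      ext A
      simp only [Set.mem_preimage, Set.mem_pi, Set.mem_univ, true_implies, Prod.forall]
      constructor
      · intro h ϑ' l k i
        split_ifs with hϑ
        · subst hϑ; exact h l k i
        · trivial
      · intro h l k i
        simpa using h ϑ l k i
    rw [this]
    unfold sensingLaw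
    simp only [Measure.pi_pi, Fintype.prod_prod_type]
    rw [Finset.prod_eq_single ϑ]
    · simp
    · intro ϑ' _ hϑ
      simp [hϑ]
    · simp
  have h2 : MeasurePreserving
      (fun (u : BatchIndex ρ q mt → Fin n → ℝ) p => WithLp.toLp 2 (u p))
      (Measure.pi fun _ : BatchIndex ρ q mt => Measure.pi fun _ : Fin n => gaussianReal 0 1)
      (batchLaw n q mt ρ) :=
    measurePreserving_pi _ _ fun _ => ⟨by fun_prop, map_pi_eq_stdGaussian⟩
  exact h2.comp h1

variable (p : Protocol n q r mt Lt ρ)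

theorem y_eq_inner (A : Sensing n q mt Lt ρ) (ϑ : Fin Lt) (l : Fin ρ) (k : Fin q) (i : Fin mt) :
    p.y A (ϑ, l) k i = ⟪cols p.X k, batchView ϑ A (l, k, i)⟫ := by
  simp [Protocol.y, cols, batchView, PiLp.inner_apply]

/-- The factors by which truncation rescales the columns of the signal. -/
noncomputable def columnScale (x : Fin q → EuclideanSpace ℝ (Fin n)) (s : ℝ)
    (ω : BatchIndex ρ q mt → EuclideanSpace ℝ (Fin n)) (k : Fin q) : ℝ :=
  ∑ l, ∑ i, if |⟪x k, ω (l, k, i)⟫| ≤ s then ⟪x k, ω (l, k, i)⟫ ^ 2 / ‖x k‖ ^ 2 else 0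

/-- With `y = ⟪x, a⟫`, the product `y a` equals `(y² / ‖x‖²) x` plus `y` times the orthogonal
component of `a`. The first terms only rescale the columns of `X = U B`. For `x = 0` the division by
zero is harmless, as it multiplies `x`. -/
theorem sum_X0_eq (D : ReducedSVD p.X r) (d : Data n q mt Lt ρ) (ϑ : Fin Lt) :
    ∑ l, p.X0 d (ϑ, l) = D.U * (D.B * Matrix.diagonal
      (columnScale (cols p.X) (Real.sqrt (p.alpha d)) (batchView ϑ d.2))) +
      noisePart (cols p.X) (Real.sqrt (p.alpha d)) (batchView ϑ d.2) := by
  rw [← Matrix.mul_assoc, ← D.eq_mul_B]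
  ext j k
  rw [Matrix.add_apply, Matrix.mul_diagonal, Matrix.sum_apply]
  simp only [Protocol.X0, Matrix.of_apply, columnScale, noisePart, Finset.mul_sum,
    ← Finset.sum_add_distrib, y_eq_inner]
  refine Finset.sum_congr rfl fun l _ => Finset.sum_congr rfl fun i _ => ?_
  have h1 : d.2 (ϑ, l) k i j = batchView ϑ d.2 (l, k, i) j := rfl
  have h2 : p.X j k = cols p.X k j := rfl
  rw [h1, h2]
  split_ifs
  · ring
  · simp

/-- The factors at the data dependent level `s` dominate those at the fixed levels `b ‖x_k‖ ≤ s`,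
which is what makes `batch_signal` applicable to an adversarial threshold. -/
theorem norm_scaled_signal_ge (D : ReducedSVD p.X r) (hr : 0 < r) {s b c : ℝ} (hc : 0 ≤ c)
    (ω : BatchIndex ρ q mt → EuclideanSpace ℝ (Fin n)) (hs : ∀ k, b * ‖cols p.X k‖ ≤ s)
    (hω : ∀ w, c * ‖w‖ ^ 2 ≤ ∑ k, ⟪D.row k, w⟫ ^ 2 *
      ∑ l, ∑ i, truncSq b ⟪direction (cols p.X k), ω (l, k, i)⟫)
    (u : EuclideanSpace ℝ (Fin r)) :
    c * D.sigmaMin * ‖u‖ ≤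
      ‖(D.B * Matrix.diagonal (columnScale (cols p.X) s ω))ᵀ.toEuclideanLin u‖ := by
  set a := columnScale (cols p.X) s ω with ha
  set t : Fin q → ℝ := fun k => ∑ l, ∑ i, truncSq b ⟪direction (cols p.X k), ω (l, k, i)⟫ with ht
  have ht0 : ∀ k, 0 ≤ t k := fun k =>
    Finset.sum_nonneg fun _ _ => Finset.sum_nonneg fun _ _ => truncSq_nonneg _ _
  have hta : ∀ k, D.row k ≠ 0 → t k ≤ a k := by
    intro k hk
    have hx : 0 < ‖cols p.X k‖ := by
      have h1 := D.norm_row_sq_le_col hr k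
      have h2 : 0 < D.sigmaMin ^ 2 * ‖D.row k‖ ^ 2 := by
        have := D.sigmaMin_pos hr
        have := norm_pos_iff.2 hk
        positivity
      have h3 := h2.trans_le h1
      exact (sq_pos_iff.1 h3).symm.lt_of_le (norm_nonneg _)
    refine Finset.sum_le_sum fun l _ => Finset.sum_le_sum fun i _ => ?_
    rw [inner_eq_norm_mul_direction (cols p.X k), mul_pow, mul_div_cancel_left₀ _ (by positivity),
      abs_mul, abs_norm]
    unfold truncSq
    split_ifs with h1 h2 h2
    · exact le_rfl
    · exfalso
      apply h2
      calc ‖cols p.X k‖ * |⟪direction (cols p.X k), ω (l, k, i)⟫| ≤ ‖cols p.X k‖ * b := by gcongr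
        _ = b * ‖cols p.X k‖ := mul_comm _ _
        _ ≤ s := hs k
    · positivity
    · exact le_rfl
  let w : EuclideanSpace ℝ (Fin r) := WithLp.toLp 2 fun i => D.σ i * u i
  have hw : D.sigmaMin * ‖u‖ ≤ ‖w‖ := by
    have hσ := D.sigmaMin_pos hr
    refine le_of_sq_le_sq ?_ (norm_nonneg _)
    rw [mul_pow, EuclideanSpace.real_norm_sq_eq, EuclideanSpace.real_norm_sq_eq, Finset.mul_sum]
    refine Finset.sum_le_sum fun i _ => ?_
    simp only [w, mul_pow]
    have := D.sigmaMin_le i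
    gcongr
  have hnorm : ‖(D.B * Matrix.diagonal a)ᵀ.toEuclideanLin u‖ ^ 2 =
      ∑ k, (a k * ⟪D.row k, w⟫) ^ 2 := by
    rw [EuclideanSpace.real_norm_sq_eq]
    refine Finset.sum_congr rfl fun k _ => ?_
    congr 1
    simp only [Matrix.toLpLin_apply, Matrix.mulVec, dotProduct, Matrix.transpose_apply,
      Matrix.mul_diagonal, D.B_apply, ReducedSVD.row, PiLp.inner_apply, w, Finset.mul_sum]
    refine Finset.sum_congr rfl fun i _ => ?_
    simp
    ring
  have hlow : ∑ k, (t k * ⟪D.row k, w⟫) ^ 2 ≤ ∑ k, (a k * ⟪D.row k, w⟫) ^ 2 := by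
    refine Finset.sum_le_sum fun k _ => ?_
    by_cases hk : D.row k = 0
    · simp [hk]
    · have := hta k hk
      have := ht0 k
      rw [mul_pow, mul_pow]
      gcongr
  -- Cauchy–Schwarz against the Parseval coefficients turns the quadratic form bound `c ‖w‖²` into
  -- the norm bound `c ‖w‖`.
  have hcs := Finset.sum_mul_sq_le_sq_mul_sq Finset.univ (fun k => t k * ⟪D.row k, w⟫)
    (fun k => ⟪D.row k, w⟫)
  have hone : ∑ k, ⟪D.row k, w⟫ ^ 2 = ‖w‖ ^ 2 := by
    rw [← real_inner_self_eq_norm_sq, ← D.sum_inner_row]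
    exact Finset.sum_congr rfl fun k _ => by ring
  rw [hone] at hcs
  have h1 : c * ‖w‖ ^ 2 ≤ ∑ k, t k * ⟪D.row k, w⟫ * ⟪D.row k, w⟫ := by
    refine (hω w).trans (le_of_eq (Finset.sum_congr rfl fun k _ => by simp only [ht]; ring))
  have h2 : c * ‖w‖ ≤ ‖(D.B * Matrix.diagonal a)ᵀ.toEuclideanLin u‖ := by
    rcases eq_or_ne w 0 with h0 | h0
    · rw [h0]; simp
    · have hwpos := norm_pos_iff.2 h0
      refine le_of_sq_le_sq ?_ (norm_nonneg _)
      rw [hnorm]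
      refine le_trans ?_ hlow
      have h3 := (pow_le_pow_left₀ (by positivity) h1 2).trans hcs
      have h4 : (c * ‖w‖ ^ 2) ^ 2 = (c * ‖w‖) ^ 2 * ‖w‖ ^ 2 := by ring
      rw [h4] at h3
      exact le_of_mul_le_mul_right h3 (by positivity)
  refine le_trans ?_ h2
  rw [mul_assoc]
  gcongr

end BatchMatrix

end

section

open Matrix

/-! ## All attack-free mini-batches have good data -/

section Sampling

variable {n q r mt Lt ρ : ℕ}

/-- The mini-batches without Byzantine nodes. -/
def Protocol.cleanBatches (p : Protocol n q r mt Lt ρ) : Finset (Fin Lt) :=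
  (p.byz.image Prod.fst)ᶜ

theorem Protocol.notMem_byz_of_clean {p : Protocol n q r mt Lt ρ} {ϑ : Fin Lt}
    (h : ϑ ∈ p.cleanBatches) (l : Fin ρ) : (ϑ, l) ∉ p.byz := fun hl =>
  (Finset.mem_compl.1 h) (Finset.mem_image.2 ⟨_, hl, rfl⟩)

theorem Protocol.le_card_cleanBatches (p : Protocol n q r mt Lt ρ) :
    (Lt : ℝ) - p.byz.card ≤ p.cleanBatches.card := by
  have h1 := Finset.card_compl_add_card (p.byz.image Prod.fst)
  rw [Fintype.card_fin] at h1
  have h2 := Finset.card_image_le (s := p.byz) (f := Prod.fst)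
  have h3 : (p.cleanBatches.card : ℝ) + (p.byz.image Prod.fst).card = Lt := by exact_mod_cast h1
  have h4 : ((p.byz.image Prod.fst).card : ℝ) ≤ p.byz.card := by exact_mod_cast h2
  linarith

/-- Every clean mini-batch matrix is a well conditioned matrix with the column space of the signal
plus small noise. -/
def DataGood (p : Protocol n q r mt Lt ρ) (D : ReducedSVD p.X r) (δ : ℝ)
    (d : Data n q mt Lt ρ) : Prop :=
  ∀ ϑ ∈ p.cleanBatches, ∃ (G : Matrix (Fin r) (Fin q) ℝ) (W : Matrix (Fin n) (Fin q) ℝ) (θ : ℝ),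
    ∑ l, p.X0 d (ϑ, l) = D.U * G + W ∧ 0 < θ ∧
    (∀ w, ‖W.toEuclideanLin w‖ ≤ δ * θ / (200 * Real.sqrt r) * ‖w‖) ∧
    ∀ u, 2 * θ * ‖u‖ ≤ ‖Gᵀ.toEuclideanLin u‖

/-- The truncation level, relative to the signal, that is guaranteed by the threshold. -/
noncomputable def truncLevel : ℝ := Real.sqrt (9 / 2 * truncMean 1)

theorem truncLevel_pos : 0 < truncLevel :=
  Real.sqrt_pos.2 (by have := truncMean_pos one_pos; positivity)

theorem truncLevel_sq : truncLevel ^ 2 = 9 / 2 * truncMean 1 :=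
  Real.sq_sqrt (by have := truncMean_pos one_pos; positivity)

/-- Deterministic part: good events of the clean mini-batches give good data. -/
theorem dataGood_of_events (p : Protocol n q r mt Lt ρ) (D : ReducedSVD p.X r) (hr : 0 < r)
    (hN : (0 : ℝ) < ρ * mt) {Mx ε : ℝ}
    (hMx : Mx = p.κ ^ 2 * p.μ ^ 2 * (∑ k, ‖cols p.X k‖ ^ 2) / q)
    (hx : ∀ k, ‖cols p.X k‖ ^ 2 ≤ Mx) {δ : ℝ}
    (hbyz : (p.byz.card : ℝ) < 0.4 * Lt)
    (hε : ε = δ * (truncMean truncLevel * (ρ * mt) * D.sigmaMin / 4) / (200 * Real.sqrt r))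
    (d : Data n q mt Lt ρ)
    (hlow : ∀ ϑ ∈ p.cleanBatches, truncMean 1 / 2 * (ρ * mt * ∑ k, ‖cols p.X k‖ ^ 2) ≤
      ∑ i, ⟪cols p.X i.2.1, batchView ϑ d.1 i⟫ ^ 2)
    (hhigh : ∀ ϑ ∈ p.cleanBatches, ∑ i, ⟪cols p.X i.2.1, batchView ϑ d.1 i⟫ ^ 2 ≤
      4 * expSqMean * (ρ * mt * ∑ k, ‖cols p.X k‖ ^ 2))
    (hnoise : ∀ ϑ ∈ p.cleanBatches, ∀ s ≤ Real.sqrt (36 * expSqMean * Mx), ∀ w,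
      ‖(noisePart (cols p.X) s (batchView ϑ d.2)).toEuclideanLin w‖ ≤ ε * ‖w‖)
    (hsignal : ∀ ϑ ∈ p.cleanBatches, ∀ w, truncMean truncLevel / 2 * (ρ * mt) * ‖w‖ ^ 2 ≤
      ∑ k, ⟪D.row k, w⟫ ^ 2 * ∑ l, ∑ i,
        truncSq truncLevel ⟪direction (cols p.X k), batchView ϑ d.2 (l, k, i)⟫) :
    DataGood p D δ d := by
  set F := ∑ k, ‖cols p.X k‖ ^ 2 with hF
  have hq : (0 : ℝ) < q := by exact_mod_cast D.q_pos hr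
  have hρ : (0 : ℝ) < ρ := by
    rcases (Nat.cast_nonneg ρ : (0 : ℝ) ≤ ρ).eq_or_lt with h | h
    · rw [← h, zero_mul] at hN; exact absurd hN (lt_irrefl _)
    · exact h
  have hmt : (0 : ℝ) < mt := pos_of_mul_pos_right hN hρ.le
  -- More than 60% of the mini-batches are clean, so the median lies in the range of their means.
  -- The factor `9` times the energy bounds `truncMean 1 / 2` and `4 * expSqMean` gives the
  -- endpoints.
  have hα : p.alpha d ∈ Set.Icc (9 / 2 * truncMean 1 * Mx) (36 * expSqMean * Mx) := by
    unfold Protocol.alpha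
    refine median_mem_Icc p.cleanBatches (fun ϑ hϑ => ?_) ?_
    · have heq : (∑ l, p.alphaNode d (ϑ, l)) / ρ = 9 * p.κ ^ 2 * p.μ ^ 2 / (ρ * mt * q) *
          ∑ i, ⟪cols p.X i.2.1, batchView ϑ d.1 i⟫ ^ 2 := by
        have h1 : ∀ l, p.alphaNode d (ϑ, l) = 9 * p.κ ^ 2 * p.μ ^ 2 / ((mt : ℝ) * q) *
            ∑ k, ∑ i, ⟪cols p.X k, batchView ϑ d.1 (l, k, i)⟫ ^ 2 := fun l => by
          unfold Protocol.alphaNode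
          rw [if_neg (Protocol.notMem_byz_of_clean hϑ l)]
          simp only [y_eq_inner]
        simp_rw [h1]
        rw [← Finset.mul_sum, Fintype.sum_prod_type]
        simp only [Fintype.sum_prod_type]
        field_simp
      have hpos : 0 ≤ 9 * p.κ ^ 2 * p.μ ^ 2 / (ρ * mt * q) := by positivity
      rw [heq]
      constructor
      · calc 9 / 2 * truncMean 1 * Mx = 9 * p.κ ^ 2 * p.μ ^ 2 / (ρ * mt * q) *
              (truncMean 1 / 2 * (ρ * mt * F)) := by rw [hMx]; field_simp
          _ ≤ _ := mul_le_mul_of_nonneg_left (hlow ϑ hϑ) hpos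
      · calc _ ≤ 9 * p.κ ^ 2 * p.μ ^ 2 / (ρ * mt * q) * (4 * expSqMean * (ρ * mt * F)) :=
              mul_le_mul_of_nonneg_left (hhigh ϑ hϑ) hpos
          _ = _ := by rw [hMx]; field_simp; ring
    · have h1 := p.le_card_cleanBatches
      have h2 : (0 : ℝ) ≤ p.byz.card := Nat.cast_nonneg _
      have h3 : (Lt : ℝ) < 2 * p.cleanBatches.card := by
        norm_num at hbyz
        linarith
      exact_mod_cast h3
  have hσ := D.sigmaMin_pos hr
  have hβ := truncMean_pos truncLevel_pos
  intro ϑ hϑ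
  refine ⟨_, _, truncMean truncLevel * (ρ * mt) * D.sigmaMin / 4, sum_X0_eq p D d ϑ, by positivity,
    ?_, ?_⟩
  · rw [← hε]
    exact hnoise ϑ hϑ _ (Real.sqrt_le_sqrt hα.2)
  · intro u
    have hs : ∀ k, truncLevel * ‖cols p.X k‖ ≤ Real.sqrt (p.alpha d) := by
      intro k
      apply Real.le_sqrt_of_sq_le
      rw [mul_pow, truncLevel_sq]
      refine le_trans ?_ hα.1
      have := truncMean_pos one_pos
      gcongr
      exact hx k
    have h := norm_scaled_signal_ge p D hr (by positivity) (batchView ϑ d.2) hs (hsignal ϑ hϑ) u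
    refine le_trans (le_of_eq ?_) h
    ring

theorem exp_le_exp_neg_of_le {c a E : ℝ} (h : c * E ≤ a) : Real.exp (-a) ≤ Real.exp (-(c * E)) :=
  Real.exp_le_exp.2 (neg_le_neg h)

/-- All net sizes together are at most `125 ^ (n + q) ≤ exp (6 (n + q))`, which half of the exponent
absorbs. -/
theorem net_sizes_mul_exp_le {c E : ℝ} {n q r : ℕ} (hc : 0 < c) (hrn : r ≤ n + q)
    (hnq1 : 1 ≤ n + q) (hE : 12 / c * (n + q) ≤ E) :
    (1 + 1 + 5 ^ (n + q) * 2 + 25 ^ r) * Real.exp (-(c * E)) ≤ Real.exp (-(c / 2 * E)) := by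
  have h25 : (1 + 1 + 5 ^ (n + q) * 2 + 25 ^ r : ℝ) ≤ 125 ^ (n + q) := by
    have h1 : (1 : ℝ) ≤ 25 ^ (n + q) := one_le_pow₀ (by norm_num)
    have h2 : (5 : ℝ) ^ (n + q) ≤ 25 ^ (n + q) := by gcongr; norm_num
    have h3 : (25 : ℝ) ^ r ≤ 25 ^ (n + q) := pow_le_pow_right₀ (by norm_num) hrn
    have h4 : (5 : ℝ) ≤ 5 ^ (n + q) := by
      calc (5 : ℝ) = 5 ^ 1 := by norm_num
        _ ≤ _ := pow_le_pow_right₀ (by norm_num) hnq1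
    calc (1 + 1 + 5 ^ (n + q) * 2 + 25 ^ r : ℝ) ≤ 5 * 25 ^ (n + q) := by linarith
      _ ≤ 5 ^ (n + q) * 25 ^ (n + q) := by gcongr
      _ = 125 ^ (n + q) := by rw [← mul_pow]; norm_num
  have hexp : (125 : ℝ) ^ (n + q) ≤ Real.exp (c / 2 * E) := by
    have h1 : (125 : ℝ) ≤ Real.exp 6 := by
      have h2 : (2.7 : ℝ) ≤ Real.exp 1 := by linarith [Real.exp_one_gt_d9]
      calc (125 : ℝ) ≤ 2.7 ^ 6 := by norm_num
        _ ≤ Real.exp 1 ^ 6 := by gcongr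
        _ = Real.exp 6 := by rw [← Real.exp_nat_mul]; norm_num
    calc (125 : ℝ) ^ (n + q) ≤ Real.exp 6 ^ (n + q) := by gcongr
      _ = Real.exp (6 * (n + q)) := by
        rw [← Real.exp_nat_mul]; congr 1; push_cast; ring
      _ ≤ _ := by
        apply Real.exp_le_exp.2
        have h3 : c / 2 * (12 / c * (n + q)) ≤ c / 2 * E := by gcongr
        have h4 : c / 2 * (12 / c * (n + q)) = 6 * ((n : ℝ) + q) := by field_simp; ring
        linarith
  calc (1 + 1 + 5 ^ (n + q) * 2 + 25 ^ r) * Real.exp (-(c * E))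
      ≤ Real.exp (c / 2 * E) * Real.exp (-(c * E)) := by gcongr; exact h25.trans hexp
    _ = Real.exp (-(c / 2 * E)) := by rw [← Real.exp_add]; congr 1; ring

theorem measure_iUnion_batchView_le (B : Set (BatchIndex ρ q mt → EuclideanSpace ℝ (Fin n))) :
    sensingLaw n q mt Lt ρ (⋃ ϑ : Fin Lt, batchView ϑ ⁻¹' B) ≤ Lt * batchLaw n q mt ρ B := by
  refine (measure_iUnion_fintype_le _ _).trans ?_
  calc ∑ ϑ : Fin Lt, sensingLaw n q mt Lt ρ (batchView ϑ ⁻¹' B)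
      ≤ ∑ _ϑ : Fin Lt, batchLaw n q mt ρ B := by
        refine Finset.sum_le_sum fun ϑ _ => ?_
        have h1 := map_batchView (n := n) (q := q) (mt := mt) (ρ := ρ) ϑ
        rw [← h1.map_eq]
        exact Measure.le_map_apply h1.measurable.aemeasurable B
    _ = _ := by simp

theorem isProbabilityMeasure_sensingLaw : IsProbabilityMeasure (sensingLaw n q mt Lt ρ) := by
  unfold sensingLaw; infer_instance

/-- `B₁`, `B₂` concern the threshold data, `B₃`, `B₄` the power method data. Only marginals and
subadditivity enter. -/
theorem measure_prod_batches_le {A : Set (Data n q mt Lt ρ)}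
    {B₁ B₂ B₃ B₄ : Set (BatchIndex ρ q mt → EuclideanSpace ℝ (Fin n))} {x : ℝ}
    (hsub : A ⊆ ((⋃ ϑ, batchView ϑ ⁻¹' (B₁ ∪ B₂)) ×ˢ Set.univ) ∪
        (Set.univ ×ˢ ⋃ ϑ, batchView ϑ ⁻¹' (B₃ ∪ B₄)))
    (hx : 0 ≤ x) (e₁ : batchLaw n q mt ρ B₁ ≤ ENNReal.ofReal x)
    (e₂ : batchLaw n q mt ρ B₂ ≤ ENNReal.ofReal x)
    (e₃ : batchLaw n q mt ρ B₃ ≤ ENNReal.ofReal (5 ^ (n + q) * (2 * x)))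
    (e₄ : batchLaw n q mt ρ B₄ ≤ ENNReal.ofReal (25 ^ r * x)) :
    ((sensingLaw n q mt Lt ρ).prod (sensingLaw n q mt Lt ρ)) A ≤
      Lt * ENNReal.ofReal ((1 + 1 + 5 ^ (n + q) * 2 + 25 ^ r) * x) := by
  have := isProbabilityMeasure_sensingLaw (n := n) (q := q) (mt := mt) (Lt := Lt) (ρ := ρ)
  set S := sensingLaw n q mt Lt ρ with hS
  calc _ ≤ (S.prod S) ((⋃ ϑ, batchView ϑ ⁻¹' (B₁ ∪ B₂)) ×ˢ Set.univ) +
          (S.prod S) (Set.univ ×ˢ ⋃ ϑ, batchView ϑ ⁻¹' (B₃ ∪ B₄)) :=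
          (measure_mono hsub).trans (measure_union_le _ _)
      _ = S (⋃ ϑ, batchView ϑ ⁻¹' (B₁ ∪ B₂)) + S (⋃ ϑ, batchView ϑ ⁻¹' (B₃ ∪ B₄)) := by
          rw [Measure.prod_prod, Measure.prod_prod, measure_univ, one_mul, mul_one]
      _ ≤ Lt * batchLaw n q mt ρ (B₁ ∪ B₂) + Lt * batchLaw n q mt ρ (B₃ ∪ B₄) :=
          add_le_add (measure_iUnion_batchView_le _) (measure_iUnion_batchView_le _)
      _ ≤ Lt * (batchLaw n q mt ρ B₁ + batchLaw n q mt ρ B₂) +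
          Lt * (batchLaw n q mt ρ B₃ + batchLaw n q mt ρ B₄) := by
          gcongr <;> exact measure_union_le _ _
      _ ≤ Lt * (ENNReal.ofReal (x) + ENNReal.ofReal (x)) +
          Lt * (ENNReal.ofReal (5 ^ (n + q) * (2 * x)) +
            ENNReal.ofReal (25 ^ r * x)) := by gcongr
      _ = _ := by
          rw [← mul_add, ← ENNReal.ofReal_add (by positivity) (by positivity),
            ← ENNReal.ofReal_add (by positivity) (by positivity),
            ← ENNReal.ofReal_add (by positivity) (by positivity)]
          congr 2
          ring

-- The four failure events of a mini-batch give the constants `c₁`, `1`, `c₃`, `c₂` (low energy,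
-- high energy, noise, signal). The noise event dictates the exponent `E`; the others have at least
-- this exponent because `δ² ≤ 1 ≤ r κ²`.
set_option maxHeartbeats 1000000 in
theorem measure_not_dataGood_le :
    ∃ c C : ℝ, 0 < c ∧ c < 1 ∧ 1 ≤ C ∧ ∀ {n q r mt Lt ρ : ℕ} (p : Protocol n q r mt Lt ρ)
      (D : ReducedSVD p.X r), 0 < r → p.κ = D.kappa → 1 ≤ p.μ → D.Incoherent p.μ →
      (p.byz.card : ℝ) < 0.4 * Lt → ∀ δ : ℝ, 0 < δ → δ < 1 →
      C * (n + q) ≤ ρ * mt * q * δ ^ 2 / (r ^ 2 * p.κ ^ 4 * p.μ ^ 2) →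
      ((sensingLaw n q mt Lt ρ).prod (sensingLaw n q mt Lt ρ)) {d | ¬ DataGood p D δ d} ≤
        ENNReal.ofReal (Lt *
          Real.exp (-(c * (ρ * mt * q * δ ^ 2 / (r ^ 2 * p.κ ^ 4 * p.μ ^ 2))))) := by
  have hβ1 := truncMean_pos one_pos
  have hβ := truncMean_pos truncLevel_pos
  have hb := truncLevel_pos
  have hK := one_le_expSqMean
  set β₁ := truncMean 1
  set b := truncLevel
  set β := truncMean b
  set K := expSqMean
  set c₁ := β₁ ^ 2 / 2 with hc₁
  set c₂ := β ^ 2 / (32 * b ^ 4) with hc₂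
  set c₃ := β ^ 2 / (16 * 40000 * 32 * 36 * K) with hc₃
  set c := min (min c₁ 1) (min c₂ c₃) with hc
  have hcpos : 0 < c := by
    refine lt_min (lt_min ?_ one_pos) (lt_min ?_ ?_) <;> positivity
  have hcc₁ : c ≤ c₁ := (min_le_left _ _).trans (min_le_left _ _)
  have hc1 : c ≤ 1 := (min_le_left _ _).trans (min_le_right _ _)
  have hcc₂ : c ≤ c₂ := (min_le_right _ _).trans (min_le_left _ _)
  have hcc₃ : c ≤ c₃ := (min_le_right _ _).trans (min_le_right _ _)
  refine ⟨c / 2, 12 / c, by positivity, by linarith, ?_, ?_⟩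
  · rw [one_le_div hcpos]; linarith
  intro n q r mt Lt ρ p D hr hκ hμ hinc hbyz δ hδ hδ1 hE
  set E := ρ * mt * q * δ ^ 2 / (r ^ 2 * p.κ ^ 4 * p.μ ^ 2) with hEdef
  have hκ1 : 1 ≤ p.κ := by rw [hκ]; exact D.one_le_kappa hr
  have hq : (0 : ℝ) < q := by exact_mod_cast D.q_pos hr
  have hr0 : (0 : ℝ) < r := by exact_mod_cast hr
  have hr1 : (1 : ℝ) ≤ r := by exact_mod_cast hr
  have hσ := D.sigmaMin_pos hr
  have hκ0 : 0 < p.κ := by linarith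
  have hμ0 : 0 < p.μ := by linarith
  have hnq : (1 : ℝ) ≤ n + q := by
    have : (1 : ℝ) ≤ q := by exact_mod_cast D.q_pos hr
    have : (0 : ℝ) ≤ n := Nat.cast_nonneg n
    linarith
  have hEpos : 0 < E := lt_of_lt_of_le (by positivity) hE
  have hN : (0 : ℝ) < ρ * mt := by
    rcases (show (0 : ℝ) ≤ ρ * mt by positivity).eq_or_lt with h | h
    · rw [hEdef, ← h] at hEpos; simp at hEpos
    · exact h
  set N : ℝ := (ρ : ℝ) * mt with hNdef
  set F := ∑ k, ‖cols p.X k‖ ^ 2 with hF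
  have hF1 : r * D.sigmaMin ^ 2 ≤ F := D.le_sum_norm_col_sq hr
  have hF2 : F ≤ r * (p.κ * D.sigmaMin) ^ 2 := by
    have := D.sum_norm_col_sq_le
    rwa [D.sigmaMax_eq hr, ← hκ] at this
  have hFpos : 0 < F := lt_of_lt_of_le (by positivity) hF1
  set Mx := p.κ ^ 2 * p.μ ^ 2 * F / q with hMx
  have hMxpos : 0 < Mx := by positivity
  have hx : ∀ k, ‖cols p.X k‖ ^ 2 ≤ Mx := by
    intro k
    refine (D.norm_col_sq_le hinc k).trans ?_
    rw [D.sigmaMax_eq hr, ← hκ, hMx]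
    calc p.μ ^ 2 * (r / q) * (p.κ * D.sigmaMin) ^ 2
        = p.κ ^ 2 * p.μ ^ 2 * (r * D.sigmaMin ^ 2) / q := by ring
      _ ≤ _ := by gcongr
  set Mv := p.κ ^ 2 * p.μ ^ 2 * r / q with hMv
  have hMvpos : 0 < Mv := by positivity
  have hv : ∀ k, ‖D.row k‖ ^ 2 ≤ Mv := by
    intro k
    have h1 := (D.norm_row_sq_le_col hr k).trans (D.norm_col_sq_le hinc k)
    rw [D.sigmaMax_eq hr, ← hκ] at h1
    refine le_of_mul_le_mul_left (h1.trans (le_of_eq ?_)) (show 0 < D.sigmaMin ^ 2 by positivity)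
    rw [hMv]; ring
  have hrow : ∀ k, D.row k ≠ 0 → ‖direction (cols p.X k)‖ = 1 := by
    intro k hk
    apply norm_direction
    intro h0
    have h1 := D.norm_row_sq_le_col hr k
    rw [h0, norm_zero] at h1
    have := norm_pos_iff.2 hk
    have : 0 < D.sigmaMin ^ 2 * ‖D.row k‖ ^ 2 := by positivity
    simp at h1
    linarith
  set ε := δ * (β * N * D.sigmaMin / 4) / (200 * Real.sqrt r) with hε
  have hsr : 0 < Real.sqrt r := Real.sqrt_pos.2 hr0
  have hεpos : 0 < ε := by positivity
  have hκμ : E ≤ N * q / (p.κ ^ 2 * p.μ ^ 2 * r) := by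
    rw [hEdef, div_le_div_iff₀ (by positivity) (by positivity)]
    have h1 : δ ^ 2 ≤ 1 := pow_le_one₀ hδ.le hδ1.le
    have h2 : (1 : ℝ) ≤ p.κ ^ 2 := one_le_pow₀ hκ1
    have h3 : δ ^ 2 * 1 ≤ 1 * (r * p.κ ^ 2) := by
      have : 1 ≤ r * p.κ ^ 2 := one_le_mul_of_one_le_of_one_le hr1 h2
      nlinarith
    calc N * q * δ ^ 2 * (p.κ ^ 2 * p.μ ^ 2 * r)
        = N * q * (p.κ ^ 2 * p.μ ^ 2 * r) * (δ ^ 2 * 1) := by ring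
      _ ≤ N * q * (p.κ ^ 2 * p.μ ^ 2 * r) * (1 * (r * p.κ ^ 2)) := by gcongr
      _ = _ := by ring
  have hE1 : E ≤ N * F / Mx := by
    have h1 : N * F / Mx = N * q / (p.κ ^ 2 * p.μ ^ 2) := by rw [hMx]; field_simp
    rw [h1]
    refine hκμ.trans ?_
    exact div_le_div_of_nonneg_left (by positivity) (by positivity)
      (le_mul_of_one_le_right (by positivity) hr1)
  have hE2 : E ≤ N / Mv := by
    have h1 : N / Mv = N * q / (p.κ ^ 2 * p.μ ^ 2 * r) := by rw [hMv]; field_simp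
    rw [h1]
    exact hκμ
  -- One `κ²` comes from the threshold, the other from `F ≤ r κ² σ_min²`; one `r` from this bound,
  -- the other from `√r` in `ε`.
  have hE3 : c₃ * E ≤ ε ^ 2 / (32 * (Real.sqrt (36 * K * Mx) ^ 2 * N)) := by
    rw [Real.sq_sqrt (by positivity), hε, div_pow, mul_pow (200 : ℝ), Real.sq_sqrt hr0.le, div_div,
      le_div_iff₀ (by positivity), hc₃, hEdef, hMx]
    calc β ^ 2 / (16 * 40000 * 32 * 36 * K) * (N * q * δ ^ 2 / (r ^ 2 * p.κ ^ 4 * p.μ ^ 2)) *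
          (200 ^ 2 * r * (32 * (36 * K * (p.κ ^ 2 * p.μ ^ 2 * F / q) * N)))
        = β ^ 2 * N ^ 2 * δ ^ 2 / (16 * r * p.κ ^ 2) * F := by
          field_simp
          ring
      _ ≤ β ^ 2 * N ^ 2 * δ ^ 2 / (16 * r * p.κ ^ 2) * (r * (p.κ * D.sigmaMin) ^ 2) := by gcongr
      _ = _ := by field_simp; norm_num
  -- the four failure events of a mini-batch
  set B₁ := {ω : BatchIndex ρ q mt → EuclideanSpace ℝ (Fin n) |
    ∑ i, ⟪cols p.X i.2.1, ω i⟫ ^ 2 ≤ β₁ / 2 * (N * F)} with hB₁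
  set B₂ := {ω : BatchIndex ρ q mt → EuclideanSpace ℝ (Fin n) |
    4 * K * (N * F) ≤ ∑ i, ⟪cols p.X i.2.1, ω i⟫ ^ 2} with hB₂
  set B₃ := {ω : BatchIndex ρ q mt → EuclideanSpace ℝ (Fin n) |
    ¬ ∀ s ≤ Real.sqrt (36 * K * Mx), ∀ w,
      ‖(noisePart (cols p.X) s ω).toEuclideanLin w‖ ≤ ε * ‖w‖} with hB₃
  set B₄ := {ω : BatchIndex ρ q mt → EuclideanSpace ℝ (Fin n) | ¬ ∀ w, β / 2 * N * ‖w‖ ^ 2 ≤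
    ∑ k, ⟪D.row k, w⟫ ^ 2 * ∑ l, ∑ i, truncSq b ⟪direction (cols p.X k), ω (l, k, i)⟫} with hB₄
  have e₁ : batchLaw n q mt ρ B₁ ≤ ENNReal.ofReal (Real.exp (-(c * E))) := by
    refine (batch_energy_low (cols p.X) hMxpos hx).trans (ENNReal.ofReal_le_ofReal
      (exp_le_exp_neg_of_le ?_))
    gcongr
  have e₂ : batchLaw n q mt ρ B₂ ≤ ENNReal.ofReal (Real.exp (-(c * E))) := by
    refine (batch_energy_high (cols p.X) hMxpos hx).trans (ENNReal.ofReal_le_ofReal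
      (exp_le_exp_neg_of_le ?_))
    calc c * E ≤ 1 * (N * F / Mx) := by gcongr
      _ = _ := one_mul _
  have e₃ : batchLaw n q mt ρ B₃ ≤ ENNReal.ofReal (5 ^ (n + q) * (2 * Real.exp (-(c * E)))) := by
    refine (batch_noise (cols p.X) hεpos.le).trans (ENNReal.ofReal_le_ofReal ?_)
    gcongr
    exact le_trans (by gcongr) hE3
  have e₄ : batchLaw n q mt ρ B₄ ≤ ENNReal.ofReal (25 ^ r * Real.exp (-(c * E))) := by
    refine (batch_signal (fun k => direction (cols p.X k)) D.row D.sum_inner_row hMvpos.le hv hrow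
      hb).trans (ENNReal.ofReal_le_ofReal ?_)
    gcongr
  have hsub : {d | ¬ DataGood p D δ d} ⊆
      ((⋃ ϑ, batchView ϑ ⁻¹' (B₁ ∪ B₂)) ×ˢ Set.univ) ∪
        (Set.univ ×ˢ ⋃ ϑ, batchView ϑ ⁻¹' (B₃ ∪ B₄)) := by
    intro d hd
    by_contra hcon
    apply hd
    simp only [Set.mem_union, Set.mem_prod, Set.mem_iUnion, Set.mem_preimage, Set.mem_univ,
      and_true, true_and, not_or, not_exists] at hcon
    obtain ⟨h1, h2⟩ := hcon
    refine dataGood_of_events p D hr hN hMx hx hbyz hε d (fun ϑ _ => ?_) (fun ϑ _ => ?_)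
      (fun ϑ _ => not_not.1 (h2 ϑ).1) (fun ϑ _ => not_not.1 (h2 ϑ).2)
    · exact (not_le.1 (h1 ϑ).1).le
    · exact (not_le.1 (h1 ϑ).2).le
  refine (measure_prod_batches_le hsub (Real.exp_nonneg _) e₁ e₂ e₃ e₄).trans ?_
  rw [ENNReal.ofReal_mul (Nat.cast_nonneg Lt), ENNReal.ofReal_natCast]
  exact mul_le_mul_right (ENNReal.ofReal_le_ofReal (net_sizes_mul_exp_le hcpos
    (D.r_le_n.trans (Nat.le_add_right _ _)) (by have := D.q_pos hr; omega) hE)) _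

end Sampling

end

section

open Matrix

/-! ## The power methods of the attack-free mini-batches -/

section Power

variable {n q r mt Lt ρ : ℕ} {p : Protocol n q r mt Lt ρ}

theorem Protocol.powerIterate_succ_of_clean {w : World n q r mt Lt ρ} {ϑ : Fin Lt}
    (h : ϑ ∈ p.cleanBatches) (t : ℕ) :
    p.powerIterate w (t + 1) ϑ = p.qr.toFun
      ((∑ l, p.X0 w.1 (ϑ, l)) * (∑ l, p.X0 w.1 (ϑ, l))ᵀ * p.powerIterate w t ϑ) := by
  change p.qr.toFun (∑ l : Fin ρ, p.UNode w t (p.powerIterate w t) (ϑ, l)) = _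
  congr 1
  have hV : p.VBatch w t (p.powerIterate w t) ϑ =
      (∑ l, p.X0 w.1 (ϑ, l))ᵀ * p.powerIterate w t ϑ := by
    unfold Protocol.VBatch
    rw [Matrix.transpose_sum, Matrix.sum_mul]
    refine Finset.sum_congr rfl fun l _ => ?_
    unfold Protocol.VNode
    rw [if_neg (Protocol.notMem_byz_of_clean h l)]
  rw [Matrix.mul_assoc, ← hV, Matrix.sum_mul]
  refine Finset.sum_congr rfl fun l _ => ?_
  unfold Protocol.UNode
  rw [if_neg (Protocol.notMem_byz_of_clean h l)]

/-- Orthonormalization only changes coordinates on the right, so the intermediate QR factors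
accumulate in `R`, whose invertibility is not claimed here. -/
theorem Protocol.exists_pow_mul_eq_powerIterate {w : World n q r mt Lt ρ} {ϑ : Fin Lt}
    (h : ϑ ∈ p.cleanBatches) (t : ℕ) :
    ∃ R : Matrix (Fin r) (Fin r) ℝ,
      ((∑ l, p.X0 w.1 (ϑ, l)) * (∑ l, p.X0 w.1 (ϑ, l))ᵀ) ^ t * Matrix.of w.2 =
        p.powerIterate w t ϑ * R := by
  induction t with
  | zero => exact ⟨1, by simp [Protocol.powerIterate]⟩
  | succ t ih =>
    obtain ⟨R, hR⟩ := ih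
    obtain ⟨R', -, hR'⟩ := p.qr.factor
      ((∑ l, p.X0 w.1 (ϑ, l)) * (∑ l, p.X0 w.1 (ϑ, l))ᵀ * p.powerIterate w t ϑ)
    refine ⟨R' * R, ?_⟩
    rw [pow_succ', Matrix.mul_assoc, hR, p.powerIterate_succ_of_clean h, ← Matrix.mul_assoc,
      ← Matrix.mul_assoc, ← hR']

theorem Protocol.exists_pow_mul_eq_basis {w : World n q r mt Lt ρ} {ϑ : Fin Lt}
    (h : ϑ ∈ p.cleanBatches) (t : ℕ) :
    ∃ R : Matrix (Fin r) (Fin r) ℝ,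
      ((∑ l, p.X0 w.1 (ϑ, l)) * (∑ l, p.X0 w.1 (ϑ, l))ᵀ) ^ t * Matrix.of w.2 =
        p.basis w t ϑ * R := by
  obtain ⟨R, hR⟩ := p.exists_pow_mul_eq_powerIterate (w := w) h t
  obtain ⟨R', -, hR'⟩ := p.qr.factor (p.powerIterate w t ϑ)
  exact ⟨R' * R, by rw [hR, ← Matrix.mul_assoc, Protocol.basis, ← hR']⟩

/-- With noise level `ε = δθ / (200 √r)`, the bound `√r · 2ε/θ` equals `δ / 100`. `Q` depends on the
data and not on the start. -/
theorem DataGood.exists_subspaceDist_basis_le {D : ReducedSVD p.X r} (hr : 0 < r) {δ : ℝ}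
    (hδ : 0 < δ) (hδ1 : δ < 1) {d : Data n q mt Lt ρ} (hd : DataGood p D δ d) {ϑ : Fin Lt}
    (hϑ : ϑ ∈ p.cleanBatches) :
    ∃ Q : Fin r → EuclideanSpace ℝ (Fin n), Orthonormal ℝ Q ∧ ∀ (T : ℕ) (u : Fin n → Fin r → ℝ),
      StartGood Q (cols u) (4 ^ (T + 1)) →
        subspaceDist D.U (p.basis (d, u) (T + 1) ϑ) ≤ δ / 100 := by
  obtain ⟨G, W, θ, hM, hθ, hW, hG⟩ := hd ϑ hϑ
  have hsr : 1 ≤ Real.sqrt r := Real.one_le_sqrt.2 (by exact_mod_cast hr)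
  have hεθ : δ * θ / (200 * Real.sqrt r) ≤ θ := by
    rw [div_le_iff₀ (by positivity)]
    nlinarith
  obtain ⟨Q, hQ, h⟩ := subspaceDist_power_le D.U_orthonormal hM hθ (by positivity) hεθ hW hG
  refine ⟨Q, hQ, fun T u hu => ?_⟩
  obtain ⟨R, hR⟩ := p.exists_pow_mul_eq_basis (w := (d, u)) hϑ (T + 1)
  refine (h T (Matrix.of u) _ R hu (p.qr.orthonormal _) hR).trans (le_of_eq ?_)
  field_simp
  norm_num

/-- Most of the mini-batches have a good estimate. -/
def WorldGood (p : Protocol n q r mt Lt ρ) (D : ReducedSVD p.X r) (δ : ℝ) (T : ℕ)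
    (w : World n q r mt Lt ρ) : Prop :=
  ∃ G : Finset (Fin Lt), 0.55 * (Lt : ℝ) ≤ G.card ∧
    ∀ ϑ ∈ G, subspaceDist D.U (p.basis w T ϑ) ≤ δ / 100

/-- Data are fixed and only the start is random. Clean mini-batches make up at least 60%; at most 5%
are lost except with probability `20 · 2η`. -/
theorem DataGood.one_sub_le_worldGood {D : ReducedSVD p.X r} (hr : 0 < r) (hLt : 0 < Lt)
    (hbyz : (p.byz.card : ℝ) < 0.4 * Lt) {δ : ℝ}
    (hδ : 0 < δ) (hδ1 : δ < 1) {d : Data n q mt Lt ρ} (hd : DataGood p D δ d) {η : ℝ}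
    (hη : 0 < η) (hη1 : η ≤ 1) {T : ℕ} (hT : (n : ℝ) ^ 3 / η ^ 2 ≤ 4 ^ (T + 1)) :
    1 - 40 * η ≤ (Measure.pi fun _ : Fin n => Measure.pi fun _ : Fin r => gaussianReal 0 1).real
      {u | WorldGood p D δ (T + 1) (d, u)} := by
  classical
  choose! Q hQ h using fun ϑ (hϑ : ϑ ∈ p.cleanBatches) =>
    hd.exists_subspaceDist_basis_le hr hδ hδ1 hϑ
  have hmarkov := measure_card_bad_gt_le (ν := Measure.pi fun _ : Fin n =>
    Measure.pi fun _ : Fin r => gaussianReal 0 1) p.cleanBatches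
    (fun ϑ => cols ⁻¹' {u | ¬ StartGood (Q ϑ) u (4 ^ (T + 1))}) (p := 2 * η) (N := Lt)
    (fun ϑ hϑ => by
      refine (Measure.le_map_apply measurePreserving_cols.measurable.aemeasurable _).trans ?_
      rw [measurePreserving_cols.map_eq]
      exact measure_not_startGood_le hr (hQ ϑ hϑ) hη hη1 (by rwa [finrank_euclideanSpace_fin]))
    hLt ((Finset.card_le_univ _).trans (by simp))
  refine one_sub_le_measureReal_of_compl (by positivity) (le_trans (measure_mono fun u hu => ?_)
    (hmarkov.trans (le_of_eq (by ring_nf))))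
  by_contra hcon
  apply hu
  rw [Set.mem_ofPred_eq, not_lt] at hcon
  refine ⟨p.cleanBatches.filter fun ϑ => ¬ u ∈ cols ⁻¹' {u | ¬ StartGood (Q ϑ) u (4 ^ (T + 1))},
    ?_, fun ϑ hϑ => ?_⟩
  · have h1 := Finset.card_filter_add_card_filter_not (s := p.cleanBatches)
      (fun ϑ => u ∈ cols ⁻¹' {u | ¬ StartGood (Q ϑ) u (4 ^ (T + 1))})
    have h2 := p.le_card_cleanBatches
    rw [← h1] at h2
    push_cast at h2
    linarith
  · rw [Finset.mem_filter] at hϑ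
    exact h ϑ hϑ.1 T u (not_not.1 hϑ.2)

end Power

/-! ## The subspace median -/

section Median

variable {n q r mt Lt ρ : ℕ} {p : Protocol n q r mt Lt ρ}

theorem gmObjective_center_le {K : ℕ} {E : Type} [NormedAddCommGroup E] [NormedSpace ℝ E]
    {z : Fin K → E} {B : ℝ} (hz : ∀ i, ‖z i‖ ≤ B) :
    gmObjective z (gmCenter z) ≤ 2 * K * B := by
  rcases Nat.eq_zero_or_pos K with rfl | hK
  · simp [gmObjective]
  have hK' : (0 : ℝ) < K := by exact_mod_cast hK
  have hc : ‖gmCenter z‖ ≤ B := by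
    unfold gmCenter
    rw [norm_smul, Real.norm_of_nonneg (by positivity), inv_mul_le_iff₀ hK']
    refine (norm_sum_le _ _).trans ((Finset.sum_le_sum fun i _ => hz i).trans ?_)
    simp
  calc gmObjective z (gmCenter z) ≤ ∑ _i : Fin K, 2 * B :=
        Finset.sum_le_sum fun i _ => (norm_sub_le _ _).trans (by linarith [hz i])
    _ = 2 * K * B := by simp; ring

theorem gmObjective_center_of_one {E : Type} [NormedAddCommGroup E] [NormedSpace ℝ E]
    (z : Fin 1 → E) : gmObjective z (gmCenter z) = 0 := by
  simp [gmObjective, gmCenter]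

/-- The number of iterations of the median routine is sufficient. -/
theorem gm_error_le {n K r T : ℕ} {L : ℝ} (hr : 0 < r) (hK : 0 < K) (hL : (K : ℝ) ≤ L) {δ C : ℝ}
    (hδ : 0 < δ) (hδ1 : δ < 1) (hC : 12621 ≤ C) (hT : C * Real.log (L * r / δ) ≤ T)
    {z : Fin K → EuclideanSpace ℝ (Fin n × Fin n)} (hz : ∀ i, ‖z i‖ ≤ Real.sqrt r) :
    4000 * gmObjective z (gmCenter z) / (1 + 1 / 600) ^ T ≤ δ / 100 := by
  -- For a single mini-batch `L r / δ` may be close to `1` and `T` small, but then the objective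
  -- vanishes.
  rcases Nat.lt_or_ge 1 K with hK2 | hK1
  swap
  · obtain rfl : K = 1 := by omega
    rw [gmObjective_center_of_one]
    simp only [mul_zero, zero_div]
    positivity
  have hr1 : (1 : ℝ) ≤ r := by exact_mod_cast hr
  have hK2' : (2 : ℝ) ≤ K := by exact_mod_cast hK2
  set x := L * r / δ with hx
  have hKr : (K : ℝ) * r ≤ L * r := by gcongr
  have hxδ : x * δ = L * r := by rw [hx]; field_simp
  have hx2 : 2 ≤ x := by
    rw [hx, le_div_iff₀ hδ]
    nlinarith
  have hlog : 0 ≤ Real.log x := Real.log_nonneg (by linarith)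
  have hbase : Real.exp (1 / 601) ≤ 1 + 1 / 600 := by
    have h1 := Real.add_one_le_exp (-(1 / 601) : ℝ)
    rw [Real.exp_neg] at h1
    have h2 := Real.exp_pos (1 / 601)
    have h3 : (600 / 601 : ℝ) ≤ (Real.exp (1 / 601))⁻¹ := by norm_num at h1 ⊢; linarith
    rw [le_inv_comm₀ (by norm_num) h2] at h3
    norm_num at h3 ⊢
    linarith
  -- `12621 = 21 · 601`. Twenty powers of `x ≥ 2` beat the constant `800000`, and the last one pays
  -- for `L r`.
  have hpow : x ^ 21 ≤ (1 + 1 / 600) ^ T := by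
    calc x ^ 21 = Real.exp (21 * Real.log x) := by
          rw [show (21 : ℝ) = ((21 : ℕ) : ℝ) by norm_num, Real.exp_nat_mul,
            Real.exp_log (by linarith)]
      _ ≤ Real.exp (T * (1 / 601)) := by
          apply Real.exp_le_exp.2
          have : 12621 * Real.log x ≤ T := le_trans (by gcongr) hT
          linarith
      _ = Real.exp (1 / 601) ^ T := Real.exp_nat_mul _ _
      _ ≤ _ := by gcongr
  have hobj := gmObjective_center_le hz
  have hsr : Real.sqrt r ≤ r := by
    rw [Real.sqrt_le_left (by positivity)]
    nlinarith
  have h20 : (2 : ℝ) ^ 20 ≤ x ^ 20 := by gcongr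
  rw [div_le_iff₀ (by positivity)]
  calc 4000 * gmObjective z (gmCenter z) ≤ 4000 * (2 * K * Real.sqrt r) := by gcongr
    _ ≤ 4000 * (2 * (K * r)) := by
        have : (K : ℝ) * Real.sqrt r ≤ K * r := by gcongr
        linarith
    _ ≤ 8000 * (x * δ) := by rw [hxδ]; linarith
    _ ≤ δ / 100 * (x ^ 20 * x) := by
        have h0 : 0 ≤ x * δ := by positivity
        norm_num at h20
        nlinarith
    _ = δ / 100 * x ^ 21 := by ring
    _ ≤ _ := by gcongr

/-- Good projections are within `δ/50` of the true one, so the median is within `10 · δ/50 + δ/100`.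
The input nearest to the median is no farther from it than a good input, so by the triangle
inequality it is close to the truth even if its mini-batch is attacked. -/
theorem WorldGood.subspaceDist_output_le {S : Type} [MeasurableSpace S]
    {gm : MedianRoutine Lt (EuclideanSpace ℝ (Fin n × Fin n)) S} {Tpow Tgm : ℕ} {εc L C : ℝ}
    {D : ReducedSVD p.X r} (hr : 0 < r) (hLt : 0 < Lt) (hL : (Lt : ℝ) ≤ L) {δ : ℝ}
    (hδ : 0 < δ) (hδ1 : δ < 1) (hC : 12621 ≤ C) (hT : C * Real.log (L * r / δ) ≤ Tgm)
    (hε : εc ≤ 1) {w : World n q r mt Lt ρ} (hw : WorldGood p D δ Tpow w) {s : S}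
    (hs : gmObjective (p.proj w Tpow) (gmCenter (p.proj w Tpow)) ≠ 0 →
      gm.LineSearchesSucceed Tgm εc (p.proj w Tpow) s)
    {Uout : Matrix (Fin n) (Fin r) ℝ} (hU : p.IsOutput gm Tpow Tgm w s Uout) :
    subspaceDist D.U Uout ≤ δ := by
  obtain ⟨G, hcard, hG⟩ := hw
  have horth : ∀ ϑ, (p.basis w Tpow ϑ)ᵀ * p.basis w Tpow ϑ = 1 := fun ϑ => p.qr.orthonormal _
  have hclose : ∀ ϑ ∈ G, ‖p.proj w Tpow ϑ - vec (D.U * D.Uᵀ)‖ ≤ δ / 50 := by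
    intro ϑ hϑ
    have h1 := norm_vec_proj_sub D.U_orthonormal (horth ϑ)
    have h2 : 0 ≤ subspaceDist D.U (p.basis w Tpow ϑ) := Real.sqrt_nonneg _
    refine abs_le_of_sq_le_sq' ?_ (by positivity) |>.2
    change ‖vec _ - _‖ ^ 2 ≤ _
    rw [h1]
    nlinarith [hG ϑ hϑ]
  have hgm := gm.norm_output_sub_le hε hs (by positivity) G hclose hLt hcard
  have herr : 4000 * gmObjective (p.proj w Tpow) (gmCenter (p.proj w Tpow)) /
      (1 + 1 / 600) ^ Tgm ≤ δ / 100 := by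
    refine gm_error_le hr hLt hL hδ hδ1 hC hT fun ϑ => ?_
    apply Real.le_sqrt_of_sq_le
    exact (norm_vec_proj (horth ϑ)).le
  obtain ⟨ϑ, hbest, rfl⟩ := hU
  obtain ⟨ϑ', hϑ'⟩ : G.Nonempty := by
    rw [← Finset.card_pos]
    have : (0 : ℝ) < Lt := by exact_mod_cast hLt
    have : (0 : ℝ) < G.card := lt_of_lt_of_le (by positivity) hcard
    exact_mod_cast this
  set o := gm.output Tgm (p.proj w Tpow) s with ho
  have h1 : ‖p.proj w Tpow ϑ - vec (D.U * D.Uᵀ)‖ ≤ δ := by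
    calc ‖p.proj w Tpow ϑ - vec (D.U * D.Uᵀ)‖
        ≤ ‖p.proj w Tpow ϑ - o‖ + ‖o - vec (D.U * D.Uᵀ)‖ := norm_sub_le_norm_sub_add_norm_sub _ _ _
      _ ≤ ‖p.proj w Tpow ϑ' - o‖ + ‖o - vec (D.U * D.Uᵀ)‖ := by gcongr; exact hbest ϑ'
      _ ≤ ‖p.proj w Tpow ϑ' - vec (D.U * D.Uᵀ)‖ + ‖vec (D.U * D.Uᵀ) - o‖ +
          ‖o - vec (D.U * D.Uᵀ)‖ := by gcongr; exact norm_sub_le_norm_sub_add_norm_sub _ _ _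
      _ ≤ δ := by
          rw [norm_sub_rev (vec (D.U * D.Uᵀ)) o]
          have := hclose ϑ' hϑ'
          linarith
  have h2 := norm_vec_proj_sub D.U_orthonormal (horth ϑ)
  change ‖p.proj w Tpow ϑ - vec (D.U * D.Uᵀ)‖ ^ 2 = _ at h2
  refine abs_le_of_sq_le_sq' ?_ hδ.le |>.2
  have h3 : ‖p.proj w Tpow ϑ - vec (D.U * D.Uᵀ)‖ ^ 2 ≤ δ ^ 2 := by gcongr
  nlinarith [sq_nonneg (subspaceDist D.U (p.basis w Tpow ϑ))]

end Median

/-! ## Success probability -/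

section Success

/-- Data, start and seed are revealed one after the other, each bound holding for every fixed good
outcome of the earlier layers. The line search guarantee can thus be used on a fixed input. -/
theorem one_sub_le_real_success :
    ∃ c C : ℝ, 0 < c ∧ c < 1 ∧ 1 ≤ C ∧ ∀ {n q r mt Lt ρ : ℕ} (p : Protocol n q r mt Lt ρ)
      (D : ReducedSVD p.X r), 0 < r → 0 < Lt → p.κ = D.kappa → 1 ≤ p.μ → D.Incoherent p.μ →
      (p.byz.card : ℝ) < 0.4 * Lt → ∀ δ : ℝ, 0 < δ → δ < 1 →
      C * (n + q) ≤ ρ * mt * q * δ ^ 2 / (r ^ 2 * p.κ ^ 4 * p.μ ^ 2) →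
      ∀ (η : ℝ) (T : ℕ), 0 < η → η ≤ 1 → (n : ℝ) ^ 3 / η ^ 2 ≤ 4 ^ (T + 1) →
      ∀ (L Cgm : ℝ) (Tgm : ℕ), (Lt : ℝ) ≤ L → 12621 ≤ Cgm → Cgm * Real.log (L * r / δ) ≤ Tgm →
      ∀ {S : Type} [MeasurableSpace S] (ν : Measure S) [IsProbabilityMeasure ν]
      (gm : MedianRoutine Lt (EuclideanSpace ℝ (Fin n × Fin n)) S) (εc cgm : ℝ),
      εc ≤ 1 → 0 ≤ cgm → gm.IsPathFollowing ν Tgm εc cgm →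
      1 - Lt * Real.exp (-(c * (ρ * mt * q * δ ^ 2 / (r ^ 2 * p.κ ^ 4 * p.μ ^ 2))))
          - 40 * η - cgm ≤
        ((worldLaw n q r mt Lt ρ).prod ν).real
          {ω | ∀ Uout, p.IsOutput gm (T + 1) Tgm ω.1 ω.2 Uout → subspaceDist D.U Uout ≤ δ} := by
  obtain ⟨c, C, hc, hc1, hC, hdata⟩ := measure_not_dataGood_le
  refine ⟨c, C, hc, hc1, hC, ?_⟩
  intro n q r mt Lt ρ p D hr hLt hκ hμ hinc hbyz δ hδ hδ1 hE η T hη hη1 hT L Cgm Tgm hL hCgm hTgm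
    S _ ν _ gm εc cgm hε hcgm hpath
  have := isProbabilityMeasure_sensingLaw (n := n) (q := q) (mt := mt) (Lt := Lt) (ρ := ρ)
  have hprob : IsProbabilityMeasure (worldLaw n q r mt Lt ρ) := by unfold worldLaw; infer_instance
  have h1 := one_sub_le_measureReal_of_compl (G := {d | DataGood p D δ d}) (by positivity)
    (hdata p D hr hκ hμ hinc hbyz δ hδ hδ1 hE)
  have h2 := one_sub_le_prod_real (E := {w | WorldGood p D δ (T + 1) w}) (by positivity)
    (by positivity) h1 fun d hd =>
      DataGood.one_sub_le_worldGood hr hLt hbyz hδ hδ1 hd hη hη1 hT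
  rw [show ∀ x y : ℝ, 1 - x - y = 1 - (x + y) from fun x y => by ring] at h2
  have h3 := one_sub_le_prod_real (μ := worldLaw n q r mt Lt ρ) (ν := ν)
    (E := {ω | ∀ Uout, p.IsOutput gm (T + 1) Tgm ω.1 ω.2 Uout → subspaceDist D.U Uout ≤ δ})
    (by positivity) hcgm h2 fun w hw => ?_
  · linarith
  -- When all inputs coincide, path following promises nothing, but the output is then
  -- deterministic.
  by_cases hobj : gmObjective (p.proj w (T + 1)) (gmCenter (p.proj w (T + 1))) = 0
  · have : {s : S | (w, s) ∈ {ω : World n q r mt Lt ρ × S |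
        ∀ Uout, p.IsOutput gm (T + 1) Tgm ω.1 ω.2 Uout → subspaceDist D.U Uout ≤ δ}} =
        Set.univ := by
      refine Set.eq_univ_of_forall fun s Uout hU => ?_
      exact WorldGood.subspaceDist_output_le hr hLt hL hδ hδ1 hCgm hTgm hε hw
        (fun h => absurd hobj h) hU
    rw [this, probReal_univ]
    linarith
  · refine (hpath _ hobj).trans (measureReal_mono (fun s hs Uout hU => ?_) (measure_ne_top _ _))
    exact WorldGood.subspaceDist_output_le hr hLt hL hδ hδ1 hCgm hTgm hε hw (fun _ => hs) hU

end Success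

end

/-! ## Numerical estimates and communication cost -/

/-- The start may fail with probability of order `n ^ (-10 s)`: `s = 1` serves the first claim and
`s = L` the second. As `6400 ≤ 2 ^ 13`, the left side is at most `n ^ (16 + 20 s)`. -/
theorem start_error_le_pow {n s T : ℕ} (hn : 2 ≤ n) (hs : 1 ≤ s)
    (hT : 36 * s * Real.log n ≤ T) :
    (n : ℝ) ^ 3 / (1 / (80 * (n : ℝ) ^ (10 * s))) ^ 2 ≤ 4 ^ T := by
  have hn2 : (2 : ℝ) ≤ n := by exact_mod_cast hn
  have hn0 : (0 : ℝ) < n := by linarith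
  have h13 : (6400 : ℝ) ≤ (n : ℝ) ^ 13 :=
    le_trans (by norm_num) (pow_le_pow_left₀ zero_le_two hn2 13)
  calc (n : ℝ) ^ 3 / (1 / (80 * (n : ℝ) ^ (10 * s))) ^ 2
      = (n : ℝ) ^ 3 * (6400 * (n : ℝ) ^ (20 * s)) := by
        rw [one_div, inv_pow, div_inv_eq_mul, mul_pow, ← pow_mul]
        norm_num
        left
        congr 1
        ring
    _ ≤ (n : ℝ) ^ 3 * ((n : ℝ) ^ 13 * (n : ℝ) ^ (20 * s)) := by gcongr
    _ = (n : ℝ) ^ (16 + 20 * s) := by rw [← pow_add, ← pow_add]; congr 1; ring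
    _ ≤ (n : ℝ) ^ (36 * s) := pow_le_pow_right₀ (by linarith) (by omega)
    _ = Real.exp ((36 * s : ℕ) * Real.log n) := by rw [Real.exp_nat_mul, Real.exp_log hn0]
    _ ≤ Real.exp ((T : ℝ) * 1) := by
        apply Real.exp_le_exp.2
        push_cast
        linarith
    _ = Real.exp 1 ^ T := Real.exp_nat_mul _ _
    _ ≤ 4 ^ T := by
        gcongr
        linarith [Real.exp_one_lt_d9]

/-- The number of mini-batches cancels, and of `κ⁶` only `κ⁴` is used. -/
theorem le_sample_ratio {C κ μ n q r ρ mt Lt δ : ℝ} (hC : 0 ≤ C) (hκ : 1 ≤ κ) (hμ : 0 < μ)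
    (hr : 0 < r) (hδ : 0 < δ) (hLt : 0 < Lt) (hnq : 0 ≤ n + q)
    (h : C * Lt * (κ ^ 6 * μ ^ 2 * (n + q) * r ^ 2) / δ ^ 2 ≤ mt * (Lt * ρ) * q) :
    C * (n + q) ≤ ρ * mt * q * δ ^ 2 / (r ^ 2 * κ ^ 4 * μ ^ 2) := by
  have hκ0 : 0 < κ := by linarith
  rw [le_div_iff₀ (by positivity)]
  rw [div_le_iff₀ (by positivity)] at h
  have h1 : Lt * (C * (κ ^ 6 * μ ^ 2 * (n + q) * r ^ 2)) ≤ Lt * (ρ * mt * q * δ ^ 2) := by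
    linarith
  refine le_trans ?_ (le_of_mul_le_mul_left h1 hLt)
  have hκ2 : 1 ≤ κ ^ 2 := one_le_pow₀ hκ
  calc C * (n + q) * (r ^ 2 * κ ^ 4 * μ ^ 2)
      = C * (κ ^ 4 * 1 * μ ^ 2 * (n + q) * r ^ 2) := by ring
    _ ≤ C * (κ ^ 4 * κ ^ 2 * μ ^ 2 * (n + q) * r ^ 2) := by gcongr
    _ = _ := by ring

/-- The terms `a log a` and `(1 - a) log (1 - a)` are nonpositive, and `log b ≤ log (1 - b)`. Hence
`ψ(a, b) ≤ -log b`. -/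
theorem pow_le_exp_neg_mul_psi {a b : ℝ} (ha : 0 < a) (ha1 : a < 1) (hb : 0 < b) (hb2 : b ≤ 1 / 2)
    (L : ℕ) : b ^ L ≤ Real.exp (-(L * psi a b)) := by
  have hpsi : psi a b ≤ -Real.log b := by
    unfold psi
    rw [Real.log_div (by linarith) (by linarith), Real.log_div ha.ne' hb.ne']
    have h1 : Real.log (1 - a) ≤ 0 := Real.log_nonpos (by linarith) (by linarith)
    have h2 : Real.log a ≤ 0 := Real.log_nonpos ha.le ha1.le
    have h3 : Real.log b ≤ Real.log (1 - b) := Real.log_le_log hb (by linarith)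
    have h4 : (1 - a) * Real.log (1 - a) ≤ 0 := mul_nonpos_of_nonneg_of_nonpos (by linarith) h1
    have h5 : a * Real.log a ≤ 0 := mul_nonpos_of_nonneg_of_nonpos ha.le h2
    have h6 : (1 - a) * Real.log b ≤ (1 - a) * Real.log (1 - b) :=
      mul_le_mul_of_nonneg_left h3 (by linarith)
    linarith
  calc b ^ L = Real.exp (L * Real.log b) := by rw [Real.exp_nat_mul, Real.exp_log hb]
    _ ≤ _ := by
      apply Real.exp_le_exp.2
      have : (L : ℝ) * psi a b ≤ L * -Real.log b := by gcongr
      linarith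

/-- If the number of nodes is treated as a constant, the error terms of the power methods are
dominated by the large deviation term. -/
theorem error_le_exp_neg_mul_psi {n q L Lt : ℕ} (hn : 2 ≤ n) (hL : 1 ≤ L) (hLt : Lt ≤ L)
    {a x : ℝ} (ha : 0 < a) (ha1 : a < 1) (hx : 4 * L * (n + q) ≤ x) :
    Lt * Real.exp (-x) + 1 / (2 * (n : ℝ) ^ (10 * L)) ≤
      Real.exp (-(L * psi a (Real.exp (-(9 / 10 * (n + q))) + 1 / (n : ℝ) ^ 10))) := by
  have hn2 : (2 : ℝ) ≤ n := by exact_mod_cast hn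
  have hq0 : (0 : ℝ) ≤ q := Nat.cast_nonneg q
  have hL1 : (1 : ℝ) ≤ L := by exact_mod_cast hL
  set e := Real.exp (-(9 / 10 * ((n : ℝ) + q))) with he
  have he0 : 0 < e := Real.exp_pos _
  have hn10 : 1 / (n : ℝ) ^ 10 ≤ 1 / 1024 := by
    apply one_div_le_one_div_of_le (by norm_num)
    exact le_trans (by norm_num) (pow_le_pow_left₀ zero_le_two hn2 10)
  have hn10' : 0 < 1 / (n : ℝ) ^ 10 := by positivity
  have he4 : e ≤ 4 / 10 := by
    calc e ≤ Real.exp (-1) := by apply Real.exp_le_exp.2; linarith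
      _ ≤ 4 / 10 := by
        rw [Real.exp_neg, inv_le_comm₀ (Real.exp_pos 1) (by norm_num)]
        norm_num
        linarith [Real.exp_one_gt_d9]
  refine le_trans ?_ (pow_le_exp_neg_mul_psi ha ha1 (by positivity) (by linarith) L)
  have h1 : 1 / (n : ℝ) ^ (10 * L) ≤ (e + 1 / (n : ℝ) ^ 10) ^ L := by
    rw [pow_mul, ← one_div_pow]
    gcongr
    linarith
  have h2 : e ^ L ≤ (e + 1 / (n : ℝ) ^ 10) ^ L := by
    gcongr
    linarith
  -- Each of the two errors gets half of the target. Here `2 Lt ≤ e ^ (2L)`, and `2L ≤ L (n + q)` is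
  -- covered by the surplus in `x`.
  have h3 : Lt * Real.exp (-x) ≤ e ^ L / 2 := by
    have h4 : (Lt : ℝ) ≤ Real.exp L := by
      have h5 : (Lt : ℝ) ≤ L := by exact_mod_cast hLt
      linarith [Real.add_one_le_exp (L : ℝ)]
    have h6 : (2 : ℝ) ≤ Real.exp L := by linarith [Real.add_one_le_exp (L : ℝ)]
    have h7 : 2 * (Lt * Real.exp (-x)) ≤ Real.exp L * (Real.exp L * Real.exp (-x)) := by gcongr
    have h8 : Real.exp L * (Real.exp L * Real.exp (-x)) ≤ e ^ L := by
      rw [he, ← Real.exp_nat_mul, ← Real.exp_add, ← Real.exp_add]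
      apply Real.exp_le_exp.2
      have h9 : (L : ℝ) * 2 ≤ L * (n + q) := by gcongr; linarith
      linarith
    linarith
  have h10 : 1 / (2 * (n : ℝ) ^ (10 * L)) = 1 / (n : ℝ) ^ (10 * L) / 2 := by
    rw [div_div, mul_comm]
  rw [h10]
  linarith

theorem Protocol.commCost_eq {n q r mt Lt ρ : ℕ} (p : Protocol n q r mt Lt ρ)
    (w : World n q r mt Lt ρ) (T : ℕ) (ℓ : Node Lt ρ) :
    p.commCost w T ℓ = 2 + n * r + T * (2 * (q * r) + 2 * (n * r)) := by
  unfold Protocol.commCost Protocol.transcript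
  simp only [List.map_append, List.sum_append, List.map_flatMap, List.map_cons, List.map_nil,
    Message.size]
  simp [List.flatMap_def, List.sum_flatten]
  ring

/-- The communication cost is of order `(n + q) r x` for `⌈x⌉` iterations. -/
theorem commCost_bounds {n q r T : ℕ} {x : ℝ} (hn : 2 ≤ n) (hr : 0 < r) (hx : 1 ≤ x)
    (hT : T = ⌈x⌉₊) :
    x * ((n + q) * r) ≤ ((2 + n * r + T * (2 * (q * r) + 2 * (n * r)) : ℕ) : ℝ) ∧
      ((2 + n * r + T * (2 * (q * r) + 2 * (n * r)) : ℕ) : ℝ) ≤ 6 * (x * ((n + q) * r)) := by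
  have h1 : x ≤ T := by rw [hT]; exact Nat.le_ceil x
  have h2 : (T : ℝ) ≤ 2 * x := by
    have := Nat.ceil_lt_add_one (show 0 ≤ x by linarith)
    rw [← hT] at this
    linarith
  have hr1 : (1 : ℝ) ≤ r := by exact_mod_cast hr
  have hn2 : (2 : ℝ) ≤ n := by exact_mod_cast hn
  have hq0 : (0 : ℝ) ≤ q := Nat.cast_nonneg q
  have hqr : (0 : ℝ) ≤ q * r := by positivity
  have hnr : 2 ≤ (n : ℝ) * r := by nlinarith
  push_cast
  have h3 : x * ((n + q) * r) ≤ T * ((n + q) * r) := by gcongr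
  have h4 : T * (((n : ℝ) + q) * r) ≤ 2 * x * ((n + q) * r) := by gcongr
  have h5 : 1 * (((n : ℝ) + q) * r) ≤ x * ((n + q) * r) := by gcongr
  have h6 : 0 ≤ x * (((n : ℝ) + q) * r) := by positivity
  -- The iterations cost at most `4x (n + q) r`, and the threshold and the start at most `2 + n r ≤
  -- 2x (n + q) r`.
  constructor <;> nlinarith

end ByzLRCS

/-! ### Choice of the constants and the three claims -/

set_option maxHeartbeats 800000 in
theorem mainTheorem4 :
    ∃ C₀ c c' K : ℝ, 1 ≤ C₀ ∧ 0 < c ∧ c < 1 ∧ 0 < c' ∧ c' < 1 ∧ 1 ≤ K ∧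
    ∀ (n q r mt Lt ρ L m : ℕ), 2 ≤ n → 0 < r → 0 < Lt → 0 < ρ → L = Lt * ρ → m = mt * L →
    ∀ (p : ByzLRCS.Protocol n q r mt Lt ρ) (D : ByzLRCS.ReducedSVD p.X r),
      p.κ = D.kappa → 1 ≤ p.μ → D.Incoherent p.μ →
    ∀ τ : ℝ, (p.byz.card : ℝ) ≤ τ * L → τ < 0.4 * Lt / L →
    ∀ δ₀ : ℝ, 0 < δ₀ → δ₀ < 1 →
    ∀ Cs Cpow Cgm : ℝ, C₀ ≤ Cs → C₀ ≤ Cpow → C₀ ≤ Cgm →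
    ∀ Tpow Tgm : ℕ,
      Tpow = ⌈Cpow * p.κ ^ 2 * Real.log (n / δ₀)⌉₊ →
      Tgm = ⌈Cgm * Real.log (L * r / δ₀)⌉₊ →
    ∀ (S : Type) [MeasurableSpace S] (ν : MeasureTheory.Measure S)
      [MeasureTheory.IsProbabilityMeasure ν]
      (gm : ByzLRCS.MedianRoutine Lt (EuclideanSpace ℝ (Fin n × Fin n)) S) (εc cgm : ℝ),
      0 < εc → εc ≤ 1 → 0 ≤ cgm → gm.IsPathFollowing ν Tgm εc cgm →
      Cs * Lt * (p.κ ^ 6 * p.μ ^ 2 * (n + q) * r ^ 2) / δ₀ ^ 2 ≤ (m : ℝ) * q →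
      (1 - cgm
          - Real.exp (-(Lt * ByzLRCS.psi (0.4 - τ * L / Lt)
              (Real.exp (-(c * (n + q))) + 1 / (n : ℝ) ^ 10)))
          - 1 / (n : ℝ) ^ 10
          - L * Real.exp (-(c' * mt * q * δ₀ ^ 2 / (r ^ 2 * p.κ ^ 4 * p.μ ^ 2)))
        ≤ ((ByzLRCS.worldLaw n q r mt Lt ρ).prod ν).real
            {ω | ∀ Uout, p.IsOutput gm Tpow Tgm ω.1 ω.2 Uout →
              ByzLRCS.subspaceDist D.U Uout ≤ δ₀}) ∧
      (C₀ * L ≤ Cs → C₀ * L ≤ Cpow →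
        1 - cgm
          - Real.exp (-(L * ByzLRCS.psi (0.4 - τ)
              (Real.exp (-(c * (n + q))) + 1 / (n : ℝ) ^ 10)))
          - L * Real.exp (-(c' * mt * q * δ₀ ^ 2 / (r ^ 2 * p.κ ^ 4)))
        ≤ ((ByzLRCS.worldLaw n q r mt Lt ρ).prod ν).real
            {ω | ∀ Uout, p.IsOutput gm Tpow Tgm ω.1 ω.2 Uout →
              ByzLRCS.subspaceDist D.U Uout ≤ δ₀}) ∧
      (∀ (w : ByzLRCS.World n q r mt Lt ρ) (ℓ : ByzLRCS.Node Lt ρ),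
        Cpow * p.κ ^ 2 * (n + q) * r * Real.log (n / δ₀) ≤ p.commCost w Tpow ℓ ∧
        (p.commCost w Tpow ℓ : ℝ) ≤ K * (Cpow * p.κ ^ 2 * (n + q) * r * Real.log (n / δ₀)) ∧
        (q ≤ n →
          (p.commCost w Tpow ℓ : ℝ) ≤ K * (Cpow * p.κ ^ 2 * n * r * Real.log (n / δ₀)))) := by
  obtain ⟨c, C, hc, hc1, hC, hsuccess⟩ := ByzLRCS.one_sub_le_real_success
  -- `12621` serves the median and the start, `C` the sampling bound, `4 / c` the second claim. `K =
  -- 12` doubles the `6` of `commCost_bounds` for the case `q ≤ n`.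
  refine ⟨12621 + C + 4 / c, 9 / 10, c, 12, ?_, by norm_num, by norm_num, hc, hc1, by norm_num, ?_⟩
  · have : 0 < 4 / c := by positivity
    linarith
  intro n q r mt Lt ρ L m hn hr hLt hρ hL hm p D hκ hμ hinc τ hτ hτ2 δ hδ hδ1 Cs Cpow Cgm hCs hCpow
    hCgm Tpow Tgm hTpow hTgm S _ ν _ gm εc cgm hε hε1 hcgm hpath hsample
  have hc4 : 0 < 4 / c := by positivity
  have hκ1 : 1 ≤ p.κ := by rw [hκ]; exact D.one_le_kappa hr
  have hκ2 : 1 ≤ p.κ ^ 2 := one_le_pow₀ hκ1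
  have hn2 : (2 : ℝ) ≤ n := by exact_mod_cast hn
  have hLt1 : (1 : ℝ) ≤ Lt := by exact_mod_cast hLt
  have hρ1 : (1 : ℝ) ≤ ρ := by exact_mod_cast hρ
  have hr0 : (0 : ℝ) < r := by exact_mod_cast hr
  have hL' : (L : ℝ) = Lt * ρ := by rw [hL]; push_cast; ring
  have hLtL : (Lt : ℝ) ≤ L := by rw [hL']; nlinarith
  have hLtL' : Lt ≤ L := by exact_mod_cast hLtL
  have hL1 : (1 : ℝ) ≤ L := hLt1.trans hLtL
  have hL1' : 1 ≤ L := by exact_mod_cast hL1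
  have hτL : τ * L < 0.4 * Lt := by rwa [lt_div_iff₀ (by linarith)] at hτ2
  have hbyz : (p.byz.card : ℝ) < 0.4 * Lt := hτ.trans_lt hτL
  have hτ0 : 0 ≤ τ := nonneg_of_mul_nonneg_left ((Nat.cast_nonneg _).trans hτ) (by linarith)
  have hlogn : Real.log 2 ≤ Real.log n := Real.log_le_log two_pos hn2
  have hlog2 := Real.log_two_gt_d9
  have hlog : Real.log n ≤ Real.log (n / δ) := by
    apply Real.log_le_log (by linarith)
    rw [le_div_iff₀ hδ]
    nlinarith
  have hμ0 : 0 < p.μ := by linarith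
  have hκ0 : 0 < p.κ := by linarith
  set B : ℝ := mt * q * δ ^ 2 / (r ^ 2 * p.κ ^ 4 * p.μ ^ 2) with hB
  have hB0 : 0 ≤ B := by positivity
  have hEB : ρ * mt * q * δ ^ 2 / (r ^ 2 * p.κ ^ 4 * p.μ ^ 2) = ρ * B := by rw [hB]; ring
  have hE : Cs * (n + q) ≤ ρ * mt * q * δ ^ 2 / (r ^ 2 * p.κ ^ 4 * p.μ ^ 2) := by
    refine ByzLRCS.le_sample_ratio (by linarith) hκ1 hμ0 hr0 hδ (lt_of_lt_of_le one_pos hLt1)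
      (by positivity) ?_
    rwa [hm, Nat.cast_mul, hL'] at hsample
  have hnq : (0 : ℝ) ≤ n + q := by positivity
  have hCE : C * (n + q) ≤ ρ * mt * q * δ ^ 2 / (r ^ 2 * p.κ ^ 4 * p.μ ^ 2) :=
    le_trans (by gcongr; linarith) hE
  set x := Cpow * p.κ ^ 2 * Real.log (n / δ) with hx
  have hlog0 : 0 ≤ Real.log (n / δ) := by linarith
  have hCpow0 : 0 ≤ Cpow := by linarith
  have hxlog : ∀ y, 0 ≤ y → y ≤ Cpow → y * Real.log n ≤ x := by
    intro y hy0 hy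
    calc y * Real.log n ≤ Cpow * Real.log (n / δ) := by gcongr
      _ = Cpow * 1 * Real.log (n / δ) := by ring
      _ ≤ x := by rw [hx]; gcongr
  have hx1 : 1 ≤ x := by
    have := hxlog 12621 (by norm_num) (by linarith)
    linarith
  have hxT : x ≤ Tpow := by rw [hTpow]; exact Nat.le_ceil _
  obtain ⟨T, rfl⟩ : ∃ T, Tpow = T + 1 := by
    refine ⟨Tpow - 1, ?_⟩
    have : (1 : ℝ) ≤ Tpow := hx1.trans hxT
    have : 1 ≤ Tpow := by exact_mod_cast this
    omega
  have hTgm' : Cgm * Real.log (L * r / δ) ≤ Tgm := by rw [hTgm]; exact Nat.le_ceil _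
  have hbound : ∀ s : ℕ, 1 ≤ s → 36 * (s : ℝ) ≤ Cpow → _ := fun s hs hsC =>
    hsuccess p D hr hLt hκ hμ hinc hbyz δ hδ hδ1 hCE (1 / (80 * (n : ℝ) ^ (10 * s))) T
      (by positivity)
      ((div_le_one (by positivity)).2 (by
        have : (1 : ℝ) ≤ (n : ℝ) ^ (10 * s) := one_le_pow₀ (by linarith)
        linarith))
      (ByzLRCS.start_error_le_pow hn hs ((hxlog _ (by positivity) hsC).trans hxT))
      L Cgm Tgm hLtL (by linarith) hTgm' ν gm εc cgm hε1 hcgm hpath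
  have hη : ∀ s : ℕ, 40 * (1 / (80 * (n : ℝ) ^ (10 * s))) = 1 / (2 * (n : ℝ) ^ (10 * s)) := by
    intro s
    field_simp
    norm_num
  refine ⟨?_, fun hCsL hCpowL => ?_, fun w ℓ => ?_⟩
  · have h := hbound 1 le_rfl (by push_cast; linarith)
    rw [hη, hEB] at h
    refine le_trans ?_ h
    have h1 : 1 / (2 * (n : ℝ) ^ (10 * 1)) ≤ 1 / (n : ℝ) ^ 10 := by
      apply one_div_le_one_div_of_le (by positivity)
      have : (0 : ℝ) < (n : ℝ) ^ (10 * 1) := by positivity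
      rw [mul_one] at this ⊢
      linarith
    have h2 : Lt * Real.exp (-(c * (ρ * B))) ≤
        L * Real.exp (-(c * mt * q * δ ^ 2 / (r ^ 2 * p.κ ^ 4 * p.μ ^ 2))) := by
      rw [show c * mt * q * δ ^ 2 / (r ^ 2 * p.κ ^ 4 * p.μ ^ 2) = c * B by rw [hB]; ring]
      gcongr
      exact le_mul_of_one_le_left hB0 hρ1
    -- In the first claim the large deviation term is only needed to be nonnegative.
    have h3 := Real.exp_nonneg (-(Lt * ByzLRCS.psi (0.4 - τ * L / Lt)
      (Real.exp (-(9 / 10 * ((n : ℝ) + q))) + 1 / (n : ℝ) ^ 10)))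
    linarith
  · have h36 : 36 * (L : ℝ) ≤ Cpow := by
      refine le_trans (mul_le_mul_of_nonneg_right ?_ (by linarith)) hCpowL
      linarith
    have h := hbound L hL1' h36
    rw [hη] at h
    refine le_trans ?_ h
    have ha : (0 : ℝ) < 0.4 - τ := by
      have : τ * L < 0.4 * L := hτL.trans_le (by gcongr)
      linarith [lt_of_mul_lt_mul_right this (by linarith)]
    have hx4 : 4 * L * (n + q) ≤
        c * (ρ * mt * q * δ ^ 2 / (r ^ 2 * p.κ ^ 4 * p.μ ^ 2)) := by
      have h3 : 4 / c * L ≤ Cs := by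
        refine le_trans (mul_le_mul_of_nonneg_right ?_ (by linarith)) hCsL
        linarith
      calc 4 * (L : ℝ) * (n + q) = c * (4 / c * L * (n + q)) := by field_simp
        _ ≤ c * (Cs * (n + q)) :=
          mul_le_mul_of_nonneg_left (mul_le_mul_of_nonneg_right h3 hnq) hc.le
        _ ≤ _ := mul_le_mul_of_nonneg_left hE hc.le
    -- Here it dominates both the sampling and the start error, so the last exponential of the
    -- second claim is slack.
    have h1 := ByzLRCS.error_le_exp_neg_mul_psi hn hL1' hLtL' ha (by linarith) hx4
    have h2 : 0 ≤ L * Real.exp (-(c * mt * q * δ ^ 2 / (r ^ 2 * p.κ ^ 4))) := by positivity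
    linarith
  · rw [p.commCost_eq]
    obtain ⟨h1, h2⟩ := ByzLRCS.commCost_bounds (q := q) hn hr hx1 hTpow
    have e1 : Cpow * p.κ ^ 2 * (n + q) * r * Real.log (n / δ) = x * ((n + q) * r) := by
      rw [hx]; ring
    have h0 : 0 ≤ x * (((n : ℝ) + q) * r) := by positivity
    rw [e1]
    refine ⟨h1, by linarith, fun hqn => h2.trans ?_⟩
    have hqn' : (q : ℝ) ≤ n := by exact_mod_cast hqn
    have e2 : Cpow * p.κ ^ 2 * n * r * Real.log (n / δ) = x * (n * r) := by rw [hx]; ring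
    rw [e2]
    calc 6 * (x * (((n : ℝ) + q) * r)) ≤ 6 * (x * ((n + n) * r)) := by gcongr
      _ = 12 * (x * (n * r)) := by ring
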